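/- Let $F$ be a nonarchimedean local field, $\breve F$ the completion of its maximal unramified extension, $\sigma$ the Frobenius of $\breve F/F$, and $\Gamma_0$ the inertia group. Let $\mathbf G$ be a quasi-split connected reductive group over $F$, and let $T\subset B$ be a maximal torus and a Borel subgroup of $\mathbf G$, both defined over $F$. Put $\Lambda=X_*(T)_{\Gamma_0}$. Let $\Phi$ be the reduced root system of $\mathbf G$ relative to $\breve F$, normalised so that the affine roots are the functions $\alpha+k$ with $\alpha\in\Phi$, $k\in\mathbb Z$: the coroot attached to the $\Gamma_0$-orbit of an absolute $B$-simple root $a$ is the image of $a^\vee$ in $\Lambda$, and the corresponding simple root is the multiple of $\sum_{a'\in\Gamma_0 a}a'$ that takes the value $2$ on it. Let $W_0$ be the Weyl group of $\Phi$, $w_0$ its longest element, $\rho$ half the sum of the positive roots, and $\tilde W=\Lambda\rtimes W_0=\{t^{\lambda}x\}$ the Iwahori–Weyl group, with the length function $\ell$ and the Bruhat order $\leqslant$ defined by the base alcove $\{v: 0<\langle v,\alpha\rangle<1 \text{ for all }\alpha\in\Phi^+\}$. The Frobenius acts on $\Lambda$ and on $W_0$, again denoted by $\sigma$. Let $b\in\mathbf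 G(\breve F)$ with Newton point $\nu_b\in\Lambda\otimes\mathbb Q$ (dominant representative), and let $\mathrm{def}_{\mathbf G}(b)=\mathrm{rank}_F\mathbf G-\mathrm{rank}_F\mathbf J_b$ be its defect, where $\mathbf J_b(R)=\{g\in\mathbf G(\breve F\otimes_F R): g\,b\,\sigma(g)^{-1}=b\}$. Each $w\in\tilde W$ can be written uniquely as $w=x t^{\lambda}y$ with $\lambda\in\Lambda$ dominant, $x,y\in W_0$ and $t^\lambda y$ of minimal length in $W_0t^{\lambda}y$; put $\eta_\sigma(w)=\sigma^{-1}(y)x$ and define the virtual dimension $$d_w(b)=\tfrac12\bigl(\ell(w)+\ell(\eta_\sigma(w))-\mathrm{def}_{\mathbf G}(b)\bigr)-\langle\nu_b,\rho\rangle .$$ Let $\underline\mu\in\Lambda$ be the image of the dominant representative of a conjugacy class $\mu$ of cocharacters of $\mathbf G$, and let $\mathrm{Adm}(\mu)=\{w\in\tilde W: w\leqslant t^{x(\underline\mu)}\text{ for some }x\in W_0\}$. Assume that $\underline\mu$ is superregular: for every irreducible component $\Phi_i$ of $\Phi$, with Weyl group $W_{0,i}$ and longest element $w_{0,i}$, and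 for every simple root $\alpha$ in $\Phi_i$, $$\langle\underline\mu,\alpha\rangle\ \ge\ \begin{cases}4\ell(w_{0,i})+2,&\Phi_i\text{ not of type }G_2,\\ 5\ell(w_{0,i})+3,&\Phi_i\text{ of type }G_2.\end{cases}$$ For $x,y\in W_0$ let $d_\Gamma(x,y)$ be the minimal length of a directed path from $x$ to $y$ in the quantum Bruhat graph: its vertices are the elements of $W_0$, and for $\alpha\in\Phi^+$ there is an edge $w\to ws_\alpha$ whenever $\ell(ws_\alpha)=\ell(w)+1$ or $\ell(ws_\alpha)=\ell(w)-\langle\alpha^\vee,2\rho\rangle+1$. Then the maximum of $d_w(b)$ over $w\in\mathrm{Adm}(\mu)$ exists and $$\max_{w\in\mathrm{Adm}(\mu)}d_w(b)=\langle\underline\mu-\nu_b,\rho\rangle-\tfrac12\,\mathrm{def}_{\mathbf G}(b)+\tfrac12\,\ell(w_0)-\tfrac12\min\{d_\Gamma(x,\sigma(x)w_0):x\in W_0\}.$$ -/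

import Mathlib

universe u

/-- Simple roots and simple coroots in a finitely generated abelian group `Λ` (possibly with torsion),
with the normalisation `⟨α_i^∨, α_i⟩ = 2`. All the combinatorial objects below (finite Weyl group,
roots, extended affine Weyl group, lengths, Bruhat order, quantum Bruhat graph) are built from it.
The same root may be listed several times. -/
structure SimpleRoots (Λ : Type*) [AddCommGroup Λ] (I : Type*) where
  root : I → Module.Dual ℤ Λ
  coroot : I → Λ
  root_coroot_two : ∀ i, root i (coroot i) = 2

namespace SimpleRoots

variable {Λ : Type*} [AddCommGroup Λ] {I : Type*} (S : SimpleRoots Λ I)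

/-- The simple reflection `s_i : λ ↦ λ - ⟨λ, α_i⟩ α_i^∨`. -/
noncomputable def simpleReflection (i : I) : Λ ≃ₗ[ℤ] Λ :=
  Module.reflection (S.root_coroot_two i)

/-- The finite Weyl group `W₀`, generated by the simple reflections. -/
def W₀ : Subgroup (Λ ≃ₗ[ℤ] Λ) := Subgroup.closure (Set.range S.simpleReflection)

/-- Pairs (root, coroot). -/
abbrev Pair (Λ : Type*) [AddCommGroup Λ] : Type _ := Module.Dual ℤ Λ × Λ

/-- The action of an automorphism `g` of `Λ` on pairs (root, coroot):
`(α, α^∨) ↦ (α ∘ g⁻¹, g α^∨)`. -/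
def movePair (g : Λ ≃ₗ[ℤ] Λ) (r : Pair Λ) : Pair Λ := (r.1 ∘ₗ g.symm.toLinearMap, g r.2)

/-- The root system `Φ`: the `W₀`-orbits of the simple roots, each root together with its coroot. -/
def roots : Set (Pair Λ) :=
  {r | ∃ g ∈ S.W₀, ∃ i, r = movePair g (S.root i, S.coroot i)}

/-- A functional is positive if it is a sum of simple roots. -/
def IsPos (α : Module.Dual ℤ Λ) : Prop := α ∈ AddSubmonoid.closure (Set.range S.root)

/-- The positive roots `Φ⁺`. -/
def posRoots : Set (Pair Λ) := {r ∈ S.roots | S.IsPos r.1}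

/-- `2ρ`, the sum of the positive roots. -/
noncomputable def twoRho : Module.Dual ℤ Λ := ∑ᶠ r ∈ S.posRoots, r.1

/-- The pairing `⟨·, ρ⟩` on `Λ ⊗ ℚ`, where `ρ` is half the sum of the positive roots. -/
noncomputable def pairRho : TensorProduct ℤ ℚ Λ →ₗ[ℤ] ℚ :=
  TensorProduct.lift
    (LinearMap.mk₂ ℤ (fun (q : ℚ) (l : Λ) => q * ((S.twoRho l : ℤ) : ℚ) / 2)
      (by intros; ring) (by intros; simp; ring) (by intros; simp; ring) (by intros; simp; ring))

/-- The length of `u ∈ W₀`: the number of positive roots that `u` makes negative. -/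
noncomputable def length₀ (u : S.W₀) : ℕ :=
  {r ∈ S.posRoots | S.IsPos (-(movePair u.1 r).1)}.ncard

/-- The longest element `w₀` of `W₀`. -/
noncomputable def longest : S.W₀ :=
  Classical.epsilon fun w => ∀ x, S.length₀ x ≤ S.length₀ w

/-- `λ` is dominant: `⟨λ, α⟩ ≥ 0` for all simple roots `α`. -/
def IsDominant (l : Λ) : Prop := ∀ i, 0 ≤ S.root i l

/-- `u` is the reflection `s_α : λ ↦ λ - ⟨λ, α⟩ α^∨` of the root `α`. -/
def IsReflection (u : S.W₀) (r : Pair Λ) : Prop := ∀ l, u.1 l = l - r.1 l • r.2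

/-! ### The quantum Bruhat graph -/

/-- Upward edges `x ⇀ x s_α`: `ℓ(x s_α) = ℓ(x) + 1`. -/
def UpEdge (x y : S.W₀) : Prop :=
  ∃ r ∈ S.posRoots, ∃ s, S.IsReflection s r ∧ y = x * s ∧ S.length₀ y = S.length₀ x + 1

/-- Downward edges `x ⇁ x s_α`: `ℓ(x s_α) = ℓ(x) - ⟨α^∨, 2ρ⟩ + 1`. -/
def DownEdge (x y : S.W₀) : Prop :=
  ∃ r ∈ S.posRoots, ∃ s, S.IsReflection s r ∧ y = x * s ∧
    (S.length₀ y : ℤ) = S.length₀ x - S.twoRho r.2 + 1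

/-- There is a directed path with `n` edges from `x` to `y` in the quantum Bruhat graph. -/
def HasPath (x y : S.W₀) (n : ℕ) : Prop :=
  ∃ p : ℕ → S.W₀, p 0 = x ∧ p n = y ∧
    ∀ k < n, S.UpEdge (p k) (p (k + 1)) ∨ S.DownEdge (p k) (p (k + 1))

/-- `d_Γ(x, y)`: the minimal length of a directed path from `x` to `y`. -/
noncomputable def dΓ (x y : S.W₀) : ℕ := sInf {n | S.HasPath x y n}

/-! ### The Iwahori–Weyl group `W̃ = Λ ⋊ W₀` -/

/-- The action of `W₀` on `Λ`, written multiplicatively. -/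
def act : S.W₀ →* MulAut (Multiplicative Λ) where
  toFun u := AddEquiv.toMultiplicative u.1.toAddEquiv
  map_one' := rfl
  map_mul' _ _ := rfl

/-- The Iwahori–Weyl group `W̃ = Λ ⋊ W₀`. -/
abbrev Wext : Type _ := Multiplicative Λ ⋊[S.act] S.W₀

/-- The translation element `t^λ`. -/
def t (l : Λ) : S.Wext := SemidirectProduct.inl (Multiplicative.ofAdd l)

/-- The inclusion `W₀ ⊂ W̃`. -/
def incl (u : S.W₀) : S.Wext := SemidirectProduct.inr u

/-- The affine roots: `(α, k)` stands for the affine function `v ↦ ⟨v, α⟩ + k`. -/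
def affRoots : Set (Pair Λ × ℤ) := {a | a.1 ∈ S.roots}

/-- Affine roots that are positive on the base alcove `{v | 0 < ⟨v, α⟩ < 1 for all α ∈ Φ⁺}`. -/
def AffPos (a : Pair Λ × ℤ) : Prop := 0 < a.2 ∨ (a.2 = 0 ∧ S.IsPos a.1.1)

/-- Affine roots that are negative on the base alcove. -/
def AffNeg (a : Pair Λ × ℤ) : Prop := a.2 < 0 ∨ (a.2 = 0 ∧ S.IsPos (-a.1.1))

/-- The action `f ↦ f ∘ w⁻¹` of `w = t^λ u` on affine functions `f = α + k`; here
`w⁻¹ v = u⁻¹ (v - λ)`. -/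
def moveAff (w : S.Wext) (a : Pair Λ × ℤ) : Pair Λ × ℤ :=
  (movePair w.right.1 a.1, a.2 - (movePair w.right.1 a.1).1 (Multiplicative.toAdd w.left))

/-- The length of `w ∈ W̃`: the number of positive affine roots that `w` makes negative, that is,
the number of affine root hyperplanes between the base alcove and its translate. -/
noncomputable def length (w : S.Wext) : ℕ :=
  {a ∈ S.affRoots | S.AffPos a ∧ S.AffNeg (S.moveAff w a)}.ncard

/-- The affine reflections `t^{k α^∨} s_α`, `α ∈ Φ`, `k ∈ ℤ`. -/
def affReflections : Set S.Wext :=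
  {w | ∃ r ∈ S.roots, ∃ k : ℤ, ∃ s, S.IsReflection s r ∧ w = S.t (k • r.2) * S.incl s}

/-- The Bruhat order on `W̃`, generated by `w < r w` for affine reflections `r` with
`ℓ(w) < ℓ(r w)`. -/
def BruhatLE : S.Wext → S.Wext → Prop :=
  Relation.ReflTransGen fun w w' =>
    ∃ r ∈ S.affReflections, w' = r * w ∧ S.length w < S.length w'

/-- The admissible set `Adm(μ) = {w | w ≤ t^{x(μ)} for some x ∈ W₀}`. -/
def Adm (μ : Λ) : Set S.Wext := {w | ∃ x : S.W₀, S.BruhatLE w (S.t (x.1 μ))}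

/-! ### Superregular elements -/

/-- The simple roots `α_i`, `α_j` lie in the same irreducible component. -/
def SameComponent : I → I → Prop :=
  Relation.EqvGen fun i j => S.root j (S.coroot i) ≠ 0

/-- The maximal length `ℓ(w_{0,i})` in the irreducible factor of `W₀` that contains `s_i`. -/
noncomputable def componentLength (i : I) : ℕ :=
  sSup {n | ∃ u : S.W₀, n = S.length₀ u ∧
    u.1 ∈ Subgroup.closure (S.simpleReflection '' {j | S.SameComponent i j})}

/-- The irreducible component of `α_i` is of type `G₂`: it has a triple bond. -/
def ComponentIsG₂ (i : I) : Prop :=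
  ∃ j k, S.SameComponent i j ∧ S.SameComponent i k ∧ S.root j (S.coroot k) = -3

open Classical in
/-- `μ` is superregular: on every irreducible component, with longest element `w_{0,i}`, the depth of
`μ` is at least `4 ℓ(w_{0,i}) + 2`, respectively `5 ℓ(w_{0,i}) + 3` in type `G₂`. -/
def IsSuperregular (μ : Λ) : Prop :=
  ∀ i, (if S.ComponentIsG₂ i then 5 * (S.componentLength i : ℤ) + 3
    else 4 * (S.componentLength i : ℤ) + 2) ≤ S.root i μ

/-! ### Automorphisms -/

/-- An automorphism of `Λ` that permutes the simple roots and the simple coroots compatibly. -/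
def IsAut (g : Λ ≃ₗ[ℤ] Λ) : Prop :=
  ∃ π : Equiv.Perm I, (∀ i, g (S.coroot i) = S.coroot (π i)) ∧
    ∀ i l, S.root (π i) (g l) = S.root i l

variable {S} in
theorem IsAut.conj_simple {g : Λ ≃ₗ[ℤ] Λ} {π : Equiv.Perm I}
    (h1 : ∀ i, g (S.coroot i) = S.coroot (π i)) (h2 : ∀ i l, S.root (π i) (g l) = S.root i l)
    (i : I) : g * S.simpleReflection i * g⁻¹ = S.simpleReflection (π i) := by
  ext l
  have h3 : S.root i (g.symm l) = S.root (π i) l := by rw [← h2, g.apply_symm_apply]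
  change g (S.simpleReflection i (g.symm l)) = _
  simp [simpleReflection, Module.reflection_apply, h1, h3]

variable {S} in
theorem IsAut.map_W₀ {g : Λ ≃ₗ[ℤ] Λ} (hg : S.IsAut g) :
    S.W₀.map (MulAut.conj g).toMonoidHom = S.W₀ := by
  obtain ⟨π, h1, h2⟩ := hg
  rw [W₀, MonoidHom.map_closure]
  congr 1
  ext x
  constructor
  · rintro ⟨_, ⟨i, rfl⟩, rfl⟩
    exact ⟨π i, (IsAut.conj_simple h1 h2 i).symm⟩
  · rintro ⟨i, rfl⟩
    refine ⟨_, ⟨π.symm i, rfl⟩, ?_⟩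
    have := IsAut.conj_simple h1 h2 (π.symm i)
    rwa [π.apply_symm_apply] at this

/-- The automorphism `x ↦ g x g⁻¹` of `W₀` induced by an automorphism `g` of the simple roots. -/
noncomputable def conjW₀ (g : Λ ≃ₗ[ℤ] Λ) (hg : S.IsAut g) : S.W₀ ≃* S.W₀ :=
  ((MulAut.conj g).subgroupMap S.W₀).trans (MulEquiv.subgroupCongr hg.map_W₀)

theorem conjW₀_coe (g : Λ ≃ₗ[ℤ] Λ) (hg : S.IsAut g) (x : S.W₀) :
    (S.conjW₀ g hg x : Λ ≃ₗ[ℤ] Λ) = g * x * g⁻¹ := rfl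

/-! ### The element `η_σ(w)` -/

/-- `w = x t^λ y` with `λ` dominant, `x, y ∈ W₀`, and `t^λ y` of minimal length in `W₀ t^λ y`. -/
def IsStandardForm (w : S.Wext) (x : S.W₀) (l : Λ) (y : S.W₀) : Prop :=
  w = S.incl x * S.t l * S.incl y ∧ S.IsDominant l ∧
    ∀ u : S.W₀, S.length (S.t l * S.incl y) ≤ S.length (S.incl u * (S.t l * S.incl y))

/-- `η_σ(w) = σ⁻¹(y) x`, where `w = x t^λ y` is the standard form (which exists and is unique). -/
noncomputable def η (σ : S.W₀ ≃* S.W₀) (w : S.Wext) : S.W₀ :=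
  Classical.epsilon fun z => ∃ x l y, S.IsStandardForm w x l y ∧ z = σ.symm y * x

end SimpleRoots

/-! ## Based root data with Galois action -/

/-- `g` is (the action on cocharacters of) an automorphism of the based root datum `(P, b)`. -/
def IsBasedAut {ι X Y : Type*} [AddCommGroup X] [AddCommGroup Y] (P : RootPairing ι ℤ X Y)
    (b : P.Base) (g : Y ≃ₗ[ℤ] Y) : Prop :=
  ∃ π : Equiv.Perm ι, (∀ i, g (P.coroot i) = P.coroot (π i)) ∧
    (∀ i y, P.root' (π i) (g y) = P.root' i y) ∧ ∀ i, π i ∈ b.support ↔ i ∈ b.support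

/-- A reduced based root datum `(X, Φ, Y, Φ^∨, Δ)`, with `Y` in the role of the cocharacter group
`X_*(T)`, together with the action of a Galois group on it: `inertia` is the group of automorphisms of
`Y` by which the inertia group acts and `frob` is the automorphism by which a Frobenius element acts. -/
structure GaloisRootDatum (ι X Y : Type*) [Finite ι] [AddCommGroup X] [AddCommGroup Y]
    [Module.Finite ℤ Y] where
  P : RootPairing ι ℤ X Y
  reduced : P.IsReduced
  base : P.Base
  inertia : Subgroup (Y ≃ₗ[ℤ] Y)
  frob : Y ≃ₗ[ℤ] Y
  inertia_aut : ∀ g ∈ inertia, IsBasedAut P base g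
  frob_aut : IsBasedAut P base frob
  frob_normalizes : ∀ g, frob * g * frob⁻¹ ∈ inertia ↔ g ∈ inertia

namespace GaloisRootDatum

variable {ι X Y : Type*} [Finite ι] [AddCommGroup X] [AddCommGroup Y] [Module.Finite ℤ Y]
  (D : GaloisRootDatum ι X Y)

/-- The span of the elements `g y - y`, `g` in the inertia group. -/
def augmentation : Submodule ℤ Y :=
  Submodule.span ℤ {z | ∃ g ∈ D.inertia, ∃ y, z = g y - y}

/-- The coinvariants `X_*(T)_{Γ₀}` of the inertia group. -/
abbrev Coinv : Type _ := Y ⧸ D.augmentation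

open Classical in
/-- The orbit of a simple root under the inertia group. -/
noncomputable def orbit (i : D.base.support) : Finset D.base.support :=
  Finset.univ.filter fun j => ∃ g ∈ D.inertia, g (D.P.coroot i) = D.P.coroot j

theorem mem_orbit {i j : D.base.support} :
    j ∈ D.orbit i ↔ ∃ g ∈ D.inertia, g (D.P.coroot i) = D.P.coroot j := by
  simp [orbit]

theorem orbit_eq {i j : D.base.support} (h : j ∈ D.orbit i) : D.orbit j = D.orbit i := by
  obtain ⟨g, hg, hij⟩ := D.mem_orbit.1 h
  ext k
  rw [mem_orbit, mem_orbit]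
  constructor
  · rintro ⟨g', hg', h'⟩
    exact ⟨g' * g, mul_mem hg' hg, by rw [LinearEquiv.mul_apply, hij, h']⟩
  · rintro ⟨g', hg', h'⟩
    refine ⟨g' * g⁻¹, mul_mem hg' (inv_mem hg), ?_⟩
    rw [← hij, LinearEquiv.mul_apply, ← LinearEquiv.mul_apply (g⁻¹) g, inv_mul_cancel]
    exact h'

theorem self_mem_orbit (i : D.base.support) : i ∈ D.orbit i :=
  D.mem_orbit.2 ⟨1, one_mem _, rfl⟩

/-- A based automorphism permutes the simple roots. -/
theorem exists_perm {g : Y ≃ₗ[ℤ] Y} (hg : IsBasedAut D.P D.base g) :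
    ∃ π : Equiv.Perm D.base.support, (∀ i : D.base.support, g (D.P.coroot i) = D.P.coroot (π i)) ∧
      ∀ (i : D.base.support) y, D.P.root' (π i) (g y) = D.P.root' i y := by
  obtain ⟨π, h1, h2, h3⟩ := hg
  refine ⟨π.subtypePerm h3, fun i => ?_, fun i y => ?_⟩
  · simpa using h1 i
  · simpa using h2 i y

/-- If `g` normalises the inertia group then its permutation of the simple roots maps orbits to
orbits. -/
theorem perm_mem_orbit {g : Y ≃ₗ[ℤ] Y} (hn : ∀ h, g * h * g⁻¹ ∈ D.inertia ↔ h ∈ D.inertia)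
    {π : Equiv.Perm D.base.support} (h1 : ∀ i : D.base.support, g (D.P.coroot i) = D.P.coroot (π i))
    {i j : D.base.support} : π j ∈ D.orbit (π i) ↔ j ∈ D.orbit i := by
  rw [mem_orbit, mem_orbit]
  constructor
  · rintro ⟨h, hh, e⟩
    refine ⟨g⁻¹ * h * g, ?_, ?_⟩
    · rw [← hn]; simpa [mul_assoc] using hh
    · change g.symm (h (g (D.P.coroot i))) = _
      rw [h1, e, ← h1, g.symm_apply_apply]
  · rintro ⟨h, hh, e⟩
    refine ⟨g * h * g⁻¹, (hn h).2 hh, ?_⟩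
    change g (h (g.symm _)) = _
    rw [← h1, g.symm_apply_apply, e, h1]

theorem inertia_normalizes {g : Y ≃ₗ[ℤ] Y} (hg : g ∈ D.inertia) (h : Y ≃ₗ[ℤ] Y) :
    g * h * g⁻¹ ∈ D.inertia ↔ h ∈ D.inertia := by
  rw [D.inertia.mul_mem_cancel_right (inv_mem hg), D.inertia.mul_mem_cancel_left hg]

/-- The sum of the roots in the orbit of a simple root, as a functional on `Y`. -/
noncomputable def orbitSum (i : D.base.support) : Module.Dual ℤ Y :=
  ∑ j ∈ D.orbit i, D.P.root' j

theorem orbitSum_perm {g : Y ≃ₗ[ℤ] Y} (hn : ∀ h, g * h * g⁻¹ ∈ D.inertia ↔ h ∈ D.inertia)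
    {π : Equiv.Perm D.base.support} (h1 : ∀ i : D.base.support, g (D.P.coroot i) = D.P.coroot (π i))
    (h2 : ∀ (i : D.base.support) y, D.P.root' (π i) (g y) = D.P.root' i y) (i : D.base.support) (y : Y) :
    D.orbitSum (π i) (g y) = D.orbitSum i y := by
  simp only [orbitSum, LinearMap.sum_apply]
  symm
  refine Finset.sum_equiv π (fun j => (D.perm_mem_orbit hn h1).symm) fun j _ => (h2 j y).symm

theorem orbitSum_inertia {g : Y ≃ₗ[ℤ] Y} (hg : g ∈ D.inertia) (i : D.base.support) (y : Y) :
    D.orbitSum i (g y) = D.orbitSum i y := by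
  obtain ⟨π, h1, h2⟩ := D.exists_perm (D.inertia_aut g hg)
  rw [← D.orbitSum_perm (D.inertia_normalizes hg) h1 h2 i y]
  have : π i ∈ D.orbit i := D.mem_orbit.2 ⟨g, hg, h1 i⟩
  simp only [orbitSum, D.orbit_eq this]

theorem orbitSum_coroot_of_mem {i j : D.base.support} (h : j ∈ D.orbit i) :
    D.orbitSum i (D.P.coroot j) = D.orbitSum i (D.P.coroot i) := by
  obtain ⟨g, hg, e⟩ := D.mem_orbit.1 h
  rw [← e, D.orbitSum_inertia hg]

theorem orbitSum_coroot_le (i : D.base.support) : D.orbitSum i (D.P.coroot i) ≤ 2 := by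
  classical
  have h0 : D.P.root' i (D.P.coroot i) = 2 := D.P.root_coroot_two i
  rw [orbitSum, LinearMap.sum_apply, ← Finset.add_sum_erase _ _ (D.self_mem_orbit i), h0]
  have : ∑ j ∈ (D.orbit i).erase i, D.P.root' j (D.P.coroot i) ≤ 0 := by
    refine Finset.sum_nonpos fun j hj => ?_
    have hne : (j : ι) ≠ i := fun h => (Finset.mem_erase.1 hj).1 (Subtype.ext h)
    have := D.base.pairingIn_le_zero_of_ne hne j.2 i.2
    have e : D.P.pairingIn ℤ j i = D.P.pairing j i := by
      simpa using D.P.algebraMap_pairingIn ℤ j i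
    rw [e] at this
    exact this
  linarith

theorem orbitSum_coroot_pos (i : D.base.support) : 0 < D.orbitSum i (D.P.coroot i) := by
  classical
  have := Fintype.ofFinite ι
  set s : X := ∑ j ∈ D.orbit i, D.P.root j with hs
  have hsp : ∀ y, D.P.toLinearMap s y = D.orbitSum i y := by
    intro y; simp [hs, orbitSum]
  have hmem : s ∈ D.P.rootSpan ℤ :=
    Submodule.sum_mem _ fun j _ => Submodule.subset_span ⟨j, rfl⟩
  have hne : s ≠ 0 := by
    intro h0
    have hli : LinearIndependent ℤ fun j : D.base.support => D.P.root j :=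
      D.base.linearIndepOn_root
    have := linearIndependent_iff'.1 hli (D.orbit i) (fun _ => 1)
      (by simpa [hs] using h0) i (D.self_mem_orbit i)
    exact one_ne_zero this
  have hpos : 0 < D.P.RootForm s s := by
    have h1 := D.P.posRootForm_posForm_pos_of_ne_zero ℤ (x := ⟨s, hmem⟩)
      (fun h => hne (congrArg Subtype.val h))
    have h2 := D.P.algebraMap_posRootForm_posForm ℤ ⟨s, hmem⟩ ⟨s, hmem⟩
    simp only [algebraMap_int_eq, eq_intCast, Int.cast_id] at h2
    rwa [h2] at h1
  have hlen : ∀ j ∈ D.orbit i, D.P.RootForm (D.P.root j) (D.P.root j) =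
      D.P.RootForm (D.P.root i) (D.P.root i) := by
    intro j hj
    obtain ⟨g, hg, e⟩ := D.mem_orbit.1 hj
    obtain ⟨π, h1, h2, -⟩ := D.inertia_aut g hg
    have hπ : π i = j := D.P.coroot.injective (by rw [← h1, e])
    rw [D.P.rootForm_apply_apply, D.P.rootForm_apply_apply]
    symm
    refine Fintype.sum_equiv π _ _ fun k => ?_
    have : D.P.coroot' (π k) (D.P.root j) = D.P.coroot' k (D.P.root i) := by
      have := h2 i (D.P.coroot k)
      rw [h1, hπ] at this
      simpa using this
    rw [this]
  have hj : ∀ j ∈ D.orbit i, 2 * D.P.RootForm s (D.P.root j) =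
      D.orbitSum i (D.P.coroot i) * D.P.RootForm (D.P.root i) (D.P.root i) := by
    intro j hj
    have h3 := congrArg (fun y => D.P.toLinearMap s y) (D.P.rootForm_self_smul_coroot j)
    simp only [map_smul, map_nsmul, D.P.toLinearMap_apply_apply_Polarization, smul_eq_mul,
      nsmul_eq_mul, Nat.cast_ofNat] at h3
    rw [hlen j hj, hsp, D.orbitSum_coroot_of_mem hj] at h3
    have h4 : D.P.RootForm s (D.P.root j) = D.P.RootForm (D.P.root j) s := by
      simpa using (D.P.rootForm_symmetric.eq s (D.P.root j))
    rw [h4, ← h3, mul_comm]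
  have hsum : 2 * D.P.RootForm s s = (D.orbit i).card *
      (D.orbitSum i (D.P.coroot i) * D.P.RootForm (D.P.root i) (D.P.root i)) := by
    conv_lhs => rw [hs]; rw [map_sum]
    rw [Finset.mul_sum, ← hs, Finset.sum_congr rfl hj, Finset.sum_const, nsmul_eq_mul]
  have hnn : 0 ≤ D.P.RootForm (D.P.root i) (D.P.root i) := by
    rw [D.P.rootForm_apply_apply]
    exact Finset.sum_nonneg fun k _ => mul_self_nonneg _
  by_contra hle
  push Not at hle
  have : ((D.orbit i).card : ℤ) *
      (D.orbitSum i (D.P.coroot i) * D.P.RootForm (D.P.root i) (D.P.root i)) ≤ 0 :=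
    mul_nonpos_of_nonneg_of_nonpos (by positivity) (mul_nonpos_of_nonpos_of_nonneg hle hnn)
  linarith

/-- The functional on `X_*(T)_{Γ₀}` induced by the sum over the orbit of a simple root. -/
noncomputable def orbitSumCoinv (i : D.base.support) : Module.Dual ℤ D.Coinv :=
  D.augmentation.liftQ (D.orbitSum i) <| by
    rw [augmentation, Submodule.span_le]
    rintro _ ⟨g, hg, y, rfl⟩
    simp [D.orbitSum_inertia hg]

/-- The simple roots and coroots of the relative root system over the completed maximal unramified
extension, normalised so that the affine roots are `α + k`, `k ∈ ℤ` (the échelonnage roots).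
The coroot attached to an inertia orbit of an absolute simple root `α` is the image of `α^∨` in
`X_*(T)_{Γ₀}`; the root is the multiple of the orbit sum of `α` whose value at this coroot is `2`.
(The factor `2 / ⟨α^∨, ∑ β⟩` is `1` or `2`. A root is listed once for each element of its orbit.) -/
noncomputable def simpleRoots : SimpleRoots D.Coinv D.base.support where
  root i := (2 / D.orbitSum i (D.P.coroot i)) • D.orbitSumCoinv i
  coroot i := D.augmentation.mkQ (D.P.coroot i)
  root_coroot_two i := by
    have h1 := D.orbitSum_coroot_le i
    have h2 := D.orbitSum_coroot_pos i
    have h3 : D.orbitSumCoinv i (D.augmentation.mkQ (D.P.coroot i)) =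
      D.orbitSum i (D.P.coroot i) := rfl
    rw [LinearMap.smul_apply, h3, smul_eq_mul]
    generalize D.orbitSum i (D.P.coroot i) = k at *
    interval_cases k <;> norm_num

theorem frob_map_augmentation :
    D.augmentation.map (D.frob : Y →ₗ[ℤ] Y) = D.augmentation := by
  rw [augmentation, Submodule.map_span]
  congr 1
  ext z
  constructor
  · rintro ⟨_, ⟨g, hg, y, rfl⟩, rfl⟩
    refine ⟨_, (D.frob_normalizes g).2 hg, D.frob y, ?_⟩
    change D.frob (g y - y) = D.frob (g (D.frob.symm (D.frob y))) - D.frob y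
    simp
  · rintro ⟨g, hg, y, rfl⟩
    refine ⟨_, ⟨D.frob⁻¹ * g * D.frob, ?_, D.frob.symm y, rfl⟩, ?_⟩
    · rw [← D.frob_normalizes]; simpa [mul_assoc] using hg
    · change D.frob (D.frob.symm (g (D.frob (D.frob.symm y))) - D.frob.symm y) = _
      simp

/-- The action of `σ` on `X_*(T)_{Γ₀}`. -/
noncomputable def σ : D.Coinv ≃ₗ[ℤ] D.Coinv :=
  Submodule.Quotient.equiv _ _ D.frob D.frob_map_augmentation

theorem σ_isAut : D.simpleRoots.IsAut D.σ := by
  obtain ⟨π, h1, h2⟩ := D.exists_perm D.frob_aut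
  refine ⟨π, fun i => ?_, fun i l => ?_⟩
  · change D.augmentation.mkQ (D.frob (D.P.coroot i)) = D.augmentation.mkQ (D.P.coroot (π i))
    rw [h1]
  · obtain ⟨y, rfl⟩ := D.augmentation.mkQ_surjective l
    have h3 := D.orbitSum_perm D.frob_normalizes h1 h2
    change (2 / D.orbitSum (π i) (D.P.coroot (π i))) * D.orbitSum (π i) (D.frob y) =
      (2 / D.orbitSum i (D.P.coroot i)) * D.orbitSum i y
    rw [h3, ← h1, h3]

/-- The action of `σ` on `W₀`. -/
noncomputable def σW : D.simpleRoots.W₀ ≃* D.simpleRoots.W₀ :=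
  D.simpleRoots.conjW₀ D.σ D.σ_isAut

end GaloisRootDatum

/-! ## Affine group schemes over a field -/

section GroupSchemes

open TensorProduct CategoryTheory Topology


/-- The set `G(R)` of `R`-valued points of the affine group scheme `G = Spec H` over `F`. -/
def Pt (F H R : Type*) [CommRing F] [CommRing H] [HopfAlgebra F H] [CommRing R] [Algebra F R] :
    Type _ := WithConv (H →ₐ[F] R)

/-- The group structure on `G(R)`: convolution, with inverse induced by the antipode. -/
noncomputable instance Pt.group (F H R : Type*) [CommRing F] [CommRing H] [HopfAlgebra F H] [CommRing R]
    [Algebra F R] : Group (Pt F H R) where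
  toMonoid := inferInstanceAs (Monoid (WithConv (H →ₐ[F] R)))
  inv g := WithConv.toConv (g.ofConv.comp (HopfAlgebra.antipodeAlgHom F H))
  inv_mul_cancel g := by
    apply WithConv.ofConv_injective
    have h1 : (Algebra.TensorProduct.lmul' F).comp (Algebra.TensorProduct.map
        (g.ofConv.comp (HopfAlgebra.antipodeAlgHom F H)) g.ofConv) =
        g.ofConv.comp ((Algebra.TensorProduct.lmul' F).comp
          (Algebra.TensorProduct.map (HopfAlgebra.antipodeAlgHom F H) (AlgHom.id F H))) := by
      ext <;> simp
    ext h
    have h2 := DFunLike.congr_fun h1 (Coalgebra.comul (R := F) h)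
    refine h2.trans ?_
    change g.ofConv _ = algebraMap F R (Coalgebra.counit h)
    rw [← g.ofConv.commutes]
    congr 1
    exact HopfAlgebra.mul_antipode_rTensor_comul_apply h

variable {F : Type u} [Field F] {H : Type u} [CommRing H] [HopfAlgebra F H]

namespace Pt

variable {R R' : Type*} [CommRing R] [Algebra F R] [CommRing R'] [Algebra F R']

/-- The homomorphism `G(R) → G(R')` induced by `f : R → R'`. -/
noncomputable def map (f : R →ₐ[F] R') : Pt F H R →* Pt F H R' where
  toFun g := WithConv.toConv (f.comp g.ofConv)
  map_one' := by
    apply WithConv.ofConv_injective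
    ext h
    change f (algebraMap F R _) = algebraMap F R' _
    simp
  map_mul' g g' := by
    apply WithConv.ofConv_injective
    exact AlgHom.comp_convMul_distrib f g g'

theorem map_apply (f : R →ₐ[F] R') (g : Pt F H R) (h : H) :
    (map f g).ofConv h = f (g.ofConv h) := rfl

theorem map_map {R'' : Type*} [CommRing R''] [Algebra F R''] (f : R →ₐ[F] R') (f' : R' →ₐ[F] R'')
    (g : Pt F H R) : map f' (map f g) = map (f'.comp f) g := rfl

/-- The `K`-linear extension `K ⊗ H → R` of an `R`-valued point, for a `K`-algebra `R`. -/
noncomputable def extend (K : Type*) [Field K] [Algebra F K] [Algebra K R] [IsScalarTower F K R]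
    (g : Pt F H R) : K ⊗[F] H →ₐ[K] R :=
  Algebra.TensorProduct.lift (Algebra.ofId K R) g.ofConv fun _ _ => Commute.all _ _

/-- The image in `G(R)` of a `K`-valued point, for a `K`-algebra `R`. -/
noncomputable def const {K : Type*} (R : Type*) [Field K] [Algebra F K] [CommRing R] [Algebra F R] [Algebra K R]
    [IsScalarTower F K R] (g : Pt F H K) : Pt F H R :=
  map (IsScalarTower.toAlgHom F K R) g

/-- The universal point of `G_K`, with values in the coordinate ring `K ⊗ H`. -/
def universal (K : Type*) [Field K] [Algebra F K] : Pt F H (K ⊗[F] H) :=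
  WithConv.toConv Algebra.TensorProduct.includeRight

end Pt

/-- A closed subgroup scheme of `G = Spec H`: an ideal of `H` such that, for every `F`-algebra `R`,
the points of `G(R)` that vanish on it form a subgroup. -/
structure ClosedSubgroupScheme (F H : Type u) [Field F] [CommRing H] [HopfAlgebra F H] where
  I : Ideal H
  one_mem : ∀ (R : Type u) [CommRing R] [Algebra F R], ∀ f ∈ I, (1 : Pt F H R).ofConv f = 0
  mul_mem : ∀ (R : Type u) [CommRing R] [Algebra F R] (g g' : Pt F H R),
    (∀ f ∈ I, g.ofConv f = 0) → (∀ f ∈ I, g'.ofConv f = 0) → ∀ f ∈ I, (g * g').ofConv f = 0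
  inv_mem : ∀ (R : Type u) [CommRing R] [Algebra F R] (g : Pt F H R),
    (∀ f ∈ I, g.ofConv f = 0) → ∀ f ∈ I, g⁻¹.ofConv f = 0

namespace ClosedSubgroupScheme

/-- The subgroup of `R`-valued points. -/
noncomputable def points (Z : ClosedSubgroupScheme F H) (R : Type u) [CommRing R] [Algebra F R] :
    Subgroup (Pt F H R) where
  carrier := {g | ∀ f ∈ Z.I, g.ofConv f = 0}
  one_mem' := Z.one_mem R
  mul_mem' := Z.mul_mem R _ _
  inv_mem' := Z.inv_mem R _

end ClosedSubgroupScheme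

/-! ### Reductive groups, tori, Borel subgroups

`Ω` is an algebraically closed extension of `F`. -/

section Reductive

variable (Ω : Type u) [Field Ω] [Algebra F Ω]

/-- The Zariski topology on `G(Ω)`, induced from the spectrum of the coordinate ring of `G_Ω`. -/
@[reducible] noncomputable def zariski : TopologicalSpace (Pt F H Ω) :=
  TopologicalSpace.induced
    (fun g => (⟨RingHom.ker (g.extend Ω), RingHom.ker_isPrime _⟩ : PrimeSpectrum (Ω ⊗[F] H)))
    inferInstance

variable {Ω} in
/-- Right translation `f ↦ (x ↦ f (x g))` on the coordinate ring of `G_Ω`. -/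
noncomputable def rightTranslation (g : Pt F H Ω) : Module.End Ω (Ω ⊗[F] H) :=
  (Pt.extend Ω
    (Pt.universal Ω * g.const (Ω ⊗[F] H))).toLinearMap

variable {Ω} in
/-- `g` is unipotent: right translation by `g`, minus the identity, is locally nilpotent on the
coordinate ring. -/
def IsUnipotent (g : Pt F H Ω) : Prop := ∀ f, ∃ n : ℕ, ((rightTranslation g - 1) ^ n) f = 0

variable (F H) in
/-- `G = Spec H` is a connected reductive group over `F`: it is smooth and connected, and every
closed connected normal unipotent subgroup of `G(Ω)` is trivial. -/
structure IsConnectedReductive : Prop where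
  smooth : Algebra.Smooth F H
  connected : @IsConnected _ (zariski Ω) (Set.univ : Set (Pt F H Ω))
  unipotentRadical : ∀ U : Subgroup (Pt F H Ω), U.Normal → IsClosed[zariski Ω] (U : Set (Pt F H Ω)) →
    @IsConnected _ (zariski Ω) (U : Set (Pt F H Ω)) → (∀ g ∈ U, IsUnipotent g) → U = ⊥

/-- `c ∈ G(K[M])` is a homomorphism over `K` from the split torus with character group `M` to `G`:
`c(x y) = c(x) c(y)`. -/
def IsTorusHom {K M : Type*} [Field K] [Algebra F K] [AddCommGroup M]
    (c : Pt F H (AddMonoidAlgebra K M)) : Prop :=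
  Pt.map (AddMonoidAlgebra.mapDomainAlgHom F K ((AddMonoidHom.id M).prod (AddMonoidHom.id M))) c =
    Pt.map (AddMonoidAlgebra.mapDomainAlgHom F K (AddMonoidHom.inl M M)) c *
      Pt.map (AddMonoidAlgebra.mapDomainAlgHom F K (AddMonoidHom.inr M M)) c

/-- `Z` is a torus: over `Ω`, some homomorphism from a split torus to `G` is an isomorphism onto `Z`. -/
def ClosedSubgroupScheme.IsTorus (Z : ClosedSubgroupScheme F H) : Prop :=
  ∃ (n : ℕ) (c : Pt F H (AddMonoidAlgebra Ω (Fin n → ℤ))), IsTorusHom c ∧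
    Function.Surjective (c.extend Ω) ∧
    RingHom.ker (c.extend Ω) =
      Z.I.map (Algebra.TensorProduct.includeRight : H →ₐ[F] Ω ⊗[F] H)

/-- `Z` is a maximal torus of the connected reductive group `G`: a torus that is equal to its own
centralizer. -/
def ClosedSubgroupScheme.IsMaximalTorus (Z : ClosedSubgroupScheme F H) : Prop :=
  Z.IsTorus Ω ∧ Subgroup.centralizer (Z.points Ω : Set (Pt F H Ω)) = Z.points Ω

/-- `Z` is a Borel subgroup: smooth, and `Z(Ω)` is maximal among the closed connected solvable
subgroups of `G(Ω)`. -/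
structure ClosedSubgroupScheme.IsBorel (Z : ClosedSubgroupScheme F H) : Prop where
  smooth : Algebra.Smooth F (H ⧸ Z.I)
  connected : @IsConnected _ (zariski Ω) (Z.points Ω : Set (Pt F H Ω))
  solvable : Group.IsSolvable (Z.points Ω)
  maximal : ∀ U : Subgroup (Pt F H Ω), IsClosed[zariski Ω] (U : Set (Pt F H Ω)) →
    @IsConnected _ (zariski Ω) (U : Set (Pt F H Ω)) → Group.IsSolvable U → Z.points Ω ≤ U →
    U = Z.points Ω

variable (F H) in
/-- A quasi-split connected reductive group `G = Spec H` over `F`, with a maximal torus `T` contained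
in a Borel subgroup `B`, both defined over `F`. -/
structure QuasiSplitGroup where
  reductive : IsConnectedReductive F H Ω
  T : ClosedSubgroupScheme F H
  B : ClosedSubgroupScheme F H
  maximalTorus : T.IsMaximalTorus Ω
  borel : B.IsBorel Ω
  T_le_B : B.I ≤ T.I

end Reductive

/-! ### Cocharacters -/

section Cocharacters

/-- The value of the coordinate `T` at a unit `x`: the homomorphism `K[T, T⁻¹] → K`, `T ↦ x`. -/
noncomputable def evalAt {K : Type*} [Field K] [Algebra F K] (x : Kˣ) :
    AddMonoidAlgebra K ℤ →ₐ[F] K :=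
  (AddMonoidAlgebra.lift K K ℤ ((Units.coeHom K).comp (zpowersHom Kˣ x))).restrictScalars F

/-- The value `c(x) ∈ G(K)` of a cocharacter `c` over `K` at `x ∈ K^×`. -/
noncomputable def cocharValue {K : Type*} [Field K] [Algebra F K]
    (c : Pt F H (AddMonoidAlgebra K ℤ)) (x : Kˣ) : Pt F H K := Pt.map (evalAt x) c

/-- Base change of cocharacters along a homomorphism of fields. -/
noncomputable def cocharMap {K K' : Type*} [Field K] [Algebra F K] [Field K'] [Algebra F K']
    (τ : K →ₐ[F] K') : Pt F H (AddMonoidAlgebra K ℤ) →* Pt F H (AddMonoidAlgebra K' ℤ) :=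
  Pt.map (AddMonoidAlgebra.mapAlgHom ℤ τ)

/-- The conjugate cocharacter `g c g⁻¹`. -/
noncomputable def cocharConj {K : Type*} [Field K] [Algebra F K] (g : Pt F H K)
    (c : Pt F H (AddMonoidAlgebra K ℤ)) : Pt F H (AddMonoidAlgebra K ℤ) :=
  g.const (AddMonoidAlgebra K ℤ) * c * (g.const (AddMonoidAlgebra K ℤ))⁻¹

variable {Ω : Type u} [Field Ω] [Algebra F Ω]

/-- The Lie algebra of `G_Ω`: the points of `G(Ω[ε])` that reduce to `1` modulo `ε`. -/
def IsTangent (ξ : Pt F H (DualNumber Ω)) : Prop :=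
  Pt.map (TrivSqZeroExt.fstHom F Ω Ω) ξ = 1

/-- Multiplication by the scalar `a` on the Lie algebra, induced by `ε ↦ a ε`. -/
noncomputable def scaleTangent (a : Ω) : Pt F H (DualNumber Ω) →* Pt F H (DualNumber Ω) :=
  Pt.map ((TrivSqZeroExt.map (a • (LinearMap.id : Ω →ₗ[Ω] Ω))).restrictScalars F)

end Cocharacters

/-! ### Split rank -/

/-- The group functor `𝔾_m^n` over `F`. -/
def gmPow (F : Type u) [Field F] (n : ℕ) : CommAlgCat.{u} F ⥤ GrpCat.{u} where
  obj R := GrpCat.of (Fin n → Rˣ)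
  map f := GrpCat.ofHom (MonoidHom.compLeft (Units.map (f.hom : _ →* _)) (Fin n))

variable (F H) in
/-- The group functor `R ↦ G(R)`. -/
noncomputable def groupFunctor : CommAlgCat.{u} F ⥤ GrpCat.{u} where
  obj R := GrpCat.of (Pt F H R)
  map f := GrpCat.ofHom (Pt.map f.hom)
  map_id _ := rfl
  map_comp _ _ := rfl

/-- The `F`-rank of a group functor over `F`: the maximal dimension of a split torus in it. -/
noncomputable def splitRank (𝓗 : CommAlgCat.{u} F ⥤ GrpCat.{u}) : ℕ :=
  sSup {n | ∃ θ : gmPow F n ⟶ 𝓗, ∀ R, Function.Injective (θ.app R)}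

section TwistedCentralizer

variable {L : Type u} [Field L] [Algebra F L] (σ : L ≃ₐ[F] L) (b : Pt F H L)

/-- `J_b(R) = {g ∈ G(L ⊗ R) | g b σ(g)⁻¹ = b}`. -/
noncomputable def twistedCentralizer (R : Type u) [CommRing R] [Algebra F R] :
    Subgroup (Pt F H (L ⊗[F] R)) where
  carrier := {g | g * b.const (L ⊗[F] R) *
    (Pt.map (Algebra.TensorProduct.map (σ : L →ₐ[F] L) (AlgHom.id F R)) g)⁻¹ = b.const (L ⊗[F] R)}
  one_mem' := by simp
  mul_mem' {x y} hx hy := by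
    simp only [Set.mem_ofPred_eq, map_mul, mul_inv_rev] at *
    rw [← mul_assoc, mul_assoc x y, mul_assoc x, hy, hx]
  inv_mem' {x} hx := by
    simp only [Set.mem_ofPred_eq, map_inv, inv_inv] at *
    rw [mul_inv_eq_iff_eq_mul] at hx
    rw [mul_assoc, ← hx, inv_mul_cancel_left]

/-- The group functor `J_b` over `F`. -/
noncomputable def twistedCentralizerFunctor : CommAlgCat.{u} F ⥤ GrpCat.{u} where
  obj R := GrpCat.of (twistedCentralizer σ b R)
  map {R R'} f := GrpCat.ofHom <|
    ((Pt.map (Algebra.TensorProduct.map (AlgHom.id F L) f.hom)).comp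
      (twistedCentralizer σ b R).subtype).codRestrict (twistedCentralizer σ b R') <| by
      rintro ⟨g, hg⟩
      have h := congrArg (Pt.map (Algebra.TensorProduct.map (AlgHom.id F L) f.hom)) hg
      have e1 : Pt.map (Algebra.TensorProduct.map (AlgHom.id F L) f.hom) (b.const (L ⊗[F] R)) =
          b.const (L ⊗[F] R') := by
        have e0 : (Algebra.TensorProduct.map (AlgHom.id F L) f.hom).comp
            (IsScalarTower.toAlgHom F L (L ⊗[F] R)) = IsScalarTower.toAlgHom F L (L ⊗[F] R') := by
          ext x
          simp
        rw [Pt.const, Pt.map_map, e0]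
        rfl
      have e2 : (Algebra.TensorProduct.map (AlgHom.id F L) f.hom).comp
          (Algebra.TensorProduct.map (σ : L →ₐ[F] L) (AlgHom.id F R)) =
          (Algebra.TensorProduct.map (σ : L →ₐ[F] L) (AlgHom.id F R')).comp
            (Algebra.TensorProduct.map (AlgHom.id F L) f.hom) := by
        ext <;> simp
      rw [map_mul, map_mul, map_inv, e1, Pt.map_map, e2, ← Pt.map_map] at h
      exact h
  map_id R := by
    ext g
    change Pt.map (Algebra.TensorProduct.map (AlgHom.id F L) (AlgHom.id F R)) g.1 = g.1
    rw [Algebra.TensorProduct.map_id]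
    rfl
  map_comp f f' := by
    ext g
    change Pt.map (Algebra.TensorProduct.map (AlgHom.id F L) (f'.hom.comp f.hom)) g.1 =
      Pt.map (Algebra.TensorProduct.map (AlgHom.id F L) f'.hom)
        (Pt.map (Algebra.TensorProduct.map (AlgHom.id F L) f.hom) g.1)
    rw [Pt.map_map, ← Algebra.TensorProduct.map_comp]
    rfl

end TwistedCentralizer

/-! ### The completion of the maximal unramified extension -/

section LocalField

open ValuativeRel

variable (F L : Type u) [Field F] [ValuativeRel F] [TopologicalSpace F]
  [IsNonarchimedeanLocalField F] [Field L] [Algebra F L]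

/-- `L` is the completion of the maximal unramified extension of the local field `F`, with ring of
integers `O` and Frobenius automorphism `σ`: the field `L` is complete for a discrete valuation that
extends the one of `F`, a uniformizer of `F` is a uniformizer of `L`, the residue field of `L` is an
algebraic closure of the residue field `𝔽_q` of `F`, and `σ` fixes `F` and induces `x ↦ x^q` on the
residue field. -/
structure UnramifiedCompletion where
  O : ValuationSubring L
  σ : L ≃ₐ[F] L
  mem_O_iff : ∀ x : F, algebraMap F L x ∈ O ↔ x ∈ 𝒪[F]
  maximalIdeal_eq : ∀ ϖ : 𝒪[F], Irreducible ϖ → ∀ x : O,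
    x ∈ IsLocalRing.maximalIdeal O ↔ ∃ y : O, (x : L) = algebraMap F L ϖ * y
  complete : IsAdicComplete (IsLocalRing.maximalIdeal O) O
  residue_algClosed : IsAlgClosed (IsLocalRing.ResidueField O)
  residue_algebraic : ∀ x : IsLocalRing.ResidueField O, ∃ n : ℕ, 0 < n ∧ x ^ Nat.card 𝓀[F] ^ n = x
  σ_mem : ∀ x, x ∈ O → σ x ∈ O
  σ_frobenius : ∀ x (hx : x ∈ O), IsLocalRing.residue O ⟨σ x, σ_mem x hx⟩ =
    IsLocalRing.residue O ⟨x, hx⟩ ^ Nat.card 𝓀[F]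

end LocalField

/-! ### The root datum of a quasi-split group, Newton points and defects -/

section Main

open ValuativeRel

variable {F : Type u} [Field F] [ValuativeRel F] [TopologicalSpace F] [IsNonarchimedeanLocalField F]
  {L : Type u} [Field L] [Algebra F L] {Ω : Type u} [Field Ω] [Algebra F Ω] [Algebra L Ω]
  [IsScalarTower F L Ω] {H : Type u} [CommRing H] [HopfAlgebra F H]
  {ι X Y : Type*} [Finite ι] [AddCommGroup X] [AddCommGroup Y] [Module.Finite ℤ Y]

/-- An identification of `D` with the based root datum of `(G, B, T)` over the algebraic closure `Ω` of
`L`, together with its Galois action: `Y` is the cocharacter group of `T_Ω` (hence `X`, being its dual,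
is the character group), the roots are the nonzero weights of `T` on the Lie algebra of `G`, the
positive roots are those of `B`, the reflections attached to the coroots are induced by conjugation
by elements of `G(Ω)`, and the inertia group `Gal(Ω/L)` and the Frobenius act on `Y` as on cocharacters. -/
structure RootDatumIdentification (U : UnramifiedCompletion F L) (G : QuasiSplitGroup F H Ω)
    (D : GaloisRootDatum ι X Y) where
  cochar : Y → Pt F H (AddMonoidAlgebra Ω ℤ)
  cochar_add : ∀ y y', cochar (y + y') = cochar y * cochar y'
  cochar_injective : Function.Injective cochar
  range_cochar : Set.range cochar = {c | IsTorusHom c ∧ c ∈ G.T.points _}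
  root_iff : ∀ χ : X, χ ∈ Set.range D.P.root ↔ χ ≠ 0 ∧
    ∃ ξ : Pt F H (DualNumber Ω), IsTangent ξ ∧ ξ ≠ 1 ∧ ∀ y (x : Ωˣ),
      MulAut.conj ((cocharValue (cochar y) x).const (DualNumber Ω)) ξ =
        scaleTangent ((x ^ D.P.toLinearMap χ y : Ωˣ) : Ω) ξ
  pos_iff : ∀ i, D.P.root i ∈ AddSubmonoid.closure (D.P.root '' D.base.support) ↔
    ∃ ξ : Pt F H (DualNumber Ω), IsTangent ξ ∧ ξ ∈ G.B.points _ ∧ ξ ≠ 1 ∧ ∀ y (x : Ωˣ),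
      MulAut.conj ((cocharValue (cochar y) x).const (DualNumber Ω)) ξ =
        scaleTangent ((x ^ D.P.toLinearMap (D.P.root i) y : Ωˣ) : Ω) ξ
  reflection : ∀ i, ∃ n : Pt F H Ω, ∀ y, cocharConj n (cochar y) = cochar (D.P.coreflection i y)
  mem_inertia_iff : ∀ g : Y ≃ₗ[ℤ] Y, g ∈ D.inertia ↔ ∃ τ : Ω ≃ₐ[L] Ω, ∀ y,
    cochar (g y) = cocharMap ((τ : Ω →ₐ[L] Ω).restrictScalars F) (cochar y)
  frob_spec : ∃ τ : Ω ≃ₐ[F] Ω, (∀ l, τ (algebraMap L Ω l) = algebraMap L Ω (U.σ l)) ∧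
    ∀ y, cochar (D.frob y) = cocharMap (τ : Ω →ₐ[F] Ω) (cochar y)

/-- `b σ(b) ⋯ σ^{s-1}(b)`. -/
noncomputable def frobeniusNorm (U : UnramifiedCompletion F L) (b : Pt F H L) : ℕ → Pt F H L
  | 0 => 1
  | s + 1 => b * Pt.map (U.σ : L →ₐ[F] L) (frobeniusNorm U b s)

/-- The defect `def_G(b) = rank_F G - rank_F J_b`. -/
noncomputable def defect (U : UnramifiedCompletion F L) (b : Pt F H L) : ℤ :=
  (splitRank (groupFunctor F H) : ℤ) - splitRank (twistedCentralizerFunctor U.σ b)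

namespace RootDatumIdentification

variable {U : UnramifiedCompletion F L} {G : QuasiSplitGroup F H Ω} {D : GaloisRootDatum ι X Y}
  (R : RootDatumIdentification U G D)

/-- `ν` is the Newton point of `b` (Kottwitz): there are a positive integer `s`, a cocharacter `ψ`
of `G` over `L` (which is `s` times the slope homomorphism), an element `c ∈ G(L)` and a uniformizer
`ϖ` of `F` such that `c ψ c⁻¹` is defined over the fixed field of `σ^s` and
`c · b σ(b) ⋯ σ^{s-1}(b) · σ^s(c)⁻¹ = c ψ(ϖ) c⁻¹`. The Newton point is `1/s` times the dominant
cocharacter of `T` that is conjugate to `ψ` over `Ω`. -/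
def IsNewtonPoint (b : Pt F H L) (ν : TensorProduct ℤ ℚ D.Coinv) : Prop :=
  ∃ (s : ℕ) (ψ : Pt F H (AddMonoidAlgebra L ℤ)) (c : Pt F H L) (ϖ : 𝒪[F]) (p : Lˣ) (y : Y)
    (g : Pt F H Ω),
    0 < s ∧ IsTorusHom ψ ∧ Irreducible ϖ ∧ (p : L) = algebraMap F L ϖ ∧
    cocharMap ((U.σ ^ s : L ≃ₐ[F] L) : L →ₐ[F] L) (cocharConj c ψ) = cocharConj c ψ ∧
    c * frobeniusNorm U b s * (Pt.map ((U.σ ^ s : L ≃ₐ[F] L) : L →ₐ[F] L) c)⁻¹ =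
      c * cocharValue ψ p * c⁻¹ ∧
    (∀ i ∈ D.base.support, 0 ≤ D.P.root' i y) ∧
    cocharMap (IsScalarTower.toAlgHom F L Ω) ψ = cocharConj g (R.cochar y) ∧
    ν = ((1 : ℚ) / s) ⊗ₜ[ℤ] D.augmentation.mkQ y

/-- The Newton point `ν_b`. -/
noncomputable def newtonPoint (b : Pt F H L) : TensorProduct ℤ ℚ D.Coinv :=
  Classical.epsilon (R.IsNewtonPoint b)

/-- The virtual dimension `d_w(b) = ½ (ℓ(w) + ℓ(η_σ(w)) - def_G(b)) - ⟨ν_b, ρ⟩`. -/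
noncomputable def virtualDim (w : D.simpleRoots.Wext) (b : Pt F H L) : ℚ :=
  1 / 2 * ((D.simpleRoots.length w : ℚ) + D.simpleRoots.length₀ (D.simpleRoots.η D.σW w)
    - defect U b) - D.simpleRoots.pairRho (R.newtonPoint b)

end RootDatumIdentification

end Main

end GroupSchemes

open scoped TensorProduct

/-! ### Roots as a type -/

namespace SimpleRoots

variable {Λ : Type*} [AddCommGroup Λ] {I : Type*} {S : SimpleRoots Λ I}

/-- The type of roots, each together with its coroot. -/
def Root (S : SimpleRoots Λ I) : Type _ := {r : Pair Λ // r ∈ S.roots}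

namespace Root

/-- The functional attached to a root. -/
def fn (r : S.Root) : Module.Dual ℤ Λ := r.1.1

/-- The coroot. -/
def co (r : S.Root) : Λ := r.1.2

/-- The underlying pair. -/
def toPair (r : S.Root) : Pair Λ := r.1

theorem toPair_injective : Function.Injective (toPair : S.Root → Pair Λ) := Subtype.val_injective

theorem ext' {r q : S.Root} (h1 : r.fn = q.fn) (h2 : r.co = q.co) : r = q :=
  Subtype.ext (Prod.ext h1 h2)

/-- A root is positive if it is a sum of simple roots. -/
def Pos (r : S.Root) : Prop := S.IsPos r.fn

end Root

theorem movePair_mul (g h : Λ ≃ₗ[ℤ] Λ) (r : Pair Λ) :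
    movePair (g * h) r = movePair g (movePair h r) := rfl

theorem movePair_mem_roots {g : Λ ≃ₗ[ℤ] Λ} (hg : g ∈ S.W₀) {r : Pair Λ} (hr : r ∈ S.roots) :
    movePair g r ∈ S.roots := by
  obtain ⟨h, hh, i, rfl⟩ := hr
  exact ⟨g * h, mul_mem hg hh, i, rfl⟩

instance : MulAction S.W₀ S.Root where
  smul u r := ⟨movePair u.1 r.1, movePair_mem_roots u.2 r.2⟩
  one_smul _ := rfl
  mul_smul _ _ _ := rfl

@[simp] theorem Root.co_smul (u : S.W₀) (r : S.Root) : (u • r).co = u.1 r.co := rfl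

theorem Root.fn_smul (u : S.W₀) (r : S.Root) (l : Λ) : (u • r).fn l = r.fn ((u⁻¹).1 l) := rfl

@[simp] theorem Root.fn_smul_apply (u : S.W₀) (r : S.Root) (l : Λ) :
    (u • r).fn (u.1 l) = r.fn l := by
  change r.fn (u.1.symm (u.1 l)) = r.fn l
  rw [LinearEquiv.symm_apply_apply]

/-- The simple root `α_i`. -/
def simple (S : SimpleRoots Λ I) (i : I) : S.Root := ⟨(S.root i, S.coroot i), 1, one_mem _, i, rfl⟩

@[simp] theorem simple_fn (i : I) : (S.simple i).fn = S.root i := rfl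

@[simp] theorem simple_co (i : I) : (S.simple i).co = S.coroot i := rfl

theorem Root.exists_eq_smul_simple (r : S.Root) : ∃ (u : S.W₀) (i : I), r = u • S.simple i := by
  obtain ⟨_, g, hg, i, rfl⟩ := r
  exact ⟨⟨g, hg⟩, i, rfl⟩

theorem Root.fn_co (r : S.Root) : r.fn r.co = 2 := by
  obtain ⟨u, i, rfl⟩ := r.exists_eq_smul_simple
  rw [co_smul, fn_smul_apply]
  exact S.root_coroot_two i

theorem Root.fn_ne_zero (r : S.Root) : r.fn ≠ 0 := fun h => by
  have := r.fn_co
  rw [h] at this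
  simp at this

theorem W₀_ext {u v : S.W₀} (h : ∀ l, u.1 l = v.1 l) : u = v := Subtype.ext (LinearEquiv.ext h)

/-- The simple reflection as an element of `W₀`. -/
noncomputable def sr (S : SimpleRoots Λ I) (i : I) : S.W₀ :=
  ⟨S.simpleReflection i, Subgroup.subset_closure ⟨i, rfl⟩⟩

theorem sr_apply (i : I) (l : Λ) : (S.sr i).1 l = l - S.root i l • S.coroot i :=
  Module.reflection_apply l (S.root_coroot_two i)

theorem conj_sr_apply (u : S.W₀) (i : I) (l : Λ) :
    (u * S.sr i * u⁻¹).1 l = l - (u • S.simple i).fn l • (u • S.simple i).co := by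
  change u.1 ((S.sr i).1 (u.1.symm l)) = _
  rw [sr_apply, map_sub, map_smul, LinearEquiv.apply_symm_apply]
  rfl

namespace Root

/-- The reflection `s_r` of a root `r`. -/
noncomputable def refl (r : S.Root) : S.W₀ :=
  ⟨Module.reflection r.fn_co, by
    obtain ⟨u, i, rfl⟩ := r.exists_eq_smul_simple
    convert (u * S.sr i * u⁻¹).2 using 1
    ext l
    rw [conj_sr_apply]
    exact Module.reflection_apply _ _⟩

theorem refl_apply (r : S.Root) (l : Λ) : r.refl.1 l = l - r.fn l • r.co :=
  Module.reflection_apply l r.fn_co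

theorem isReflection_refl (r : S.Root) : S.IsReflection r.refl r.1 := r.refl_apply

theorem eq_refl_of_isReflection {r : S.Root} {u : S.W₀} (h : S.IsReflection u r.1) :
    u = r.refl := W₀_ext fun l => (h l).trans (r.refl_apply l).symm

theorem refl_mul_self (r : S.Root) : r.refl * r.refl = 1 := by
  refine W₀_ext fun l => ?_
  change r.refl.1 (r.refl.1 l) = l
  exact Module.involutive_reflection r.fn_co l

@[simp] theorem refl_inv (r : S.Root) : r.refl⁻¹ = r.refl :=
  inv_eq_of_mul_eq_one_left r.refl_mul_self

@[simp] theorem refl_smul_refl_smul (r q : S.Root) : r.refl • r.refl • q = q := by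
  rw [← mul_smul, refl_mul_self, one_smul]

@[simp] theorem mul_refl_mul_refl (u : S.W₀) (r : S.Root) : u * r.refl * r.refl = u := by
  rw [mul_assoc, refl_mul_self, mul_one]

theorem refl_smul (u : S.W₀) (r : S.Root) : (u • r).refl = u * r.refl * u⁻¹ := by
  refine W₀_ext fun l => ?_
  rw [refl_apply]
  change _ = u.1 (r.refl.1 (u.1.symm l))
  rw [refl_apply, map_sub, map_smul, LinearEquiv.apply_symm_apply]
  rfl

theorem mul_refl (u : S.W₀) (r : S.Root) : u * r.refl = (u • r).refl * u := by
  rw [refl_smul, inv_mul_cancel_right]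

theorem refl_smul_co (r q : S.Root) : (r.refl • q).co = q.co - r.fn q.co • r.co := by
  rw [co_smul, refl_apply]

theorem refl_smul_fn_apply (r q : S.Root) (l : Λ) :
    (r.refl • q).fn l = q.fn l - r.fn l * q.fn r.co := by
  rw [fn_smul, refl_inv, refl_apply, map_sub, map_smul, smul_eq_mul]

theorem refl_smul_fn (r q : S.Root) :
    (r.refl • q).fn = q.fn - q.fn r.co • r.fn := by
  ext l
  rw [refl_smul_fn_apply]
  simp [mul_comm]

noncomputable instance : Neg S.Root where
  neg r := ⟨-r.1, by
    convert (r.refl • r).2 using 1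
    refine Prod.ext ?_ ?_
    · change -r.fn = (r.refl • r).fn
      rw [refl_smul_fn, fn_co]
      module
    · change -r.co = (r.refl • r).co
      rw [refl_smul_co, fn_co]
      module⟩

@[simp] theorem neg_fn (r : S.Root) : (-r).fn = -r.fn := rfl

@[simp] theorem neg_co (r : S.Root) : (-r).co = -r.co := rfl

noncomputable instance : InvolutiveNeg S.Root where
  neg_neg r := ext' (by simp) (by simp)

@[simp] theorem smul_neg' (u : S.W₀) (r : S.Root) : u • (-r) = -(u • r) :=
  ext' (by ext l; simp [fn_smul]) (by simp)

theorem refl_smul_self (r : S.Root) : r.refl • r = -r := by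
  refine ext' ?_ ?_
  · rw [refl_smul_fn, fn_co, neg_fn]
    module
  · rw [refl_smul_co, fn_co, neg_co]
    module

@[simp] theorem refl_neg (r : S.Root) : (-r).refl = r.refl :=
  W₀_ext fun l => by simp [refl_apply]

theorem neg_ne_self (r : S.Root) : -r ≠ r := fun h => by
  have h1 : (-r).fn r.co = r.fn r.co := by rw [h]
  rw [neg_fn, LinearMap.neg_apply, fn_co] at h1
  norm_num at h1

end Root

theorem refl_simple (i : I) : (S.simple i).refl = S.sr i :=
  W₀_ext fun l => by rw [Root.refl_apply, sr_apply]; rfl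

@[simp] theorem sr_inv (i : I) : (S.sr i)⁻¹ = S.sr i := by rw [← refl_simple, Root.refl_inv]

@[simp] theorem sr_mul_self (i : I) : S.sr i * S.sr i = 1 := by
  rw [← refl_simple, Root.refl_mul_self]

@[simp] theorem mul_sr_mul_sr (u : S.W₀) (i : I) : u * S.sr i * S.sr i = u := by
  rw [mul_assoc, sr_mul_self, mul_one]

@[simp] theorem sr_mul_sr_mul (u : S.W₀) (i : I) : S.sr i * (S.sr i * u) = u := by
  rw [← mul_assoc, sr_mul_self, one_mul]

theorem W₀_induction {p : S.W₀ → Prop} (one : p 1) (mul : ∀ u i, p u → p (u * S.sr i)) (u : S.W₀) :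
    p u := by
  obtain ⟨g, hg⟩ := u
  have key : ∀ g ∈ S.W₀, ∀ (h : g ∈ S.W₀), p ⟨g, h⟩ := by
    intro g hg
    refine Subgroup.closure_induction_right (p := fun g _ => ∀ (h : g ∈ S.W₀), p ⟨g, h⟩)
      (fun _ => one) ?_ ?_ hg
    · rintro x hx _ ⟨i, rfl⟩ ih h
      exact mul ⟨x, hx⟩ i (ih hx)
    · rintro x hx _ ⟨i, rfl⟩ ih h
      have := mul ⟨x, hx⟩ i (ih hx)
      rw [← sr_inv] at this
      exact this
  exact key g hg hg

/-! ### Finite type -/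

/-- The simple roots `S` form a base of a finite root system: there are finitely many roots, each of
which is positive or negative, the distinct simple roots are linearly independent, and the pairing with
the simple roots is injective on the span of the simple coroots. -/
class IsFiniteType (S : SimpleRoots Λ I) : Prop where
  finite_roots : S.roots.Finite
  isPos_or_isPos_neg : ∀ r ∈ S.roots, S.IsPos r.1 ∨ S.IsPos (-r.1)
  exists_coweight : ∀ i, ∃ l, (∀ j, S.root j = S.root i → 0 < S.root j l) ∧
    ∀ j, S.root j ≠ S.root i → S.root j l = 0
  eq_zero_of_mem_span_coroot : ∀ c ∈ Submodule.span ℤ (Set.range S.coroot),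
    (∀ i, S.root i c = 0) → c = 0

section FiniteType

variable [hS : S.IsFiniteType]

instance : Finite S.Root := hS.finite_roots

noncomputable instance : Fintype S.Root := Fintype.ofFinite _

omit hS in
theorem IsPos.nonneg {a : Module.Dual ℤ Λ} (h : S.IsPos a) {l : Λ} (hl : S.IsDominant l) :
    0 ≤ a l := by
  induction h using AddSubmonoid.closure_induction with
  | mem x hx => obtain ⟨i, rfl⟩ := hx; exact hl i
  | zero => simp
  | add x y _ _ hx hy => simpa using add_nonneg hx hy

omit hS in
theorem IsPos.add {a b : Module.Dual ℤ Λ} (ha : S.IsPos a) (hb : S.IsPos b) : S.IsPos (a + b) :=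
  add_mem ha hb

/-- An element on which the simple roots equal to `α_i` are positive and the others vanish. -/
noncomputable def coweight (S : SimpleRoots Λ I) [hS : S.IsFiniteType] (i : I) : Λ :=
  (hS.exists_coweight i).choose

theorem root_coweight_self (i : I) : 0 < S.root i (S.coweight i) :=
  (hS.exists_coweight i).choose_spec.1 i rfl

theorem root_coweight_of_eq {i j : I} (h : S.root j = S.root i) : 0 < S.root j (S.coweight i) :=
  (hS.exists_coweight i).choose_spec.1 j h

theorem root_coweight_of_ne {i j : I} (h : S.root j ≠ S.root i) : S.root j (S.coweight i) = 0 :=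
  (hS.exists_coweight i).choose_spec.2 j h

theorem isDominant_coweight (i : I) : S.IsDominant (S.coweight i) := fun j => by
  by_cases h : S.root j = S.root i
  · exact (root_coweight_of_eq h).le
  · exact (root_coweight_of_ne h).ge

theorem eq_zero_of_isPos {a : Module.Dual ℤ Λ} (h1 : S.IsPos a)
    (h2 : ∀ i, a (S.coweight i) = 0) : a = 0 := by
  induction h1 using AddSubmonoid.closure_induction with
  | mem x hx =>
    obtain ⟨i, rfl⟩ := hx
    exact absurd (h2 i) (root_coweight_self i).ne'
  | zero => rfl
  | add x y hx hy ihx ihy =>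
    have h3 : ∀ i, x (S.coweight i) = 0 ∧ y (S.coweight i) = 0 := fun i => by
      have hx' := IsPos.nonneg hx (isDominant_coweight i)
      have hy' := IsPos.nonneg hy (isDominant_coweight i)
      have := h2 i
      rw [LinearMap.add_apply] at this
      constructor <;> linarith
    rw [ihx fun i => (h3 i).1, ihy fun i => (h3 i).2, add_zero]

theorem eq_zero_of_isPos_neg {a : Module.Dual ℤ Λ} (h1 : S.IsPos a) (h2 : S.IsPos (-a)) : a = 0 := by
  refine eq_zero_of_isPos h1 fun i => ?_
  have hx := IsPos.nonneg h1 (isDominant_coweight i)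
  have hy := IsPos.nonneg h2 (isDominant_coweight i)
  rw [LinearMap.neg_apply] at hy
  linarith

namespace Root

theorem pos_or_neg (r : S.Root) : r.Pos ∨ (-r).Pos := hS.isPos_or_isPos_neg r.1 r.2

theorem pos_neg_iff (r : S.Root) : (-r).Pos ↔ ¬ r.Pos := by
  refine ⟨fun h h' => r.fn_ne_zero (eq_zero_of_isPos_neg h' h), fun h => r.pos_or_neg.resolve_left h⟩

theorem not_pos_iff (r : S.Root) : ¬ r.Pos ↔ (-r).Pos := r.pos_neg_iff.symm

theorem not_pos_neg {r : S.Root} (h : r.Pos) : ¬ (-r).Pos := fun h' => r.pos_neg_iff.1 h' h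

/-- A root whose functional is a sum of two positive ones is positive, in the form of an
implication for multiples. -/
theorem pos_of_smul {r : S.Root} {n : ℤ} (hn : 0 < n) (h : S.IsPos (n • r.fn)) : r.Pos := by
  by_contra h'
  rw [not_pos_iff] at h'
  have h2 : S.IsPos (-(n • r.fn)) := by
    have : -(n • r.fn) = n.toNat • (-r).fn := by
      rw [neg_fn, ← natCast_zsmul, Int.toNat_of_nonneg hn.le, smul_neg]
    rw [this]
    exact nsmul_mem h' _
  have h3 := congrArg (fun a => a r.co) (eq_zero_of_isPos_neg h h2)
  simp [fn_co] at h3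
  omega

end Root

end FiniteType

end SimpleRoots

namespace SimpleRoots

variable {Λ : Type*} [AddCommGroup Λ] {I : Type*} {S : SimpleRoots Λ I}

theorem Root.co_mem_span (r : S.Root) : r.co ∈ Submodule.span ℤ (Set.range S.coroot) := by
  have key : ∀ (u : S.W₀) (c : Λ), c ∈ Submodule.span ℤ (Set.range S.coroot) →
      u.1 c ∈ Submodule.span ℤ (Set.range S.coroot) := by
    intro u
    induction u using W₀_induction with
    | one => exact fun c hc => hc
    | mul u i ih =>
      intro c hc
      refine ih ((S.sr i).1 c) ?_
      rw [sr_apply]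
      exact sub_mem hc (Submodule.smul_mem _ _ (Submodule.subset_span ⟨i, rfl⟩))
  obtain ⟨u, i, rfl⟩ := r.exists_eq_smul_simple
  exact key _ _ (Submodule.subset_span ⟨i, rfl⟩)

section FiniteType

variable [hS : S.IsFiniteType]

/-- A root is determined by its functional. -/
theorem Root.ext_fn {r q : S.Root} (h : r.fn = q.fn) : r = q := by
  refine Root.ext' h ?_
  have hq : r.fn q.co = 2 := h ▸ q.fn_co
  set u := r.refl * q.refl
  have h1 : ∀ l, u.1 l = l + r.fn l • (r.co - q.co) := by
    intro l
    change r.refl.1 (q.refl.1 l) = _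
    rw [Root.refl_apply, Root.refl_apply, ← h, map_sub, map_smul, hq]
    module
  have h2 : ∀ m : ℕ, (u ^ m).1 r.co = r.co + (2 * m : ℤ) • (r.co - q.co) := by
    intro m
    induction m with
    | zero => simp
    | succ m ih =>
      rw [pow_succ']
      change u.1 ((u ^ m).1 r.co) = _
      rw [ih, h1, map_add, map_smul, map_sub, hq, r.fn_co]
      push_cast
      module
  rw [← sub_eq_zero]
  refine hS.eq_zero_of_mem_span_coroot _ (sub_mem r.co_mem_span q.co_mem_span) fun i => ?_
  obtain ⟨m, m', hne, he⟩ := Finite.exists_ne_map_eq_of_infinite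
    (fun m : ℕ => (u ^ m)⁻¹ • S.simple i)
  have h3 := congrArg (fun s : S.Root => s.fn r.co) he
  simp only [Root.fn_smul, inv_inv, h2, simple_fn, map_add, map_smul, smul_eq_mul] at h3
  have h4 : ((m : ℤ) - m') * S.root i (r.co - q.co) = 0 := by linarith
  rcases mul_eq_zero.1 h4 with h5 | h5
  · exact absurd (by omega) hne
  · exact h5

theorem IsPos.exists_eq_nsmul {a : Module.Dual ℤ Λ} (h : S.IsPos a) (j : I)
    (hj : ∀ i, S.root i ≠ S.root j → a (S.coweight i) = 0) : ∃ n : ℕ, a = n • S.root j := by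
  induction h using AddSubmonoid.closure_induction with
  | mem x hx =>
    obtain ⟨i, rfl⟩ := hx
    by_cases hi : S.root i = S.root j
    · exact ⟨1, by rw [hi, one_smul]⟩
    · exact absurd (hj i hi) (root_coweight_self i).ne'
  | zero => exact ⟨0, by simp⟩
  | add x y hx hy ihx ihy =>
    have h3 : ∀ i, S.root i ≠ S.root j → x (S.coweight i) = 0 ∧ y (S.coweight i) = 0 :=
      fun i hi => by
        have hx' := IsPos.nonneg hx (isDominant_coweight i)
        have hy' := IsPos.nonneg hy (isDominant_coweight i)
        have := hj i hi
        rw [LinearMap.add_apply] at this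
        constructor <;> linarith
    obtain ⟨n, rfl⟩ := ihx fun i hi => (h3 i hi).1
    obtain ⟨m, rfl⟩ := ihy fun i hi => (h3 i hi).2
    exact ⟨n + m, by rw [add_smul]⟩

omit hS in
theorem simple_pos (i : I) : (S.simple i).Pos := AddSubmonoid.subset_closure ⟨i, rfl⟩

/-- The root system is reduced. -/
theorem Root.fn_ne_two_smul (r q : S.Root) : q.fn ≠ (2 : ℤ) • r.fn := by
  intro h
  obtain ⟨v, j, rfl⟩ := q.exists_eq_smul_simple
  have h1 : S.root j = (2 : ℤ) • (v⁻¹ • r).fn := by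
    ext l
    have := congrArg (fun a => a (v.1 l)) h
    simp only [fn_smul_apply, LinearMap.smul_apply] at this
    rw [LinearMap.smul_apply, fn_smul, inv_inv]
    exact this
  have hpos : (v⁻¹ • r).Pos :=
    Root.pos_of_smul (n := 2) (by norm_num) (h1 ▸ simple_pos j)
  obtain ⟨n, hn⟩ := IsPos.exists_eq_nsmul hpos j fun i hi => by
    have h2 := congrArg (fun a => a (S.coweight i)) h1
    simp only [root_coweight_of_ne (Ne.symm hi), LinearMap.smul_apply, smul_eq_mul] at h2
    omega
  have h3 := congrArg (fun a => a (S.coroot j)) h1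
  simp only [hn, LinearMap.smul_apply, S.root_coroot_two, smul_eq_mul, nsmul_eq_mul] at h3
  omega

/-- A simple reflection permutes the other positive roots. -/
theorem Root.Pos.sr_smul {r : S.Root} (hr : r.Pos) {j : I} (hj : r ≠ S.simple j) :
    (S.sr j • r).Pos := by
  by_cases h : ∀ i, S.root i ≠ S.root j → r.fn (S.coweight i) = 0
  · obtain ⟨n, hn⟩ := IsPos.exists_eq_nsmul hr j h
    have h2 := r.fn_co
    rw [hn, LinearMap.smul_apply, nsmul_eq_mul] at h2
    have h4 : n = 1 ∨ n = 2 := by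
      have h3 : (n : ℤ) ∣ 2 := ⟨_, h2.symm⟩
      have h5 : n ∣ 2 := by exact_mod_cast h3
      have := Nat.le_of_dvd (by norm_num) h5
      interval_cases n <;> simp_all
    rcases h4 with rfl | rfl
    · exact absurd (Root.ext_fn (by rw [hn, one_smul, simple_fn])) hj
    · exact absurd (by rw [hn, simple_fn]; module) ((S.simple j).fn_ne_two_smul r)
  · push Not at h
    obtain ⟨i, hi, h0⟩ := h
    by_contra hneg
    rw [not_pos_iff] at hneg
    have h1 := IsPos.nonneg hneg (isDominant_coweight i)
    have h2 := IsPos.nonneg hr (isDominant_coweight i)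
    rw [← refl_simple, neg_fn, LinearMap.neg_apply, refl_smul_fn_apply, simple_fn,
      root_coweight_of_ne hi.symm, zero_mul, sub_zero] at h1
    exact h0 (le_antisymm (by linarith) h2)

open Classical in
/-- `0` on the positive roots and `1` on the negative roots. -/
noncomputable def Root.chi (r : S.Root) : ℤ := if r.Pos then 0 else 1

omit hS in
theorem Root.chi_of_pos {r : S.Root} (h : r.Pos) : r.chi = 0 := if_pos h

omit hS in
theorem Root.chi_of_not_pos {r : S.Root} (h : ¬ r.Pos) : r.chi = 1 := if_neg h

omit hS in
theorem Root.chi_eq (r : S.Root) : r.chi = 0 ∨ r.chi = 1 := by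
  by_cases h : r.Pos
  · exact Or.inl (chi_of_pos h)
  · exact Or.inr (chi_of_not_pos h)

omit hS in
theorem Root.chi_eq_one_iff {r : S.Root} : r.chi = 1 ↔ ¬ r.Pos := by
  simp [chi]

@[simp] theorem Root.chi_neg (r : S.Root) : (-r).chi = 1 - r.chi := by
  by_cases h : r.Pos
  · rw [chi_of_pos h, chi_of_not_pos (not_pos_neg h), sub_zero]
  · rw [chi_of_not_pos h, chi_of_pos ((not_pos_iff r).1 h), sub_self]

open Classical in
/-- The finite set of positive roots. -/
noncomputable def pos (S : SimpleRoots Λ I) [S.IsFiniteType] : Finset S.Root :=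
  Finset.univ.filter Root.Pos

@[simp] theorem mem_pos {r : S.Root} : r ∈ S.pos ↔ r.Pos := by simp [pos]

theorem sum_univ_eq (G : S.Root → ℤ) : ∑ r, G r = ∑ r ∈ S.pos, (G r + G (-r)) := by
  classical
  rw [Finset.sum_add_distrib, ← Finset.sum_filter_add_sum_filter_not Finset.univ Root.Pos]
  refine congrArg₂ _ (by simp only [pos]) ?_
  refine Finset.sum_nbij' (fun r => -r) (fun r => -r) ?_ ?_ ?_ ?_ ?_
  · intro r hr
    simp only [Finset.mem_filter, Finset.mem_univ, true_and] at hr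
    exact mem_pos.2 ((Root.not_pos_iff r).1 hr)
  · intro r hr
    simpa using Root.not_pos_neg (mem_pos.1 hr)
  all_goals simp

/-- The sum of an even function over the positive roots is invariant under `W₀`. -/
theorem sum_pos_smul {G : S.Root → ℤ} (hG : ∀ r, G (-r) = G r) (u : S.W₀) :
    ∑ r ∈ S.pos, G (u • r) = ∑ r ∈ S.pos, G r := by
  have h1 : ∑ r, G (u • r) = ∑ r, G r := Equiv.sum_comp (MulAction.toPerm u) G
  rw [sum_univ_eq, sum_univ_eq] at h1
  simp only [Root.smul_neg', hG, Finset.sum_add_distrib] at h1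
  linarith

/-- The sum of an odd function over the positive roots, reparametrised by an element of `W₀`. -/
theorem sum_pos_eq_of_odd {G : S.Root → ℤ} (hG : ∀ r, G (-r) = -G r) (u : S.W₀) :
    ∑ r ∈ S.pos, G r = ∑ r ∈ S.pos, (1 - 2 * (u • r).chi) * G (u • r) := by
  rw [sum_pos_smul (G := fun r => (1 - 2 * r.chi) * G r) (fun r => by rw [Root.chi_neg, hG]; ring)]
  refine Finset.sum_congr rfl fun r hr => ?_
  rw [Root.chi_of_pos (mem_pos.1 hr)]
  ring

theorem length₀_eq (u : S.W₀) : (S.length₀ u : ℤ) = ∑ r ∈ S.pos, (u • r).chi := by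
  classical
  have h1 : S.length₀ u = (S.pos.filter fun r => ¬ (u • r).Pos).card := by
    rw [length₀, ← Set.ncard_coe_finset]
    refine Eq.trans ?_ (Set.ncard_image_of_injective _ Root.toPair_injective)
    congr 1
    ext r
    simp only [Set.mem_ofPred_eq, posRoots, Finset.coe_filter, mem_pos, Set.mem_image]
    constructor
    · rintro ⟨⟨h1, h2⟩, h3⟩
      exact ⟨⟨r, h1⟩, ⟨h2, (Root.not_pos_iff _).2 h3⟩, rfl⟩
    · rintro ⟨r, ⟨h2, h3⟩, rfl⟩
      exact ⟨⟨r.2, h2⟩, (Root.not_pos_iff _).1 h3⟩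
  rw [h1, Finset.card_filter]
  push_cast
  refine Finset.sum_congr rfl fun r _ => ?_
  by_cases h : (u • r).Pos <;> simp [Root.chi, h]

theorem twoRho_eq : S.twoRho = ∑ r ∈ S.pos, r.fn := by
  have h1 : S.posRoots = Root.toPair '' (S.pos : Set S.Root) := by
    ext r
    simp only [posRoots, Set.mem_ofPred_eq, Set.mem_image, Finset.mem_coe, mem_pos]
    constructor
    · rintro ⟨h1, h2⟩
      exact ⟨⟨r, h1⟩, h2, rfl⟩
    · rintro ⟨r, h2, rfl⟩
      exact ⟨r.2, h2⟩
  rw [twoRho, h1, finsum_mem_image Root.toPair_injective.injOn, finsum_mem_coe_finset]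
  rfl

theorem twoRho_apply (l : Λ) : S.twoRho l = ∑ r ∈ S.pos, r.fn l := by
  rw [twoRho_eq, LinearMap.sum_apply]

/-- The change of length under right multiplication by a reflection, as a sum over inversions. -/
theorem length₀_mul_refl (v : S.W₀) (b : S.Root) :
    (S.length₀ (v * b.refl) : ℤ) - S.length₀ v =
      ∑ r ∈ S.pos, (b.refl • r).chi * (1 - 2 * (v • r).chi) := by
  have h := sum_pos_eq_of_odd (G := fun r => 1 - 2 * (v • b.refl • r).chi)
    (fun r => by simp only [Root.smul_neg', Root.chi_neg]; ring) b.refl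
  simp only [Root.refl_smul_refl_smul] at h
  rw [length₀_eq, length₀_eq, ← Finset.sum_sub_distrib]
  simp only [mul_smul]
  have h2 : ∀ r : S.Root, ((v • b.refl • r).chi - (v • r).chi) * 2 =
    (1 - 2 * (v • r).chi) - (1 - 2 * (v • b.refl • r).chi) := fun r => by ring
  have h3 : ∀ r : S.Root, ((b.refl • r).chi * (1 - 2 * (v • r).chi)) * 2 =
    (1 - 2 * (v • r).chi) - (1 - 2 * (b.refl • r).chi) * (1 - 2 * (v • r).chi) := fun r => by ring
  have h4 : (∑ r ∈ S.pos, ((v • b.refl • r).chi - (v • r).chi)) * 2 =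
      (∑ r ∈ S.pos, ((b.refl • r).chi * (1 - 2 * (v • r).chi))) * 2 := by
    rw [Finset.sum_mul, Finset.sum_mul, Finset.sum_congr rfl fun r _ => h2 r,
      Finset.sum_congr rfl fun r _ => h3 r, Finset.sum_sub_distrib (fun r : S.Root => 1 - 2 * (v • r).chi),
      Finset.sum_sub_distrib (fun r : S.Root => 1 - 2 * (v • r).chi), h]
  linarith

theorem twoRho_co (b : S.Root) :
    S.twoRho b.co = ∑ r ∈ S.pos, (b.refl • r).chi * r.fn b.co := by
  have h := sum_pos_eq_of_odd (G := fun r => r.fn b.co) (fun r => by simp) b.refl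
  have h1 : ∀ r : S.Root, (b.refl • r).fn b.co = -r.fn b.co := fun r => by
    rw [Root.refl_smul_fn_apply, Root.fn_co]; ring
  simp only [h1] at h
  have h2 : ∀ r : S.Root, (1 - 2 * (b.refl • r).chi) * -r.fn b.co =
    2 * ((b.refl • r).chi * r.fn b.co) - r.fn b.co := fun r => by ring
  rw [twoRho_apply]
  simp only [h2, Finset.sum_sub_distrib, ← Finset.mul_sum] at h
  linarith

theorem length₀_inv (u : S.W₀) : S.length₀ u⁻¹ = S.length₀ u := by
  have h : (S.length₀ u⁻¹ : ℤ) = S.length₀ u := by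
    rw [length₀_eq, length₀_eq]
    have h := sum_pos_eq_of_odd (G := fun r => 1 - 2 * (u⁻¹ • r).chi)
      (fun r => by simp only [Root.smul_neg', Root.chi_neg]; ring) u
    simp only [inv_smul_smul] at h
    have h2 : ∑ r ∈ S.pos, (1 - 2 * (u • r).chi) * (1 - 2 * r.chi) =
        ∑ r ∈ S.pos, (1 - 2 * (u • r).chi) := Finset.sum_congr rfl fun r hr => by
      rw [Root.chi_of_pos (mem_pos.1 hr)]; ring
    rw [h2] at h
    simp only [Finset.sum_sub_distrib, ← Finset.mul_sum] at h
    linarith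
  exact_mod_cast h

/-! ### Inversions of a reflection -/

omit hS in
/-- Inversions of `s_b` pair positively with `b^∨`. -/
theorem Root.fn_co_pos_of_inversion {b r : S.Root} (hb : b.Pos) (hr : r.Pos)
    (h : ¬ (b.refl • r).Pos) : 0 < r.fn b.co := by
  by_contra hle
  push Not at hle
  refine h ?_
  have h1 : (b.refl • r).fn = r.fn + (-(r.fn b.co)).toNat • b.fn := by
    rw [refl_smul_fn, ← natCast_zsmul, Int.toNat_of_nonneg (by linarith), neg_smul, sub_eq_add_neg]
  change S.IsPos _
  rw [h1]
  exact IsPos.add hr (nsmul_mem hb _)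

omit hS in
theorem Root.chi_mul_fn_co_nonneg {b r : S.Root} (hb : b.Pos) (hr : r.Pos) :
    0 ≤ (b.refl • r).chi * r.fn b.co := by
  by_cases h : (b.refl • r).Pos
  · rw [chi_of_pos h, zero_mul]
  · rw [chi_of_not_pos h, one_mul]
    exact (fn_co_pos_of_inversion hb hr h).le

theorem Root.refl_self_not_pos {b : S.Root} (hb : b.Pos) : ¬ (b.refl • b).Pos := by
  rw [refl_smul_self]
  exact not_pos_neg hb

theorem Root.twoRho_co_ge {b : S.Root} (hb : b.Pos) : 2 ≤ S.twoRho b.co := by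
  rw [twoRho_co]
  have h := Finset.single_le_sum (f := fun r : S.Root => (b.refl • r).chi * r.fn b.co)
    (fun r hr => chi_mul_fn_co_nonneg hb (mem_pos.1 hr)) (mem_pos.2 hb)
  simpa [chi_of_not_pos (refl_self_not_pos hb), fn_co] using h

omit hS in
/-- If `v b > 0` then at least one of `v r`, `-v s_b r` is positive for each inversion `r`. -/
theorem Root.chi_add_chi_le {b r : S.Root} (hb : b.Pos) (hr : r.Pos) (h : ¬ (b.refl • r).Pos)
    (v : S.W₀) (hv : (v • b).Pos) : (v • r).chi ≤ (v • b.refl • r).chi := by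
  have hn := fn_co_pos_of_inversion hb hr h
  rcases chi_eq (v • r) with h0 | h0
  · rcases chi_eq (v • b.refl • r) with h1 | h1 <;> omega
  · rw [h0]
    rw [chi_eq_one_iff] at h0
    refine (chi_eq_one_iff.2 fun h2 => h0 ?_).ge
    have h3 : (v • r).fn = (v • b.refl • r).fn + (r.fn b.co).toNat • (v • b).fn := by
      ext l
      rw [← natCast_zsmul, Int.toNat_of_nonneg hn.le]
      simp only [LinearMap.add_apply, LinearMap.smul_apply, fn_smul v, refl_smul_fn]
      simp
    change S.IsPos _
    rw [h3]
    exact IsPos.add h2 (nsmul_mem hv _)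

theorem length₀_lt_mul_refl {v : S.W₀} {b : S.Root} (hb : b.Pos) (hv : (v • b).Pos) :
    S.length₀ v < S.length₀ (v * b.refl) := by
  have h := length₀_mul_refl v b
  have h4 : 0 < 2 * ∑ r ∈ S.pos, (b.refl • r).chi * (1 - 2 * (v • r).chi) := by
    have h5 : ∑ r ∈ S.pos, (b.refl • r).chi * (1 - 2 * (v • r).chi) =
        ∑ r ∈ S.pos, (b.refl • r).chi * (2 * (v • b.refl • r).chi - 1) := by
      have h6 := sum_pos_smul (G := fun r => (if (b.refl • r).chi = r.chi then 0 else 1) *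
        (1 - 2 * r.chi) * (1 - 2 * (v • r).chi)) (fun r => by
          simp only [Root.smul_neg', Root.chi_neg]
          split_ifs <;> first | ring1 | omega) b.refl
      have h7 : ∀ r ∈ S.pos, (if (b.refl • b.refl • r).chi = (b.refl • r).chi then 0 else 1) *
        (1 - 2 * (b.refl • r).chi) * (1 - 2 * (v • b.refl • r).chi) =
          (b.refl • r).chi * (2 * (v • b.refl • r).chi - 1) := fun r hr => by
        rw [Root.refl_smul_refl_smul, Root.chi_of_pos (mem_pos.1 hr)]
        rcases Root.chi_eq (b.refl • r) with h0 | h0 <;> rw [h0] <;> simp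
      have h8 : ∀ r ∈ S.pos, (if (b.refl • r).chi = r.chi then 0 else 1) *
        (1 - 2 * r.chi) * (1 - 2 * (v • r).chi) =
          (b.refl • r).chi * (1 - 2 * (v • r).chi) := fun r hr => by
        rw [Root.chi_of_pos (mem_pos.1 hr)]
        rcases Root.chi_eq (b.refl • r) with h0 | h0 <;> rw [h0] <;> simp
      rw [Finset.sum_congr rfl h7, Finset.sum_congr rfl h8] at h6
      exact h6.symm
    rw [two_mul]
    nth_rw 2 [h5]
    rw [← Finset.sum_add_distrib]
    refine Finset.sum_pos' (fun r hr => ?_) ⟨b, mem_pos.2 hb, ?_⟩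
    · by_cases h0 : (b.refl • r).Pos
      · rw [Root.chi_of_pos h0]; simp
      · have := Root.chi_add_chi_le hb (mem_pos.1 hr) h0 v hv
        rw [Root.chi_of_not_pos h0]
        linarith
    · rw [Root.refl_smul_self, Root.smul_neg', Root.chi_neg, Root.chi_neg, Root.chi_of_pos hb,
        Root.chi_of_pos hv]
      norm_num
  have : (0 : ℤ) < S.length₀ (v * b.refl) - S.length₀ v := by linarith
  omega

end FiniteType

end SimpleRoots

namespace SimpleRoots

variable {Λ : Type*} [AddCommGroup Λ] {I : Type*} {S : SimpleRoots Λ I}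

section FiniteType

variable [hS : S.IsFiniteType]

theorem length₀_mul_refl_lt {v : S.W₀} {b : S.Root} (hb : b.Pos) (hv : ¬ (v • b).Pos) :
    S.length₀ (v * b.refl) < S.length₀ v := by
  have h := length₀_lt_mul_refl (v := v * b.refl) hb (by
    rw [mul_smul, Root.refl_smul_self, Root.smul_neg']
    exact (Root.not_pos_iff _).1 hv)
  rwa [Root.mul_refl_mul_refl] at h

theorem length₀_lt_mul_refl_iff {v : S.W₀} {b : S.Root} (hb : b.Pos) :
    S.length₀ v < S.length₀ (v * b.refl) ↔ (v • b).Pos := by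
  refine ⟨fun h => ?_, length₀_lt_mul_refl hb⟩
  by_contra hv
  exact absurd (length₀_mul_refl_lt hb hv) (by omega)

/-- Simple reflections change the length by one. -/
theorem length₀_mul_sr (v : S.W₀) (i : I) :
    (S.length₀ (v * S.sr i) : ℤ) = S.length₀ v + 1 - 2 * (v • S.simple i).chi := by
  have h := length₀_mul_refl v (S.simple i)
  rw [refl_simple, Finset.sum_eq_single (S.simple i)] at h
  · rw [← refl_simple, Root.chi_of_not_pos (Root.refl_self_not_pos (simple_pos i)),
      refl_simple] at h
    linarith
  · intro r hr hne
    rw [Root.chi_of_pos ((mem_pos.1 hr).sr_smul hne), zero_mul]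
  · intro h; exact absurd (mem_pos.2 (simple_pos i)) h

theorem twoRho_coroot (i : I) : S.twoRho (S.coroot i) = 2 := by
  have h := twoRho_co (S.simple i)
  rw [refl_simple, Finset.sum_eq_single (S.simple i)] at h
  · rw [← refl_simple, Root.chi_of_not_pos (Root.refl_self_not_pos (simple_pos i)),
      Root.fn_co] at h
    exact h
  · intro r hr hne
    rw [Root.chi_of_pos ((mem_pos.1 hr).sr_smul hne), zero_mul]
  · intro h; exact absurd (mem_pos.2 (simple_pos i)) h

/-! ### The invariant form -/

/-- The `W₀`-invariant form `∑ r(x) r(y)`. -/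
noncomputable def form (S : SimpleRoots Λ I) [S.IsFiniteType] (x y : Λ) : ℤ :=
  ∑ r : S.Root, r.fn x * r.fn y

theorem form_smul (u : S.W₀) (x y : Λ) : S.form (u.1 x) (u.1 y) = S.form x y := by
  have h := Equiv.sum_comp (MulAction.toPerm u) (fun r : S.Root => r.fn (u.1 x) * r.fn (u.1 y))
  rw [form, form, ← h]
  simp only [MulAction.toPerm_apply, Root.fn_smul_apply]

theorem form_comm (x y : Λ) : S.form x y = S.form y x := by simp only [form, mul_comm]

theorem form_sub_right (x y z : Λ) : S.form x (y - z) = S.form x y - S.form x z := by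
  simp only [form, map_sub, mul_sub, Finset.sum_sub_distrib]

theorem form_smul_right (x y : Λ) (n : ℤ) : S.form x (n • y) = n * S.form x y := by
  simp only [form, map_smul, smul_eq_mul, Finset.mul_sum]
  exact Finset.sum_congr rfl fun r _ => by ring

theorem form_neg_left (x y : Λ) : S.form (-x) y = -S.form x y := by
  simp only [form, map_neg, neg_mul, Finset.sum_neg_distrib]

theorem two_mul_form_co (b : S.Root) (l : Λ) :
    2 * S.form b.co l = b.fn l * S.form b.co b.co := by
  have h := form_smul b.refl b.co l
  rw [← Root.co_smul, Root.refl_smul_self, Root.neg_co, Root.refl_apply, form_neg_left,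
    form_sub_right, form_smul_right] at h
  linarith

theorem form_co_pos (b : S.Root) : 0 < S.form b.co b.co := by
  refine Finset.sum_pos' (fun r _ => mul_self_nonneg _) ⟨b, Finset.mem_univ _, ?_⟩
  rw [b.fn_co]; norm_num

theorem fn_co_mul_form (b r : S.Root) :
    r.fn b.co * S.form r.co r.co = b.fn r.co * S.form b.co b.co := by
  rw [← two_mul_form_co, ← two_mul_form_co, form_comm]

theorem Root.fn_co_pos_comm {b r : S.Root} (h : 0 < r.fn b.co) : 0 < b.fn r.co := by
  have h1 := fn_co_mul_form b r
  exact pos_of_mul_pos_left (h1 ▸ mul_pos h (form_co_pos r)) (form_co_pos b).le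

theorem form_self_eq_zero {x : Λ} (h : S.form x x = 0) (y : Λ) : S.form x y = 0 := by
  have h1 := (Finset.sum_eq_zero_iff_of_nonneg fun r _ => mul_self_nonneg _).1 h
  refine Finset.sum_eq_zero fun r hr => ?_
  rw [mul_self_eq_zero.1 (h1 r hr), zero_mul]

theorem Root.fn_co_mul_fn_co_lt {b r : S.Root} (hne : r ≠ b)
    (hpos : 0 < r.fn b.co) : r.fn b.co * b.fn r.co < 4 := by
  set n := r.fn b.co with hn
  set k := b.fn r.co with hk
  have hk0 : 0 < k := fn_co_pos_comm hpos
  have h1 : n * S.form r.co r.co = k * S.form b.co b.co := fn_co_mul_form b r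
  have h2 : 2 * S.form b.co r.co = k * S.form b.co b.co := two_mul_form_co b r.co
  set x := (2 : ℤ) • b.co - n • r.co with hx
  have h3 : ∀ y, S.form x y = 2 * S.form b.co y - n * S.form r.co y := fun y => by
    rw [form_comm, hx, form_sub_right, form_smul_right, form_smul_right, form_comm b.co y,
      form_comm r.co y]
  have h4 : S.form x x = (4 - n * k) * S.form b.co b.co := by
    rw [h3, hx, form_sub_right, form_smul_right, form_smul_right, form_sub_right, form_smul_right,
      form_smul_right, form_comm r.co b.co]
    linear_combination n * h1 - 2 * n * h2
  have h5 : 0 ≤ S.form x x := Finset.sum_nonneg fun r _ => mul_self_nonneg _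
  have hbb := form_co_pos b
  have h6 : 0 ≤ 4 - n * k := by
    by_contra hlt
    push Not at hlt
    have := mul_neg_of_neg_of_pos hlt hbb
    linarith
  rcases h6.lt_or_eq with h7 | h7
  · linarith
  exfalso
  rw [← h7, zero_mul] at h4
  have h8 : ∀ l, 2 * b.fn l = k * r.fn l := fun l => by
    have h9 := h3 l
    rw [form_self_eq_zero h4] at h9
    have h10 := two_mul_form_co b l
    have h11 := two_mul_form_co r l
    have h12 : (2 * b.fn l - k * r.fn l) * S.form b.co b.co = 0 := by
      linear_combination -2 * h10 + n * h11 - 2 * h9 + r.fn l * h1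
    rcases mul_eq_zero.1 h12 with h13 | h13
    · linarith
    · exact absurd h13 hbb.ne'
  have hn4 : n ≤ 4 := by nlinarith
  interval_cases n
  · have hk' : k = 4 := by linarith
    refine r.fn_ne_two_smul b (LinearMap.ext fun l => ?_)
    have h9 := h8 l
    rw [hk'] at h9
    simp only [LinearMap.smul_apply, smul_eq_mul]
    linarith
  · have hk' : k = 2 := by linarith
    refine hne (Root.ext_fn (LinearMap.ext fun l => ?_))
    have h9 := h8 l
    rw [hk'] at h9
    linarith
  · omega
  · have hk' : k = 1 := by linarith
    refine b.fn_ne_two_smul r (LinearMap.ext fun l => ?_)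
    have h9 := h8 l
    rw [hk'] at h9
    simp only [LinearMap.smul_apply, smul_eq_mul]
    linarith

theorem Root.fn_co_le_three (b r : S.Root) : r.fn b.co ≤ 3 := by
  by_cases h : r = b
  · rw [h, b.fn_co]; norm_num
  · by_contra h0
    push Not at h0
    have h1 := fn_co_mul_fn_co_lt h (by linarith)
    have h2 := fn_co_pos_comm (b := b) (r := r) (by linarith)
    nlinarith

/-! ### The exchange property -/

omit hS in
theorem exists_word (u : S.W₀) : ∃ L : List I, u = (L.map S.sr).prod := by
  induction u using W₀_induction with
  | one => exact ⟨[], rfl⟩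
  | mul u i ih =>
    obtain ⟨L, rfl⟩ := ih
    exact ⟨L ++ [i], by simp⟩

theorem exists_shorter_word (L : List I) (i : I) (h : ¬ ((L.map S.sr).prod • S.simple i).Pos) :
    ∃ L' : List I, L'.length + 1 = L.length ∧
      (L.map S.sr).prod * S.sr i = (L'.map S.sr).prod := by
  induction L with
  | nil => exact absurd (simple_pos i) (by simpa using h)
  | cons j L ih =>
    rw [List.map_cons, List.prod_cons] at h ⊢
    by_cases h' : ((L.map S.sr).prod • S.simple i).Pos
    · refine ⟨L, by simp, ?_⟩
      have h1 : (L.map S.sr).prod • S.simple i = S.simple j := by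
        by_contra hne
        exact h (by rw [mul_smul]; exact h'.sr_smul hne)
      have h2 := Root.mul_refl (L.map S.sr).prod (S.simple i)
      rw [h1, refl_simple, refl_simple] at h2
      rw [mul_assoc, h2, sr_mul_sr_mul]
    · obtain ⟨L', hL, h1⟩ := ih h'
      exact ⟨j :: L', by simp [hL], by rw [mul_assoc, h1]; simp⟩

theorem eq_one_of_forall_pos {u : S.W₀} (h : ∀ i, (u • S.simple i).Pos) : u = 1 := by
  classical
  have hex : ∃ n, ∃ L : List I, L.length = n ∧ u = (L.map S.sr).prod := by
    obtain ⟨L, hL⟩ := exists_word u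
    exact ⟨_, L, rfl, hL⟩
  obtain ⟨L, hL, hu⟩ := Nat.find_spec hex
  rcases L.eq_nil_or_concat with rfl | ⟨L, i, rfl⟩
  · simpa using hu
  · simp only [List.concat_eq_append, List.map_append, List.map_cons, List.map_nil, List.prod_append,
      List.prod_singleton] at hu
    obtain ⟨L', hL', h1⟩ := exists_shorter_word L i fun hp => by
      have h2 := h i
      rw [hu, mul_smul, ← refl_simple, Root.refl_smul_self, Root.smul_neg'] at h2
      exact Root.not_pos_neg hp h2
    refine absurd (Nat.find_min hex (m := L'.length) ?_) (not_not.2 ⟨L', rfl, hu.trans h1⟩)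
    rw [← hL]
    simp
    omega

theorem exists_not_pos {u : S.W₀} (h : u ≠ 1) : ∃ i, ¬ (u • S.simple i).Pos := by
  by_contra h'
  push Not at h'
  exact h (eq_one_of_forall_pos h')

theorem length₀_one : S.length₀ 1 = 0 := by
  have h := length₀_eq (1 : S.W₀)
  rw [Finset.sum_eq_zero fun r hr => by rw [one_smul, Root.chi_of_pos (mem_pos.1 hr)]] at h
  exact_mod_cast h

/-! ### The longest element -/

theorem length₀_le_card (u : S.W₀) : S.length₀ u ≤ S.pos.card := by
  have h : (S.length₀ u : ℤ) ≤ S.pos.card := by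
    rw [length₀_eq, Finset.card_eq_sum_ones]
    push_cast
    refine Finset.sum_le_sum fun r _ => ?_
    rcases Root.chi_eq (u • r) with h | h <;> simp [h]
  exact_mod_cast h

theorem length₀_le_longest (u : S.W₀) : S.length₀ u ≤ S.length₀ S.longest := by
  have hfin : (Set.range S.length₀).Finite :=
    (Set.finite_Iic S.pos.card).subset (by
      rintro _ ⟨u, rfl⟩
      exact length₀_le_card u)
  obtain ⟨_, ⟨w, rfl⟩, hw⟩ := Set.exists_max_image _ id hfin ⟨_, 1, rfl⟩
  exact Classical.epsilon_spec (p := fun w => ∀ x, S.length₀ x ≤ S.length₀ w)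
    ⟨w, fun x => hw _ ⟨x, rfl⟩⟩ u

theorem longest_smul_not_pos {r : S.Root} (hr : r.Pos) : ¬ (S.longest • r).Pos := by
  have h0 : ∀ i, S.IsPos (-(S.longest • S.simple i).fn) := fun i => by
    rw [← Root.neg_fn]
    refine (Root.not_pos_iff _).1 fun h => ?_
    have h1 := length₀_lt_mul_refl (simple_pos i) h
    exact absurd (length₀_le_longest (S.longest * (S.simple i).refl)) (by omega)
  have key : ∀ a : Module.Dual ℤ Λ, S.IsPos a →
      S.IsPos (-(a ∘ₗ (S.longest.1.symm : Λ →ₗ[ℤ] Λ))) := by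
    intro a ha
    induction ha using AddSubmonoid.closure_induction with
    | mem x hx =>
      obtain ⟨i, rfl⟩ := hx
      exact h0 i
    | zero => rw [LinearMap.zero_comp, neg_zero]; exact zero_mem _
    | add x y _ _ hx hy =>
      rw [LinearMap.add_comp, neg_add]
      exact IsPos.add hx hy
  rw [Root.not_pos_iff]
  exact key _ hr

theorem length₀_mul_longest (u : S.W₀) :
    (S.length₀ (u * S.longest) : ℤ) = S.length₀ S.longest - S.length₀ u := by
  have h := sum_pos_smul (G := fun r => r.chi * (u • -r).chi + (1 - r.chi) * (u • r).chi)
    (fun r => by rw [neg_neg, Root.chi_neg]; ring) S.longest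
  have h1 : ∀ r ∈ S.pos, r.chi * (u • -r).chi + (1 - r.chi) * (u • r).chi = (u • r).chi :=
    fun r hr => by rw [Root.chi_of_pos (mem_pos.1 hr)]; ring
  have h2 : ∀ r ∈ S.pos, (S.longest • r).chi * (u • -(S.longest • r)).chi +
      (1 - (S.longest • r).chi) * (u • S.longest • r).chi =
        (S.longest • r).chi - ((u * S.longest) • r).chi :=
    fun r hr => by
      rw [Root.chi_of_not_pos (longest_smul_not_pos (mem_pos.1 hr)), Root.smul_neg', Root.chi_neg,
        mul_smul]
      ring
  rw [Finset.sum_congr rfl h1, Finset.sum_congr rfl h2, Finset.sum_sub_distrib, ← length₀_eq,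
    ← length₀_eq, ← length₀_eq] at h
  linarith

end FiniteType

end SimpleRoots

namespace SimpleRoots

variable {Λ : Type*} [AddCommGroup Λ] {I : Type*} {S : SimpleRoots Λ I}

/-! ### Paths in the quantum Bruhat graph -/

/-- There is a directed path with at most `n` edges from `x` to `y`. -/
def Reach (S : SimpleRoots Λ I) (x y : S.W₀) (n : ℤ) : Prop := ∃ m : ℕ, S.HasPath x y m ∧ (m : ℤ) ≤ n

theorem HasPath.refl (x : S.W₀) : S.HasPath x x 0 := ⟨fun _ => x, rfl, rfl, by simp⟩

theorem HasPath.trans {x y z : S.W₀} {m n : ℕ} (h1 : S.HasPath x y m) (h2 : S.HasPath y z n) :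
    S.HasPath x z (m + n) := by
  obtain ⟨p, hp0, hp1, hp⟩ := h1
  obtain ⟨q, hq0, hq1, hq⟩ := h2
  refine ⟨fun k => if k < m then p k else q (k - m), ?_, ?_, fun k hk => ?_⟩
  · by_cases h : 0 < m
    · simp [h, hp0]
    · have : m = 0 := by omega
      subst this
      simp [hq0, ← hp0, hp1]
  · simp [hq1]
  · by_cases h : k + 1 < m
    · simpa [h, show k < m by omega] using hp k (by omega)
    · by_cases h' : k < m
      · have h3 : k + 1 = m := by omega
        have h4 := hp k (by omega)
        rw [h3, hp1, ← hq0] at h4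
        simpa [h', h3] using h4
      · have h3 : k + 1 - m = k - m + 1 := by omega
        simpa [h', h, h3] using hq (k - m) (by omega)

theorem HasPath.of_edge {x y : S.W₀} (h : S.UpEdge x y ∨ S.DownEdge x y) : S.HasPath x y 1 :=
  ⟨fun k => if k = 0 then x else y, by simp, by simp, fun k hk => by
    obtain rfl : k = 0 := by omega
    simpa using h⟩

theorem Reach.refl (x : S.W₀) : S.Reach x x 0 := ⟨0, HasPath.refl x, le_rfl⟩

theorem Reach.trans {x y z : S.W₀} {m n : ℤ} (h1 : S.Reach x y m) (h2 : S.Reach y z n) :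
    S.Reach x z (m + n) := by
  obtain ⟨a, ha, ha'⟩ := h1
  obtain ⟨b, hb, hb'⟩ := h2
  exact ⟨a + b, ha.trans hb, by push_cast; linarith⟩

theorem Reach.mono {x y : S.W₀} {m n : ℤ} (h : S.Reach x y m) (hmn : m ≤ n) : S.Reach x y n := by
  obtain ⟨a, ha, ha'⟩ := h
  exact ⟨a, ha, ha'.trans hmn⟩

theorem Reach.of_edge {x y : S.W₀} (h : S.UpEdge x y ∨ S.DownEdge x y) : S.Reach x y 1 :=
  ⟨1, HasPath.of_edge h, by simp⟩

theorem Reach.nonneg {x y : S.W₀} {n : ℤ} (h : S.Reach x y n) : 0 ≤ n := by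
  obtain ⟨a, -, ha⟩ := h
  omega

theorem Reach.pos {x y : S.W₀} {n : ℤ} (h : S.Reach x y n) (hne : x ≠ y) : 0 < n := by
  obtain ⟨a, ⟨p, hp0, hp1, -⟩, ha⟩ := h
  rcases Nat.eq_zero_or_pos a with rfl | h0
  · exact absurd (hp0.symm.trans hp1) hne
  · omega

theorem Reach.dΓ_le {x y : S.W₀} {n : ℤ} (h : S.Reach x y n) : (S.dΓ x y : ℤ) ≤ n := by
  obtain ⟨a, ha, ha'⟩ := h
  have : S.dΓ x y ≤ a := Nat.sInf_le ha
  omega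

theorem UpEdge.exists_refl {x y : S.W₀} (h : S.UpEdge x y) :
    ∃ b : S.Root, b.Pos ∧ y = x * b.refl ∧ S.length₀ y = S.length₀ x + 1 := by
  obtain ⟨r, ⟨hr, hpos⟩, s, hs, rfl, hl⟩ := h
  have : s = Root.refl ⟨r, hr⟩ := Root.eq_refl_of_isReflection (r := ⟨r, hr⟩) hs
  exact ⟨⟨r, hr⟩, hpos, by rw [this], hl⟩

theorem DownEdge.exists_refl {x y : S.W₀} (h : S.DownEdge x y) :
    ∃ b : S.Root, b.Pos ∧ y = x * b.refl ∧
      (S.length₀ y : ℤ) = S.length₀ x - S.twoRho b.co + 1 := by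
  obtain ⟨r, ⟨hr, hpos⟩, s, hs, rfl, hl⟩ := h
  have : s = Root.refl ⟨r, hr⟩ := Root.eq_refl_of_isReflection (r := ⟨r, hr⟩) hs
  exact ⟨⟨r, hr⟩, hpos, by rw [this], hl⟩

theorem upEdge_refl {x : S.W₀} {b : S.Root} (hb : b.Pos)
    (h : S.length₀ (x * b.refl) = S.length₀ x + 1) : S.UpEdge x (x * b.refl) :=
  ⟨b.1, ⟨b.2, hb⟩, b.refl, b.isReflection_refl, rfl, h⟩

theorem downEdge_refl {x : S.W₀} {b : S.Root} (hb : b.Pos)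
    (h : (S.length₀ (x * b.refl) : ℤ) = S.length₀ x - S.twoRho b.co + 1) :
    S.DownEdge x (x * b.refl) :=
  ⟨b.1, ⟨b.2, hb⟩, b.refl, b.isReflection_refl, rfl, h⟩

section FiniteType

variable [hS : S.IsFiniteType]

omit hS in
theorem sr_mul_eq (i : I) (v : S.W₀) : S.sr i * v = v * (v⁻¹ • S.simple i).refl := by
  rw [Root.mul_refl, smul_inv_smul, refl_simple]

theorem length₀_sr_mul (i : I) (v : S.W₀) :
    (S.length₀ (S.sr i * v) : ℤ) = S.length₀ v + 1 - 2 * (v⁻¹ • S.simple i).chi := by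
  have h := length₀_mul_sr v⁻¹ i
  rwa [length₀_inv, ← length₀_inv (v⁻¹ * S.sr i), mul_inv_rev, inv_inv, sr_inv] at h

theorem length₀_sr_mul_of_pos {i : I} {v : S.W₀} (h : (v⁻¹ • S.simple i).Pos) :
    S.length₀ (S.sr i * v) = S.length₀ v + 1 := by
  have h1 := length₀_sr_mul i v
  rw [Root.chi_of_pos h] at h1
  omega

theorem length₀_sr_mul_of_not_pos {i : I} {v : S.W₀} (h : ¬ (v⁻¹ • S.simple i).Pos) :
    S.length₀ (S.sr i * v) + 1 = S.length₀ v := by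
  have h1 := length₀_sr_mul i v
  rw [Root.chi_of_not_pos h] at h1
  omega

omit hS in
theorem sr_mul_inv_smul (i : I) (v : S.W₀) :
    (S.sr i * v)⁻¹ • S.simple i = -(v⁻¹ • S.simple i) := by
  rw [mul_inv_rev, sr_inv, mul_smul, ← refl_simple, Root.refl_smul_self, Root.smul_neg']

theorem upEdge_sr_mul {i : I} {v : S.W₀} (h : (v⁻¹ • S.simple i).Pos) : S.UpEdge v (S.sr i * v) := by
  have h1 := length₀_sr_mul_of_pos h
  rw [sr_mul_eq] at h1 ⊢
  exact upEdge_refl h h1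

theorem upEdge_sr_mul' {i : I} {v : S.W₀} (h : ¬ (v⁻¹ • S.simple i).Pos) :
    S.UpEdge (S.sr i * v) v := by
  have h1 := upEdge_sr_mul (i := i) (v := S.sr i * v) (by
    rw [sr_mul_inv_smul]; exact (Root.not_pos_iff _).1 h)
  rwa [sr_mul_sr_mul] at h1

/-- Lifting of chains in the Bruhat order along left multiplication by a simple reflection. -/
theorem upChain_lift {x y : S.W₀} (h : Relation.ReflTransGen S.UpEdge x y) {i : I}
    (hx : (x⁻¹ • S.simple i).Pos) :
    ((y⁻¹ • S.simple i).Pos → Relation.ReflTransGen S.UpEdge (S.sr i * x) (S.sr i * y)) ∧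
      (¬ (y⁻¹ • S.simple i).Pos → Relation.ReflTransGen S.UpEdge (S.sr i * x) y) := by
  induction h with
  | refl => exact ⟨fun _ => .refl, fun h => absurd hx h⟩
  | @tail y z _ hyz ih =>
    obtain ⟨g, hg, hz, hl⟩ := hyz.exists_refl
    by_cases hy : (y⁻¹ • S.simple i).Pos
    · by_cases hgy : g = y⁻¹ • S.simple i
      · have hz' : z = S.sr i * y := by rw [hz, hgy, sr_mul_eq]
        have hn : ¬ (z⁻¹ • S.simple i).Pos := by
          rw [hz', sr_mul_inv_smul]
          exact Root.not_pos_neg hy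
        exact ⟨fun h => absurd h hn, fun _ => hz' ▸ ih.1 hy⟩
      · have hyg : (y • g).Pos := by
          rw [← length₀_lt_mul_refl_iff hg, ← hz]; omega
        have hsyg : ((S.sr i * y) • g).Pos := by
          rw [mul_smul]
          exact hyg.sr_smul fun h => hgy (by rw [← h, inv_smul_smul])
        have h1 := length₀_lt_mul_refl hg hsyg
        have h2 := length₀_sr_mul_of_pos hy
        rw [mul_assoc, ← hz] at h1
        have hzp : (z⁻¹ • S.simple i).Pos := by
          by_contra hzn
          have := length₀_sr_mul_of_not_pos hzn
          omega
        have h3 := length₀_sr_mul_of_pos hzp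
        refine ⟨fun _ => (ih.1 hy).tail ?_, fun h => absurd hzp h⟩
        have h4 := upEdge_refl (x := S.sr i * y) hg (by rw [mul_assoc, ← hz]; omega)
        rwa [mul_assoc, ← hz] at h4
    · exact ⟨fun hzp => ((ih.2 hy).tail hyz).tail (upEdge_sr_mul hzp), fun _ => (ih.2 hy).tail hyz⟩

/-- If `v b > 0` then `v` and `v s_b` are joined by a saturated chain. -/
theorem upChain_mul_refl {b : S.Root} (hb : b.Pos) {v : S.W₀} (hv : (v • b).Pos) :
    Relation.ReflTransGen S.UpEdge v (v * b.refl) := by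
  induction hn : S.length₀ (v * b.refl) using Nat.strong_induction_on generalizing v with
  | _ n ih =>
  subst hn
  have hlt := length₀_lt_mul_refl hb hv
  have hne : v * b.refl ≠ 1 := fun h => by rw [h, length₀_one] at hlt; omega
  obtain ⟨i, hi⟩ := exists_not_pos (inv_ne_one.2 hne)
  have h1 := length₀_sr_mul_of_not_pos hi
  by_cases hvb : v • b = S.simple i
  · have h2 : v * b.refl = S.sr i * v := by rw [Root.mul_refl, hvb, refl_simple]
    rw [h2]
    exact .single (upEdge_sr_mul (by rw [← hvb, inv_smul_smul]; exact hb))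
  · have h2 : ((S.sr i * v) • b).Pos := by
      rw [mul_smul]
      exact hv.sr_smul hvb
    have h3 := ih _ (by rw [mul_assoc]; omega) h2 rfl
    rw [mul_assoc] at h3
    by_cases hvi : (v⁻¹ • S.simple i).Pos
    · exact (Relation.ReflTransGen.head (upEdge_sr_mul hvi) h3).tail (upEdge_sr_mul' hi)
    · have h4 := (upChain_lift h3 (i := i) (by
        rw [sr_mul_inv_smul]; exact (Root.not_pos_iff _).1 hvi)).1 (by
        rw [sr_mul_inv_smul]; exact (Root.not_pos_iff _).1 hi)
      rwa [sr_mul_sr_mul, sr_mul_sr_mul] at h4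

omit hS in
theorem Reach.of_upChain {x y : S.W₀} (h : Relation.ReflTransGen S.UpEdge x y) :
    S.Reach x y (S.length₀ y - S.length₀ x) := by
  induction h with
  | refl => exact (Reach.refl x).mono (by simp)
  | tail _ hyz ih =>
    refine (ih.trans (Reach.of_edge (Or.inl hyz))).mono ?_
    obtain ⟨g, hg, hz, hl⟩ := hyz.exists_refl
    rw [hl]
    push_cast
    linarith

theorem reach_mul_refl_of_pos {b : S.Root} (hb : b.Pos) {v : S.W₀} (hv : (v • b).Pos) :
    S.Reach v (v * b.refl) (S.length₀ (v * b.refl) - S.length₀ v) :=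
  Reach.of_upChain (upChain_mul_refl hb hv)

omit hS in
theorem twoRho_refl_smul (g b : S.Root) :
    S.twoRho (g.refl • b).co = S.twoRho b.co - g.fn b.co * S.twoRho g.co := by
  rw [Root.refl_smul_co, map_sub, map_smul, smul_eq_mul]

/-- The bound for the distance from `v` to `v s_b`. -/
def ReachRefl (b : S.Root) (v : S.W₀) : Prop :=
  S.Reach v (v * b.refl) (S.length₀ (v * b.refl) - S.length₀ v + (v • b).chi * S.twoRho b.co)

theorem reachRefl_of_pos {b : S.Root} (hb : b.Pos) {v : S.W₀} (hv : (v • b).Pos) :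
    ReachRefl b v := (reach_mul_refl_of_pos hb hv).mono (by rw [Root.chi_of_pos hv]; simp)

omit hS in
theorem ReachRefl.conj {g d b : S.Root} (hd : d.refl = g.refl * b.refl * g.refl) {v : S.W₀}
    (h1 : ReachRefl g v) (h2 : ReachRefl d (v * g.refl)) (h3 : ReachRefl g (v * g.refl * d.refl)) :
    S.Reach v (v * b.refl) (S.length₀ (v * b.refl) - S.length₀ v + (v • g).chi * S.twoRho g.co +
      ((v * g.refl) • d).chi * S.twoRho d.co +
      ((v * g.refl * d.refl) • g).chi * S.twoRho g.co) := by
  have h4 : v * g.refl * d.refl * g.refl = v * b.refl := by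
    rw [hd]
    simp only [← mul_assoc, Root.mul_refl_mul_refl]
  have h5 := (h1.trans h2).trans h3
  rw [h4] at h5
  exact h5.mono (by linarith)

theorem ReachRefl.conj_smul {g d b : S.Root} (hd : d.refl = g.refl * b.refl * g.refl) (v : S.W₀) :
    ((v * g.refl * d.refl) • g).chi = 1 - (v • b.refl • g).chi := by
  have h4 : v * g.refl * d.refl = v * b.refl * g.refl := by
    rw [hd]
    simp only [← mul_assoc, Root.mul_refl_mul_refl]
  rw [h4, mul_smul, Root.refl_smul_self, Root.smul_neg', Root.chi_neg, mul_smul]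

theorem reachRefl_of_refl_smul_pos {g b : S.Root} {v : S.W₀} (hv : ¬ (v • b).Pos)
    (hg : ∀ v, ReachRefl g v) (hd : ∀ v, ReachRefl (g.refl • b) v)
    (h : ((v • g).chi + (1 - (v • b.refl • g).chi) - g.fn b.co) * S.twoRho g.co ≤ 0) :
    ReachRefl b v := by
  have hd' : (g.refl • b).refl = g.refl * b.refl * g.refl := by rw [Root.refl_smul, Root.refl_inv]
  refine ((hg v).conj hd' (hd _) (hg _)).mono ?_
  rw [ReachRefl.conj_smul hd', mul_smul, Root.refl_smul_refl_smul, Root.chi_of_not_pos hv,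
    twoRho_refl_smul]
  linarith

theorem reachRefl_of_refl_smul_not_pos {g b : S.Root} {v : S.W₀} (hv : ¬ (v • b).Pos)
    (hgb : ¬ (g.refl • b).Pos) (hg : ∀ v, ReachRefl g v)
    (h : ((v • g).chi + (1 - (v • b.refl • g).chi)) * S.twoRho g.co ≤ S.twoRho b.co) :
    ReachRefl b v := by
  have hd' : (-(g.refl • b)).refl = g.refl * b.refl * g.refl := by
    rw [Root.refl_neg, Root.refl_smul, Root.refl_inv]
  have h1 : ((v * g.refl) • -(g.refl • b)).Pos := by
    rw [Root.smul_neg', mul_smul, Root.refl_smul_refl_smul]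
    exact (Root.not_pos_iff _).1 hv
  refine ((hg v).conj hd' (reachRefl_of_pos ((Root.not_pos_iff _).1 hgb) h1) (hg _)).mono ?_
  rw [ReachRefl.conj_smul hd', Root.chi_of_pos h1, Root.chi_of_not_pos hv]
  linarith

/-- The distance from `v` to `v s_b` is at most `ℓ(v s_b) - ℓ(v)` if `v b > 0`, and at most
`ℓ(v s_b) - ℓ(v) + ⟨b^∨, 2ρ⟩` otherwise. -/
theorem reachRefl {b : S.Root} (hb : b.Pos) (v : S.W₀) : ReachRefl b v := by
  induction hn : (S.twoRho b.co).toNat using Nat.strong_induction_on generalizing b v with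
  | _ m ih =>
  subst hn
  have IH : ∀ {g : S.Root}, g.Pos → S.twoRho g.co < S.twoRho b.co → ∀ v, ReachRefl g v :=
    fun {g} hg hlt v => ih _ (by have := Root.twoRho_co_ge hg; omega) hg v rfl
  by_cases hv : (v • b).Pos
  · exact reachRefl_of_pos hb hv
  by_cases hdir : ∀ r : S.Root, r.Pos → ¬ (b.refl • r).Pos → r ≠ b → r.fn b.co = 1 ∧ ¬ (v • r).Pos
  · have h1 := length₀_mul_refl v b
    have h2 := twoRho_co b
    have h3 : ∑ r ∈ S.pos, ((b.refl • r).chi * (1 - 2 * (v • r).chi) +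
        (b.refl • r).chi * r.fn b.co) = 1 := by
      rw [Finset.sum_eq_single b]
      · rw [Root.chi_of_not_pos (Root.refl_self_not_pos hb), Root.chi_of_not_pos hv, b.fn_co]
        norm_num
      · intro r hr hne
        by_cases h0 : (b.refl • r).Pos
        · rw [Root.chi_of_pos h0]; ring
        · obtain ⟨h4, h5⟩ := hdir r (mem_pos.1 hr) h0 hne
          rw [Root.chi_of_not_pos h5, h4]; ring
      · exact fun h => absurd (mem_pos.2 hb) h
    rw [Finset.sum_add_distrib, ← h1, ← h2] at h3
    refine (Reach.of_edge (Or.inr (downEdge_refl hb (by linarith)))).mono ?_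
    rw [Root.chi_of_not_pos hv]
    linarith
  push Not at hdir
  obtain ⟨g, hg, hinv, hgb, hdir⟩ := hdir
  have hn0 := Root.fn_co_pos_of_inversion hb hg hinv
  have hk0 := Root.fn_co_pos_comm hn0
  have hnk := Root.fn_co_mul_fn_co_lt hgb hn0
  obtain ⟨g', hg'⟩ : ∃ g' : S.Root, g' = -(b.refl • g) := ⟨_, rfl⟩
  have hg'pos : g'.Pos := hg' ▸ (Root.not_pos_iff _).1 hinv
  have hbg' : b.refl • g' = -g := by rw [hg', Root.smul_neg', Root.refl_smul_refl_smul]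
  have hN' : S.twoRho g'.co = b.fn g.co * S.twoRho b.co - S.twoRho g.co := by
    rw [hg', Root.neg_co, map_neg, twoRho_refl_smul]; ring
  have hn' : g'.fn b.co = g.fn b.co := by
    rw [hg', Root.neg_fn, LinearMap.neg_apply, Root.refl_smul_fn_apply, b.fn_co]; ring
  have hNg := Root.twoRho_co_ge hg
  have hNg' := Root.twoRho_co_ge hg'pos
  have two : ∀ g : S.Root, g.Pos → 2 ≤ g.fn b.co → 2 * S.twoRho g.co ≤ S.twoRho b.co →
      ReachRefl b v := by
    intro g hg hn h2
    have hNg := Root.twoRho_co_ge hg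
    have hc : (v • g).chi + (1 - (v • b.refl • g).chi) ≤ 2 := by
      rcases Root.chi_eq (v • g) with h | h <;> rcases Root.chi_eq (v • b.refl • g) with h' | h' <;>
        omega
    by_cases h : (g.refl • b).Pos
    · refine reachRefl_of_refl_smul_pos hv (IH hg (by linarith)) (IH h ?_) ?_
      · rw [twoRho_refl_smul]; nlinarith
      · exact mul_nonpos_of_nonpos_of_nonneg (by linarith) (by linarith)
    · refine reachRefl_of_refl_smul_not_pos hv h (IH hg (by linarith)) ?_
      nlinarith
  have one : ∀ g : S.Root, g.Pos → g.fn b.co = 1 → (g.refl • b).Pos →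
      (v • g).chi ≤ (v • b.refl • g).chi → ReachRefl b v := by
    intro g hg hn h hc
    have hNg := Root.twoRho_co_ge hg
    have hNd := Root.twoRho_co_ge h
    rw [twoRho_refl_smul, hn] at hNd
    refine reachRefl_of_refl_smul_pos hv (IH hg (by linarith)) (IH h ?_) ?_
    · rw [twoRho_refl_smul, hn]; linarith
    · rw [hn]
      exact mul_nonpos_of_nonpos_of_nonneg (by linarith) (by linarith)
  rcases (show 2 ≤ g.fn b.co ∨ g.fn b.co = 1 by omega) with hn2 | hn1
  · have hk1 : b.fn g.co = 1 := by nlinarith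
    rw [hk1] at hN'
    by_cases hle : S.twoRho g.co ≤ S.twoRho g'.co
    · exact two g hg hn2 (by linarith)
    · exact two g' hg'pos (by linarith) (by linarith)
  · have hvg : (v • g).Pos := hdir hn1
    by_cases h : (g.refl • b).Pos
    · refine one g hg hn1 h ?_
      rw [Root.chi_of_pos hvg]
      rcases Root.chi_eq (v • b.refl • g) with h' | h' <;> omega
    by_cases h' : (g'.refl • b).Pos
    · refine one g' hg'pos (by omega) h' ?_
      rw [hbg', Root.smul_neg', Root.chi_neg, Root.chi_of_pos hvg]
      rcases Root.chi_eq (v • g') with h' | h' <;> omega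
    set e : S.Root := -(g.refl • b) with he
    have hepos : e.Pos := (Root.not_pos_iff _).1 h
    have he'pos : (-(g'.refl • b)).Pos := (Root.not_pos_iff _).1 h'
    have hk3 : b.fn g.co = 3 := by
      have h1 := Root.twoRho_co_ge hepos
      have h2 := Root.twoRho_co_ge he'pos
      rw [he, Root.neg_co, map_neg, twoRho_refl_smul, hn1] at h1
      rw [Root.neg_co, map_neg, twoRho_refl_smul, hn', hn1, hN'] at h2
      rw [hn1] at hnk
      have h3 := Root.twoRho_co_ge hb
      have : 2 < b.fn g.co := by
        by_contra hle
        push Not at hle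
        nlinarith
      omega
    have hefn : e.fn = 3 • g.fn - b.fn := by
      rw [he, Root.neg_fn, Root.refl_smul_fn, hk3]; module
    have heco : b.fn e.co = 1 := by
      rw [he, Root.neg_co, map_neg, Root.refl_smul_co, map_sub, map_smul, hn1, b.fn_co, hk3]
      norm_num
    have hg'fn : g'.fn = b.fn - g.fn := by
      rw [hg', Root.neg_fn, Root.refl_smul_fn, hn1]; module
    have hg'co : b.fn g'.co = 3 := by
      rw [hg', Root.neg_co, map_neg, Root.refl_smul_co, map_sub, map_smul, b.fn_co, hk3]
      norm_num
    refine one e hepos ?_ ?_ ?_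
    · rw [hefn, LinearMap.sub_apply, LinearMap.smul_apply, hn1, b.fn_co]; norm_num
    · have : (e.refl • b).fn = (-(g'.refl • b)).fn := by
        rw [Root.refl_smul_fn, heco, hefn, Root.neg_fn, Root.refl_smul_fn, hg'co, hg'fn]
        module
      change S.IsPos _
      rw [this]
      exact he'pos
    · have hve : (v • e).Pos := by
        have : (v • e).fn = 3 • (v • g).fn + (-(v • b)).fn := by
          ext l
          simp only [Root.fn_smul, hefn, LinearMap.add_apply, LinearMap.smul_apply,
            LinearMap.sub_apply, Root.neg_fn, LinearMap.neg_apply]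
          ring
        change S.IsPos _
        rw [this]
        exact IsPos.add (nsmul_mem hvg 3) ((Root.not_pos_iff _).1 hv)
      rw [Root.chi_of_pos hve]
      rcases Root.chi_eq (v • b.refl • e) with h' | h' <;> omega

/-- Right multiplication by `u` can be achieved in `ℓ(u)` steps. -/
theorem reach_mul (x u : S.W₀) : S.Reach x (x * u) (S.length₀ u) := by
  induction hn : S.length₀ u generalizing u with
  | zero =>
    by_cases hu : u = 1
    · subst hu
      simpa using Reach.refl x
    · obtain ⟨i, hi⟩ := exists_not_pos hu
      have h1 := length₀_mul_sr u i
      rw [Root.chi_of_not_pos hi] at h1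
      omega
  | succ n ih =>
    have hu : u ≠ 1 := fun h => by rw [h, length₀_one] at hn; omega
    obtain ⟨i, hi⟩ := exists_not_pos hu
    have h1 := length₀_mul_sr u i
    rw [Root.chi_of_not_pos hi] at h1
    have h2 := (ih (u * S.sr i) (by omega)).trans (reachRefl (simple_pos i) (x * (u * S.sr i)))
    rw [refl_simple, ← mul_assoc, mul_sr_mul_sr] at h2
    refine h2.mono ?_
    have h3 := length₀_mul_sr (x * u) i
    have h4 : ((x * u * S.sr i) • S.simple i).chi = 1 - ((x * u) • S.simple i).chi := by
      rw [← Root.chi_neg, ← Root.smul_neg', ← Root.refl_smul_self, refl_simple, ← mul_smul]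
    rw [h3, h4, simple_co, twoRho_coroot]
    push_cast
    linarith

theorem hasPath_dΓ (x y : S.W₀) : S.HasPath x y (S.dΓ x y) := by
  have h := reach_mul x (x⁻¹ * y)
  rw [mul_inv_cancel_left] at h
  obtain ⟨m, hm, -⟩ := h
  exact Nat.sInf_mem (s := {n | S.HasPath x y n}) ⟨m, hm⟩

theorem reach_dΓ (x y : S.W₀) : S.Reach x y (S.dΓ x y) := ⟨_, hasPath_dΓ x y, le_rfl⟩

end FiniteType

end SimpleRoots

namespace SimpleRoots

variable {Λ : Type*} [AddCommGroup Λ] {I : Type*} {S : SimpleRoots Λ I}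

/-! ### The length function on the Iwahori–Weyl group -/

/-- The element `m` of `Λ` with `w = u t^m`, `u ∈ W₀`. -/
def tr (w : S.Wext) : Λ := (w.right⁻¹).1 (Multiplicative.toAdd w.left)

@[simp] theorem incl_right (u : S.W₀) : (S.incl u).right = u := rfl

@[simp] theorem t_right (l : Λ) : (S.t l).right = 1 := rfl

theorem tr_t (l : Λ) : tr (S.t l) = l := by simp [tr, t]

theorem tr_incl (u : S.W₀) : tr (S.incl u) = 0 := by simp [tr, incl]

theorem tr_mul (w w' : S.Wext) : tr (w * w') = (w'.right⁻¹).1 (tr w) + tr w' := by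
  have h : Multiplicative.toAdd (w * w').left =
    Multiplicative.toAdd w.left + w.right.1 (Multiplicative.toAdd w'.left) := rfl
  have h2 : ∀ l, (w'.right⁻¹).1 ((w.right⁻¹).1 (w.right.1 l)) = (w'.right⁻¹).1 l := fun l => by
    congr 1
    exact w.right.1.symm_apply_apply l
  have h3 : ∀ l, ((w * w').right⁻¹).1 l = (w'.right⁻¹).1 ((w.right⁻¹).1 l) := fun l => by
    rw [SemidirectProduct.mul_right, mul_inv_rev]; rfl
  rw [tr, h3, h, map_add, map_add, h2]
  rfl

theorem Wext_ext {w w' : S.Wext} (h1 : w.right = w'.right) (h2 : tr w = tr w') : w = w' := by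
  refine SemidirectProduct.ext ?_ h1
  rw [tr, tr, h1] at h2
  exact (w'.right⁻¹).1.injective h2

theorem tr_form (x y : S.W₀) (l : Λ) : tr (S.incl x * S.t l * S.incl y) = (y⁻¹).1 l := by
  simp [tr_mul, tr_t, tr_incl]

theorem right_form (x y : S.W₀) (l : Λ) : (S.incl x * S.t l * S.incl y).right = x * y := by
  simp

/-- The contribution of a root to the length of `u t^m`, with its sign. -/
noncomputable def ell (u : S.W₀) (m : Λ) (r : S.Root) : ℤ := r.fn m + (u • r).chi - r.chi

section FiniteType

variable [hS : S.IsFiniteType]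

theorem ell_neg (u : S.W₀) (m : Λ) (r : S.Root) : ell u m (-r) = -ell u m r := by
  simp only [ell, Root.neg_fn, Root.smul_neg', Root.chi_neg, LinearMap.neg_apply]
  ring

/-- The length of `u t^m`. -/
noncomputable def len (u : S.W₀) (m : Λ) : ℤ := ∑ r ∈ S.pos, |ell u m r|

theorem length_eq_len (w : S.Wext) : (S.length w : ℤ) = len w.right (tr w) := by
  classical
  set u := w.right with hu
  set m := tr w with hm
  have hc : ∀ r : S.Root, (movePair u.1 r.1).1 (Multiplicative.toAdd w.left) = r.fn m := by
    intro r
    rfl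
  let F : Finset (S.Root × ℤ) := Finset.univ.biUnion fun r : S.Root =>
    (Finset.Ico r.chi (r.fn m + (u • r).chi)).image fun k => (r, k)
  have hmem : ∀ r k, (r, k) ∈ F ↔ r.chi ≤ k ∧ k < r.fn m + (u • r).chi := by
    intro r k
    simp [F]
  have h1 : S.length w = F.card := by
    rw [length, ← Set.ncard_coe_finset]
    refine Eq.trans ?_ (Set.ncard_image_of_injective (F : Set (S.Root × ℤ))
      (f := fun a => (a.1.toPair, a.2)) (fun a b h => ?_))
    · congr 1
      ext ⟨r, k⟩
      have key : ∀ r : S.Root, (S.AffPos (r.toPair, k) ∧ S.AffNeg (S.moveAff w (r.toPair, k))) ↔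
          (r, k) ∈ F := by
        intro r
        have e1 : S.AffPos (r.toPair, k) ↔ r.chi ≤ k := by
          change (0 < k ∨ (k = 0 ∧ r.Pos)) ↔ _
          by_cases h : r.Pos
          · rw [Root.chi_of_pos h]; simp only [h, and_true]; omega
          · rw [Root.chi_of_not_pos h]; simp only [h, and_false, or_false]; omega
        have e2 : S.AffNeg (S.moveAff w (r.toPair, k)) ↔ k < r.fn m + (u • r).chi := by
          change (k - r.fn m < 0 ∨ (k - r.fn m = 0 ∧ (-(u • r)).Pos)) ↔ _
          rw [Root.pos_neg_iff]
          by_cases h : (u • r).Pos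
          · rw [Root.chi_of_pos h]; simp only [h, not_true, and_false, or_false]; omega
          · rw [Root.chi_of_not_pos h]; simp only [h, not_false_iff, and_true]; omega
        rw [hmem, e1, e2]
      constructor
      · rintro ⟨hr, h⟩
        exact ⟨(⟨r, hr⟩, k), (key ⟨r, hr⟩).1 h, rfl⟩
      · rintro ⟨⟨q, k'⟩, h, he⟩
        obtain ⟨rfl, rfl⟩ := Prod.mk.inj he
        exact ⟨q.2, (key q).2 h⟩
    · obtain ⟨h1, h2⟩ := Prod.mk.inj h
      exact Prod.ext (Root.toPair_injective h1) h2
  have h2 : F.card = ∑ r : S.Root, (ell u m r).toNat := by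
    rw [Finset.card_biUnion]
    · refine Finset.sum_congr rfl fun r _ => ?_
      rw [Finset.card_image_of_injective _ fun a b h => (Prod.mk.inj h).2, Int.card_Ico, ell]
    · intro r _ q _ hne
      rw [Function.onFun, Finset.disjoint_left]
      rintro ⟨a, k⟩ h h'
      simp only [Finset.mem_image, Prod.mk.injEq] at h h'
      obtain ⟨_, _, rfl, _⟩ := h
      obtain ⟨_, _, rfl, _⟩ := h'
      exact hne rfl
  rw [h1, h2]
  push_cast
  rw [sum_univ_eq, len]
  refine Finset.sum_congr rfl fun r _ => ?_
  rw [ell_neg]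
  rcases abs_cases (ell u m r) with h | h <;> omega

theorem len_eq (u : S.W₀) (m : Λ) (v : S.W₀) : len u m = ∑ r ∈ S.pos, |ell u m (v • r)| :=
  (sum_pos_smul (G := fun r => |ell u m r|) (fun r => by rw [ell_neg, abs_neg]) v).symm

/-- The sum of the signed contributions of the roots `v r`, `r > 0`, to the length of `u t^m`. -/
noncomputable def lenAt (u : S.W₀) (m : Λ) (v : S.W₀) : ℤ :=
  S.twoRho ((v⁻¹).1 m) + S.length₀ (u * v) - S.length₀ v

theorem lenAt_eq (u : S.W₀) (m : Λ) (v : S.W₀) :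
    lenAt u m v = ∑ r ∈ S.pos, ell u m (v • r) := by
  simp only [ell, Finset.sum_sub_distrib, Finset.sum_add_distrib]
  rw [lenAt, twoRho_apply, length₀_eq, length₀_eq]
  simp only [mul_smul, Root.fn_smul]

theorem lenAt_le_len (u : S.W₀) (m : Λ) (v : S.W₀) : lenAt u m v ≤ len u m := by
  rw [len_eq u m v, lenAt_eq]
  exact Finset.sum_le_sum fun r _ => le_abs_self _

omit hS in
variable (S) in
/-- `v` is length positive for `u t^m`. -/
def LenPos (u : S.W₀) (m : Λ) (v : S.W₀) : Prop := ∀ r : S.Root, r.Pos → 0 ≤ ell u m (v • r)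

theorem LenPos.lenAt_eq_len {u : S.W₀} {m : Λ} {v : S.W₀} (h : S.LenPos u m v) :
    lenAt u m v = len u m := by
  rw [len_eq u m v, lenAt_eq]
  exact Finset.sum_congr rfl fun r hr => (abs_of_nonneg (h r (mem_pos.1 hr))).symm

theorem reach_mul_refl {b : S.Root} (hb : b.Pos) (v : S.W₀) :
    S.Reach v (v * b.refl)
      (S.length₀ (v * b.refl) - S.length₀ v + (v • b).chi * S.twoRho b.co) := reachRefl hb v

theorem reach_mul_refl' {b : S.Root} (hb : b.Pos) (v : S.W₀) :
    S.Reach (v * b.refl) v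
      (S.length₀ v - S.length₀ (v * b.refl) + (1 - (v • b).chi) * S.twoRho b.co) := by
  have h := reach_mul_refl hb (v * b.refl)
  rwa [Root.mul_refl_mul_refl, mul_smul, Root.refl_smul_self, Root.smul_neg', Root.chi_neg] at h

theorem exists_lenPos (u : S.W₀) (m : Λ) (v : S.W₀) :
    ∃ v', S.LenPos u m v' ∧ ∃ a b, S.Reach v' v a ∧ S.Reach (u * v) (u * v') b ∧
      a + b ≤ len u m - lenAt u m v := by
  induction hn : (len u m - lenAt u m v).toNat using Nat.strong_induction_on generalizing v with
  | _ n ih =>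
  subst hn
  by_cases h : S.LenPos u m v
  · exact ⟨v, h, 0, 0, Reach.refl v, Reach.refl _, by rw [h.lenAt_eq_len]; simp⟩
  simp only [LenPos, not_forall, not_le] at h
  obtain ⟨r, hr, hlt⟩ := h
  have h1 := reach_mul_refl' hr v
  have h2 := reach_mul_refl hr (u * v)
  have h3 : lenAt u m (v * r.refl) - lenAt u m v = -((v • r).fn m * S.twoRho r.co) +
      S.length₀ (u * v * r.refl) - S.length₀ (u * v) - S.length₀ (v * r.refl) + S.length₀ v := by
    have : ((v * r.refl)⁻¹).1 m = (v⁻¹).1 m - (v • r).fn m • r.co := by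
      rw [mul_inv_rev, Root.refl_inv]
      exact r.refl_apply _
    rw [lenAt, lenAt, this, map_sub, map_smul, smul_eq_mul, mul_assoc u]
    ring
  have h4 : (u • v • r).chi + (1 - (v • r).chi) ≤ -(v • r).fn m := by
    rw [ell] at hlt
    linarith
  have h5 := Root.twoRho_co_ge hr
  have h6 := h1.pos (fun h => by
    have := congrArg (v⁻¹ * ·) h
    simp only [inv_mul_cancel_left, inv_mul_cancel] at this
    have h7 := Root.refl_smul_self r
    rw [this, one_smul] at h7
    exact r.neg_ne_self h7.symm)
  have h7 := h2.nonneg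
  rw [mul_smul] at h2 h7
  have h8 : (1 - (v • r).chi) * S.twoRho r.co + (u • v • r).chi * S.twoRho r.co ≤
      -((v • r).fn m * S.twoRho r.co) := by nlinarith
  have h9 := lenAt_le_len u m (v * r.refl)
  obtain ⟨v', hv', a, b, ha, hb, hab⟩ := ih _ (by omega) (v * r.refl) rfl
  rw [← mul_assoc] at hb
  exact ⟨v', hv', _, _, ha.trans h1, h2.trans hb, by linarith⟩

/-- One of the two length estimates for the product of `u t^m` with an affine reflection. -/
theorem exists_lenAt_ge_of_pos {u : S.W₀} {m : Λ} {v : S.W₀} {a : S.Root} {k : ℤ}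
    (hv : (v⁻¹ • a).Pos) (h : (u • a).chi ≤ -k ∨ a.fn m + 1 - a.chi ≤ k) :
    ∃ v' p q, S.Reach v' v p ∧ S.Reach (u * v) (u * a.refl * v') q ∧
      p + q ≤ lenAt (u * a.refl) (m - k • a.co) v' - lenAt u m v := by
  obtain ⟨b, rfl⟩ : ∃ b, a = v • b := ⟨v⁻¹ • a, by rw [smul_inv_smul]⟩
  rw [inv_smul_smul] at hv
  have h5 := Root.twoRho_co_ge hv
  have e1 : u * (v • b).refl * v = u * v * b.refl := by
    rw [mul_assoc, ← Root.mul_refl, mul_assoc]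
  have e3 : ∀ l, (v⁻¹).1 (v.1 l) = l := fun l => v.1.symm_apply_apply l
  rcases h with h | h
  · refine ⟨v, 0, S.length₀ (u * v * b.refl) - S.length₀ (u * v) +
      ((u * v) • b).chi * S.twoRho b.co, Reach.refl v, ?_, ?_⟩
    · rw [e1]; exact reach_mul_refl hv (u * v)
    · have e2 : (v⁻¹).1 (m - k • (v • b).co) = (v⁻¹).1 m - k • b.co := by
        rw [map_sub, map_smul, Root.co_smul, e3]
      rw [lenAt, lenAt, e1, e2, map_sub, map_smul, smul_eq_mul, mul_smul]
      nlinarith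
  · have e2 : u * (v • b).refl * (v * b.refl) = u * v := by
      rw [← mul_assoc, e1, Root.mul_refl_mul_refl]
    refine ⟨v * b.refl, _, 0, reach_mul_refl' hv v, ?_, ?_⟩
    · rw [e2]; exact Reach.refl _
    · have e4 : ((v * b.refl)⁻¹).1 (m - k • (v • b).co) =
          (v⁻¹).1 m + (k - (v • b).fn m) • b.co := by
        have : ((v * b.refl)⁻¹).1 (m - k • (v • b).co) = b.refl.1 ((v⁻¹).1 (m - k • (v • b).co)) := by
          rw [mul_inv_rev, Root.refl_inv]; rfl
        rw [this, map_sub, map_smul, Root.co_smul, e3, Root.refl_apply, map_sub, map_smul, b.fn_co,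
          Root.fn_smul, smul_eq_mul]
        module
      rw [lenAt, lenAt, e2, e4, map_add, map_smul, smul_eq_mul]
      nlinarith

theorem exists_lenAt_ge {u : S.W₀} {m : Λ} {a : S.Root} {k : ℤ} (v : S.W₀)
    (h : Xor ((u • a).chi ≤ -k) (a.fn m + 1 - a.chi ≤ k)) :
    ∃ v' p q, S.Reach v' v p ∧ S.Reach (u * v) (u * a.refl * v') q ∧
      p + q ≤ lenAt (u * a.refl) (m - k • a.co) v' - lenAt u m v := by
  by_cases hv : (v⁻¹ • a).Pos
  · exact exists_lenAt_ge_of_pos hv (h.imp And.left And.left)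
  · have h1 := exists_lenAt_ge_of_pos (u := u) (m := m) (v := v) (a := -a) (k := -k)
      (by rw [Root.smul_neg']; exact (Root.not_pos_iff _).1 hv) (by
        simp only [Root.smul_neg', Root.chi_neg, Root.neg_fn, LinearMap.neg_apply]
        rcases h with ⟨_, h⟩ | ⟨_, h⟩
        · right; omega
        · left; omega)
    rwa [Root.refl_neg, Root.neg_co, neg_smul, smul_neg, neg_neg] at h1

theorem exists_lenPos_of_len_lt {u : S.W₀} {m : Λ} {a : S.Root} {k : ℤ}
    (hlt : len u m < len (u * a.refl) (m - k • a.co)) {v : S.W₀} (hv : S.LenPos u m v) :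
    ∃ v', S.LenPos (u * a.refl) (m - k • a.co) v' ∧ ∃ p q, S.Reach v' v p ∧
      S.Reach (u * v) (u * a.refl * v') q ∧
      p + q ≤ len (u * a.refl) (m - k • a.co) - len u m := by
  by_cases h : Xor ((u • a).chi ≤ -k) (a.fn m + 1 - a.chi ≤ k)
  · obtain ⟨v1, p, q, hp, hq, hpq⟩ := exists_lenAt_ge v h
    obtain ⟨v2, hv2, p', q', hp', hq', hpq'⟩ :=
      exists_lenPos (u * a.refl) (m - k • a.co) v1
    rw [hv.lenAt_eq_len] at hpq
    exact ⟨v2, hv2, _, _, hp'.trans hp, hq.trans hq', by linarith⟩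
  · exfalso
    obtain ⟨v1, hv1, -⟩ := exists_lenPos (u * a.refl) (m - k • a.co) 1
    have h' : Xor (((u * a.refl) • a).chi ≤ -(-k)) (a.fn (m - k • a.co) + 1 - a.chi ≤ -k) := by
      rw [mul_smul, Root.refl_smul_self, Root.smul_neg', Root.chi_neg, map_sub, map_smul, a.fn_co,
        smul_eq_mul]
      rw [not_xor] at h
      by_cases h1 : a.fn m + 1 - a.chi ≤ k
      · exact Or.inr ⟨by omega, fun h2 => by have := h.2 h1; omega⟩
      · refine Or.inl ⟨?_, by omega⟩
        by_contra h2
        exact h1 (h.1 (by omega))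
    obtain ⟨v2, p, q, hp, hq, hpq⟩ := exists_lenAt_ge v1 h'
    rw [Root.mul_refl_mul_refl, neg_smul, sub_neg_eq_add, sub_add_cancel, hv1.lenAt_eq_len] at hpq
    have h1 := lenAt_le_len u m v2
    have h2 := hp.nonneg
    have h3 := hq.nonneg
    linarith

omit hS in
theorem exists_of_mem_affReflections {r : S.Wext} (hr : r ∈ S.affReflections) (w : S.Wext) :
    ∃ (a : S.Root) (k : ℤ), (r * w).right = w.right * a.refl ∧ tr (r * w) = tr w - k • a.co := by
  obtain ⟨r, hr, k, s, hs, rfl⟩ := hr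
  obtain rfl : s = Root.refl ⟨r, hr⟩ := Root.eq_refl_of_isReflection (r := ⟨r, hr⟩) hs
  set b : S.Root := ⟨r, hr⟩ with hb
  have hco : r.2 = b.co := rfl
  refine ⟨w.right⁻¹ • b, k, ?_, ?_⟩
  · rw [Root.mul_refl, smul_inv_smul]
    simp
  · rw [tr_mul, tr_mul, tr_t, tr_incl, incl_right, add_zero, Root.refl_inv, map_smul, hco,
      ← Root.co_smul b.refl b, Root.refl_smul_self, Root.neg_co, Root.co_smul, map_smul, map_neg]
    module

theorem BruhatLE.exists_lenPos {w w' : S.Wext} (h : S.BruhatLE w w') {v : S.W₀}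
    (hv : S.LenPos w.right (tr w) v) :
    ∃ v', S.LenPos w'.right (tr w') v' ∧ ∃ p q, S.Reach v' v p ∧
      S.Reach (w.right * v) (w'.right * v') q ∧ p + q ≤ (S.length w' : ℤ) - S.length w := by
  induction h with
  | refl => exact ⟨v, hv, 0, 0, Reach.refl _, Reach.refl _, by simp⟩
  | @tail y z _ hyz ih =>
    obtain ⟨v1, hv1, p, q, hp, hq, hpq⟩ := ih
    obtain ⟨r, hr, rfl, hlt⟩ := hyz
    obtain ⟨a, k, e1, e2⟩ := exists_of_mem_affReflections hr y
    have hlt' : (S.length y : ℤ) < S.length (r * y) := by exact_mod_cast hlt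
    rw [length_eq_len y, length_eq_len (r * y), e1, e2] at hlt'
    obtain ⟨v2, hv2, p', q', hp', hq', hpq'⟩ := exists_lenPos_of_len_lt hlt' hv1
    rw [length_eq_len (r * y), e1, e2]
    rw [length_eq_len y] at hpq
    exact ⟨v2, hv2, _, _, hp'.trans hp, hq.trans hq', by linarith⟩

omit hS in
theorem IsPos.nonneg' {r : S.Root} (h : r.Pos) {l : Λ} (hl : S.IsDominant l) : 0 ≤ r.fn l :=
  IsPos.nonneg h hl

theorem length_t {l : Λ} (hl : S.IsDominant l) (z : S.W₀) :
    (S.length (S.t (z.1 l)) : ℤ) = S.twoRho l := by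
  have h : S.LenPos 1 (z.1 l) z := fun r hr => by
    rw [ell, one_smul, add_sub_cancel_right, Root.fn_smul_apply]
    exact IsPos.nonneg' hr hl
  rw [length_eq_len, tr_t, t_right, ← h.lenAt_eq_len, lenAt, one_mul, add_sub_cancel_right]
  congr 1
  exact z.1.symm_apply_apply l

/-- The upper bound for the length of the elements of the admissible set. -/
theorem reach_of_mem_adm {l : Λ} (hl : S.IsDominant l) {w : S.Wext} (hw : w ∈ S.Adm l) {v : S.W₀}
    (hv : S.LenPos w.right (tr w) v) :
    S.Reach (w.right * v) v (S.twoRho l - S.length w) := by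
  obtain ⟨z, hz⟩ := hw
  obtain ⟨v', -, p, q, hp, hq, hpq⟩ := BruhatLE.exists_lenPos hz hv
  rw [t_right, one_mul] at hq
  rw [length_t hl] at hpq
  exact (hq.trans hp).mono (by linarith)

/-! ### Standard forms -/

theorem IsStandardForm.pos_of_root_eq_zero {w : S.Wext} {x y : S.W₀} {l : Λ}
    (h : S.IsStandardForm w x l y) (i : I) (hi : S.root i l = 0) : (y⁻¹ • S.simple i).Pos := by
  by_contra hneg
  obtain ⟨-, hl, hmin⟩ := h
  have h1 := hmin (S.sr i)
  have h0 : ∀ u : S.W₀, S.incl u * (S.t l * S.incl y) = S.incl u * S.t l * S.incl y :=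
    fun u => (mul_assoc _ _ _).symm
  have h00 : S.t l * S.incl y = S.incl 1 * S.t l * S.incl y := by
    rw [← h0]; exact (one_mul _).symm
  rw [h0, h00] at h1
  have h2 : len (1 * y) ((y⁻¹).1 l) ≤ len (S.sr i * y) ((y⁻¹).1 l) := by
    have h3 : (S.length (S.incl 1 * S.t l * S.incl y) : ℤ) ≤
        S.length (S.incl (S.sr i) * S.t l * S.incl y) := by exact_mod_cast h1
    rwa [length_eq_len, length_eq_len, tr_form, tr_form, right_form, right_form] at h3
  rw [len_eq _ _ y⁻¹, len_eq _ _ y⁻¹] at h2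
  have e : ∀ (u : S.W₀) (r : S.Root), ell (u * y) ((y⁻¹).1 l) (y⁻¹ • r) =
      r.fn l + (u • r).chi - (y⁻¹ • r).chi := fun u r => by
    rw [ell, Root.fn_smul_apply, mul_smul, smul_inv_smul]
  simp only [e, one_smul] at h2
  refine absurd h2 (not_le.2 (Finset.sum_lt_sum (fun r hr => ?_)
    ⟨S.simple i, mem_pos.2 (simple_pos i), ?_⟩))
  · by_cases hr' : r = S.simple i
    · subst hr'
      rw [← refl_simple, Root.refl_smul_self, Root.chi_neg, Root.chi_of_pos (simple_pos i),
        Root.chi_of_not_pos hneg, simple_fn, hi]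
      norm_num
    · rw [Root.chi_of_pos (mem_pos.1 hr), Root.chi_of_pos ((mem_pos.1 hr).sr_smul hr')]
  · rw [← refl_simple, Root.refl_smul_self, Root.chi_neg, Root.chi_of_pos (simple_pos i),
      Root.chi_of_not_pos hneg, simple_fn, hi]
    norm_num

end FiniteType

end SimpleRoots

namespace SimpleRoots

variable {Λ : Type*} [AddCommGroup Λ] {I : Type*} {S : SimpleRoots Λ I}

section FiniteType

variable [hS : S.IsFiniteType]

omit hS in
theorem ell_form (x y : S.W₀) (l : Λ) (r : S.Root) :
    ell (x * y) ((y⁻¹).1 l) (y⁻¹ • r) = r.fn l + (x • r).chi - (y⁻¹ • r).chi := by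
  rw [ell, Root.fn_smul_apply, mul_smul, smul_inv_smul]

omit hS in
theorem lenPos_form {y : S.W₀} {l : Λ} (hl : S.IsDominant l)
    (hy : ∀ i, S.root i l = 0 → (y⁻¹ • S.simple i).Pos) (x : S.W₀) :
    S.LenPos (x * y) ((y⁻¹).1 l) y⁻¹ := by
  have key : ∀ a : Module.Dual ℤ Λ, S.IsPos a → a l = 0 →
      S.IsPos (a ∘ₗ ((y⁻¹).1.symm : Λ →ₗ[ℤ] Λ)) := by
    intro a ha
    induction ha using AddSubmonoid.closure_induction with
    | mem a ha => obtain ⟨i, rfl⟩ := ha; exact hy i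
    | zero => intro _; rw [LinearMap.zero_comp]; exact zero_mem _
    | add a b ha hb iha ihb =>
      intro h
      have h1 := IsPos.nonneg ha hl
      have h2 := IsPos.nonneg hb hl
      rw [LinearMap.add_apply] at h
      rw [LinearMap.add_comp]
      exact IsPos.add (iha (by linarith)) (ihb (by linarith))
  intro r hr
  rw [ell_form]
  have h1 := IsPos.nonneg' hr hl
  rcases h1.lt_or_eq with h2 | h2
  · rcases Root.chi_eq (x • r) with h | h <;> rcases Root.chi_eq (y⁻¹ • r) with h' | h' <;> omega
  · have h3 : (y⁻¹ • r).Pos := key _ hr h2.symm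
    rw [Root.chi_of_pos h3]
    rcases Root.chi_eq (x • r) with h | h <;> omega

theorem length_form {y : S.W₀} {l : Λ} (hl : S.IsDominant l)
    (hy : ∀ i, S.root i l = 0 → (y⁻¹ • S.simple i).Pos) (x : S.W₀) :
    (S.length (S.incl x * S.t l * S.incl y) : ℤ) = S.twoRho l + S.length₀ x - S.length₀ y := by
  rw [length_eq_len, tr_form, right_form, ← (lenPos_form hl hy x).lenAt_eq_len, lenAt,
    mul_inv_cancel_right, length₀_inv]
  congr 3
  exact (y⁻¹).1.symm_apply_apply l

theorem isStandardForm_of {y : S.W₀} {l : Λ} (hl : S.IsDominant l)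
    (hy : ∀ i, S.root i l = 0 → (y⁻¹ • S.simple i).Pos) (x : S.W₀) :
    S.IsStandardForm (S.incl x * S.t l * S.incl y) x l y := by
  refine ⟨rfl, hl, fun u => ?_⟩
  have h1 := length_form hl hy u
  have h2 := length_form hl hy 1
  have h3 : S.incl 1 * S.t l * S.incl y = S.t l * S.incl y := by
    rw [mul_assoc]; exact one_mul _
  rw [h3, length₀_one] at h2
  rw [mul_assoc] at h1
  have : (S.length (S.t l * S.incl y) : ℤ) ≤ S.length (S.incl u * (S.t l * S.incl y)) := by
    rw [h1, h2]; push_cast; linarith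
  exact_mod_cast this

theorem IsStandardForm.lenPos {w : S.Wext} {x y : S.W₀} {l : Λ} (h : S.IsStandardForm w x l y) :
    S.LenPos w.right (tr w) y⁻¹ := by
  have h1 := lenPos_form h.2.1 h.pos_of_root_eq_zero x
  rwa [h.1, tr_form, right_form]

omit hS in
theorem mul_sr_inv_apply (v : S.W₀) (i : I) (m : Λ) :
    ((v * S.sr i)⁻¹).1 m = (v⁻¹).1 m - S.root i ((v⁻¹).1 m) • S.coroot i := by
  rw [mul_inv_rev, sr_inv]
  exact sr_apply i _

theorem exists_isDominant (m : Λ) : ∃ v : S.W₀, S.IsDominant ((v⁻¹).1 m) := by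
  have hb : ∀ v : S.W₀, S.twoRho ((v⁻¹).1 m) ≤ len (1 : S.W₀) m := fun v => by
    have h := lenAt_le_len (1 : S.W₀) m v
    rw [lenAt, one_mul] at h
    linarith
  have key : ∀ v : S.W₀, ∃ v : S.W₀, S.IsDominant ((v⁻¹).1 m) := by
    intro v
    induction hn : (len (1 : S.W₀) m - S.twoRho ((v⁻¹).1 m)).toNat using Nat.strong_induction_on
      generalizing v with
    | _ n ih =>
    subst hn
    by_cases h : S.IsDominant ((v⁻¹).1 m)
    · exact ⟨v, h⟩
    simp only [IsDominant, not_forall, not_le] at h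
    obtain ⟨i, hi⟩ := h
    refine ih _ ?_ (v * S.sr i) rfl
    have h1 := hb (v * S.sr i)
    rw [mul_sr_inv_apply, map_sub, map_smul, twoRho_coroot, smul_eq_mul] at h1 ⊢
    omega
  exact key 1

theorem exists_isStandardForm (w : S.Wext) : ∃ x l y, S.IsStandardForm w x l y := by
  obtain ⟨v, hv, hmin⟩ := WellFounded.has_min (measure (S.length₀)).wf
    {v : S.W₀ | S.IsDominant ((v⁻¹).1 (tr w))} (exists_isDominant (tr w))
  set l := (v⁻¹).1 (tr w) with hl
  have h1 := isStandardForm_of (y := v⁻¹) (l := l) hv (fun i hi => by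
    rw [inv_inv]
    by_contra hneg
    have h2 : ((v * S.sr i)⁻¹).1 (tr w) = l := by
      rw [mul_sr_inv_apply, ← hl, hi, zero_smul, sub_zero]
    refine hmin (v * S.sr i) ?_ ?_
    · change S.IsDominant _
      rw [h2]; exact hv
    · have h3 := length₀_mul_refl_lt (simple_pos i) hneg
      rwa [refl_simple] at h3) (w.right * v)
  refine ⟨w.right * v, l, v⁻¹, ?_⟩
  convert h1 using 1
  refine Wext_ext ?_ ?_
  · rw [right_form, mul_inv_cancel_right]
  · rw [tr_form, inv_inv, hl]
    exact (v.1.apply_symm_apply _).symm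

theorem exists_η_eq (σ : S.W₀ ≃* S.W₀) (w : S.Wext) :
    ∃ x l y, S.IsStandardForm w x l y ∧ S.η σ w = σ.symm y * x := by
  obtain ⟨x, l, y, h⟩ := exists_isStandardForm w
  exact Classical.epsilon_spec (p := fun z => ∃ x l y, S.IsStandardForm w x l y ∧ z = σ.symm y * x)
    ⟨_, x, l, y, h, rfl⟩

theorem η_form (σ : S.W₀ ≃* S.W₀) {x y : S.W₀} {l : Λ} (hl : ∀ i, 0 < S.root i l) :
    S.η σ (S.incl x * S.t l * S.incl y) = σ.symm y * x := by
  obtain ⟨x', l', y', ⟨h1, h2, -⟩, h⟩ := exists_η_eq σ (S.incl x * S.t l * S.incl y)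
  have e1 := congrArg tr h1
  rw [tr_form, tr_form] at e1
  have e2 := congrArg (fun w : S.Wext => w.right) h1
  simp only [right_form] at e2
  have hg : y' * y⁻¹ = 1 := by
    refine eq_one_of_forall_pos fun i => ?_
    by_contra hneg
    have e3 : l' = (y' * y⁻¹).1 l := by
      have : y'.1 ((y'⁻¹).1 l') = l' := y'.1.apply_symm_apply l'
      rw [← this, ← e1]; rfl
    have h3 := IsPos.nonneg' ((Root.not_pos_iff _).1 hneg) h2
    rw [Root.neg_fn, LinearMap.neg_apply, e3, Root.fn_smul_apply] at h3
    have := hl i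
    rw [simple_fn] at h3
    linarith
  have hy : y' = y := mul_inv_eq_one.1 hg
  rw [hy] at e2
  rw [h, hy, mul_right_cancel e2]

/-! ### The upper bound -/

/-- The minimum of the distances `d_Γ(x, σ(x) w₀)`. -/
noncomputable def minDist (σ : S.W₀ ≃* S.W₀) : ℕ :=
  sInf (Set.range fun x : S.W₀ => S.dΓ x (σ x * S.longest))

theorem length_add_length_η_le {σ : S.W₀ ≃* S.W₀} (hσ : ∀ u, S.length₀ (σ u) = S.length₀ u)
    {l : Λ} (hl : S.IsDominant l) {w : S.Wext} (hw : w ∈ S.Adm l) :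
    (S.length w : ℤ) + S.length₀ (S.η σ w) ≤
      S.twoRho l + S.length₀ S.longest - minDist σ := by
  obtain ⟨x, l', y, h, hη⟩ := exists_η_eq σ w
  have h1 := reach_of_mem_adm hl hw h.lenPos
  have h2 : w.right * y⁻¹ = x := by
    rw [h.1, right_form, mul_inv_cancel_right]
  rw [h2] at h1
  have h3 := reach_mul y⁻¹ (σ (S.η σ w) * S.longest)
  have h4 : y⁻¹ * (σ (S.η σ w) * S.longest) = σ x * S.longest := by
    rw [hη, map_mul, MulEquiv.apply_symm_apply, mul_assoc, inv_mul_cancel_left]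
  rw [h4, length₀_mul_longest, hσ] at h3
  have h5 := (h1.trans h3).dΓ_le
  have h6 : minDist σ ≤ S.dΓ x (σ x * S.longest) := Nat.sInf_le ⟨x, rfl⟩
  have h7 : (minDist σ : ℤ) ≤ S.dΓ x (σ x * S.longest) := by exact_mod_cast h6
  linarith

end FiniteType

/-! ### Components -/

variable (S) in
/-- The simple roots in `C` are orthogonal to the other simple roots. -/
def IsClosed (C : Set I) : Prop :=
  ∀ j ∈ C, ∀ k ∉ C, S.root k (S.coroot j) = 0 ∧ S.root j (S.coroot k) = 0

theorem isClosed_component (i : I) : S.IsClosed {j | S.SameComponent i j} := by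
  intro j hj k hk
  constructor
  · by_contra h
    exact hk (Relation.EqvGen.trans _ _ _ hj (Relation.EqvGen.rel _ _ h))
  · by_contra h
    exact hk (Relation.EqvGen.trans _ _ _ hj
      (Relation.EqvGen.symm _ _ (Relation.EqvGen.rel _ _ h)))

theorem IsClosed.compl {C : Set I} (h : S.IsClosed C) : S.IsClosed Cᶜ := by
  intro j hj k hk
  exact (h k (not_not.1 hk) j hj).symm

variable (S) in
/-- The parabolic subgroup generated by the simple reflections in `C`. -/
def par (C : Set I) : Subgroup S.W₀ := Subgroup.closure (S.sr '' C)

theorem coe_mem_of_mem_par {C : Set I} {u : S.W₀} (h : u ∈ S.par C) :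
    u.1 ∈ Subgroup.closure (S.simpleReflection '' C) := by
  have h1 : S.par C ≤ (Subgroup.closure (S.simpleReflection '' C)).comap S.W₀.subtype := by
    refine (Subgroup.closure_le _).2 ?_
    rintro _ ⟨i, hi, rfl⟩
    exact Subgroup.subset_closure ⟨i, hi, rfl⟩
  exact h1 h

theorem sr_mem_par {C : Set I} {i : I} (h : i ∈ C) : S.sr i ∈ S.par C :=
  Subgroup.subset_closure ⟨i, h, rfl⟩

theorem IsClosed.smul_simple {C : Set I} (hC : S.IsClosed C) {u : S.W₀} (hu : u ∈ S.par C) {k : I}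
    (hk : k ∉ C) : u • S.simple k = S.simple k := by
  induction hu using Subgroup.closure_induction with
  | mem x hx =>
    obtain ⟨j, hj, rfl⟩ := hx
    obtain ⟨h1, h2⟩ := hC j hj k hk
    refine Root.ext' ?_ ?_
    · rw [← refl_simple, Root.refl_smul_fn]
      simp [h1]
    · rw [← refl_simple, Root.refl_smul_co]
      simp [h2]
  | one => rw [one_smul]
  | mul x y _ _ hx hy => rw [mul_smul, hy, hx]
  | inv x _ hx => rw [inv_smul_eq_iff, hx]

theorem IsClosed.commute {C : Set I} (hC : S.IsClosed C) {u v : S.W₀} (hu : u ∈ S.par C)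
    (hv : v ∈ S.par Cᶜ) : Commute u v := by
  induction hv using Subgroup.closure_induction with
  | mem x hx =>
    obtain ⟨k, hk, rfl⟩ := hx
    have h := Root.mul_refl u (S.simple k)
    rwa [hC.smul_simple hu hk, refl_simple] at h
  | one => exact Commute.one_right u
  | mul x y _ _ hx hy => exact hx.mul_right hy
  | inv x _ hx => exact hx.inv_right

/-- The root belongs to the component `C`. -/
def Root.InComp (C : Set I) (r : S.Root) : Prop := ∃ u ∈ S.par C, ∃ i ∈ C, r = u • S.simple i

theorem IsClosed.exists_mul {C : Set I} (hC : S.IsClosed C) (u : S.W₀) :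
    ∃ a ∈ S.par C, ∃ b ∈ S.par Cᶜ, u = a * b := by
  induction u using W₀_induction with
  | one => exact ⟨1, one_mem _, 1, one_mem _, by simp⟩
  | mul u i ih =>
    obtain ⟨a, ha, b, hb, rfl⟩ := ih
    by_cases hi : i ∈ C
    · refine ⟨a * S.sr i, mul_mem ha (sr_mem_par hi), b, hb, ?_⟩
      rw [mul_assoc, mul_assoc, (hC.commute (sr_mem_par hi) hb).eq]
    · exact ⟨a, ha, b * S.sr i, mul_mem hb (sr_mem_par hi), by rw [mul_assoc]⟩

theorem IsClosed.inComp_or {C : Set I} (hC : S.IsClosed C) (r : S.Root) :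
    r.InComp C ∨ r.InComp Cᶜ := by
  obtain ⟨u, i, rfl⟩ := r.exists_eq_smul_simple
  obtain ⟨a, ha, b, hb, rfl⟩ := hC.exists_mul u
  by_cases hi : i ∈ C
  · refine Or.inl ⟨a, ha, i, hi, ?_⟩
    rw [mul_smul, hC.compl.smul_simple hb (not_not.2 hi)]
  · refine Or.inr ⟨b, hb, i, hi, ?_⟩
    rw [(hC.commute ha hb).eq, mul_smul, hC.smul_simple ha hi]

theorem Root.InComp.refl_mem {C : Set I} {r : S.Root} (h : r.InComp C) : r.refl ∈ S.par C := by
  obtain ⟨u, hu, i, hi, rfl⟩ := h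
  rw [Root.refl_smul, refl_simple]
  exact mul_mem (mul_mem hu (sr_mem_par hi)) (inv_mem hu)

theorem IsClosed.smul_eq {C : Set I} (hC : S.IsClosed C) {u : S.W₀} (hu : u ∈ S.par C) {r : S.Root}
    (hr : r.InComp Cᶜ) : u • r = r := by
  obtain ⟨v, hv, k, hk, rfl⟩ := hr
  rw [← mul_smul, (hC.commute hu hv).eq, mul_smul, hC.smul_simple hu hk]

theorem IsClosed.root_co_eq_zero {C : Set I} (hC : S.IsClosed C) {i : I} (hi : i ∈ C) {r : S.Root}
    (hr : r.InComp Cᶜ) : S.root i r.co = 0 := by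
  obtain ⟨v, hv, k, hk, rfl⟩ := hr
  have h := hC.compl.smul_simple hv (not_not.2 hi)
  rw [← simple_fn, ← h, Root.co_smul, Root.fn_smul_apply]
  exact (hC i hi k hk).2

section FiniteType

variable [hS : S.IsFiniteType]

theorem IsClosed.length₀_mul_refl {C : Set I} (hC : S.IsClosed C) {u : S.W₀} (hu : u ∈ S.par C)
    {b : S.Root} (hb : b.InComp Cᶜ) (y : S.W₀) :
    (S.length₀ (y * u * b.refl) : ℤ) - S.length₀ (y * u) =
      S.length₀ (y * b.refl) - S.length₀ y := by
  rw [SimpleRoots.length₀_mul_refl, SimpleRoots.length₀_mul_refl]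
  refine Finset.sum_congr rfl fun r hr => ?_
  rcases hC.inComp_or r with h | h
  · have h1 : b.refl • r = r := hC.compl.smul_eq hb.refl_mem (by rwa [compl_compl])
    rw [h1, Root.chi_of_pos (mem_pos.1 hr), zero_mul, zero_mul]
  · rw [mul_smul, hC.smul_eq hu h]

/-! ### Weighted paths -/

variable (S) in
/-- There is a path with `n` edges from `z` to `y` in the quantum Bruhat graph such that the sum of the
coroots attached to its downward edges is `c`. -/
inductive WPath (y : S.W₀) : S.W₀ → ℕ → Λ → Prop
  | nil : WPath y y 0 0
  | cons {z : S.W₀} {n : ℕ} {c : Λ} {b : S.Root} (e : ℤ) (hb : b.Pos) (he : e = 0 ∨ e = 1)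
      (hl : (S.length₀ (z * b.refl) : ℤ) = S.length₀ z + 1 - e * S.twoRho b.co)
      (h : WPath y (z * b.refl) n c) : WPath y z (n + 1) (c + e • b.co)

omit hS in
theorem exists_wPath {y z : S.W₀} {n : ℕ} (h : S.HasPath z y n) : ∃ c, S.WPath y z n c := by
  induction n generalizing z with
  | zero =>
    obtain ⟨p, hp0, hp1, -⟩ := h
    rw [← hp0, hp1]
    exact ⟨0, .nil⟩
  | succ n ih =>
    obtain ⟨p, hp0, hp1, hp⟩ := h
    obtain ⟨c, hc⟩ := ih (z := p 1) ⟨fun k => p (k + 1), rfl, hp1, fun k hk => hp (k + 1) (by omega)⟩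
    have h1 := hp 0 (by omega)
    rw [hp0, zero_add] at h1
    rcases h1 with h1 | h1
    · obtain ⟨b, hb, hz, hl⟩ := h1.exists_refl
      rw [hz] at hc hl
      exact ⟨_, .cons 0 hb (Or.inl rfl) (by rw [hl]; push_cast; ring) hc⟩
    · obtain ⟨b, hb, hz, hl⟩ := h1.exists_refl
      rw [hz] at hc hl
      exact ⟨_, .cons 1 hb (Or.inr rfl) (by rw [hl]; ring) hc⟩

omit hS in
theorem hasPath_of_length₀ {z : S.W₀} {b : S.Root} {e : ℤ} (hb : b.Pos) (he : e = 0 ∨ e = 1)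
    (hl : (S.length₀ (z * b.refl) : ℤ) = S.length₀ z + 1 - e * S.twoRho b.co) :
    S.HasPath z (z * b.refl) 1 := by
  refine HasPath.of_edge ?_
  rcases he with rfl | rfl
  · exact Or.inl (upEdge_refl hb (by rw [zero_mul, sub_zero] at hl; exact_mod_cast hl))
  · exact Or.inr (downEdge_refl hb (by rw [hl]; ring))

omit hS in
theorem WPath.twoRho_eq {y z : S.W₀} {n : ℕ} {c : Λ} (h : S.WPath y z n c) :
    (S.length₀ y : ℤ) = S.length₀ z + n - S.twoRho c := by
  induction h with
  | nil => simp
  | cons e _ _ hl _ ih =>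
    rw [ih, hl, map_add, map_smul, smul_eq_mul]
    push_cast
    ring

theorem WPath.exists_filter {y z : S.W₀} {n : ℕ} {c : Λ} (h : S.WPath y z n c) {C : Set I}
    (hC : S.IsClosed C) {i : I} (hi : i ∈ C) :
    ∃ u ∈ S.par C, ∃ m k : ℕ, m + k = n ∧ S.root i c ≤ 3 * m ∧
      ∀ a ∈ S.par C, S.HasPath (z * a) (y * u * a) k := by
  induction h with
  | nil => exact ⟨1, one_mem _, 0, 0, rfl, by simp, fun a _ => by rw [mul_one]; exact .refl _⟩
  | @cons z n c b e hb he hl _ ih =>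
    obtain ⟨u, hu, m, k, hmk, hc, hp⟩ := ih
    rcases hC.inComp_or b with h | h
    · refine ⟨u * b.refl, mul_mem hu h.refl_mem, m + 1, k, by omega, ?_, fun a ha => ?_⟩
      · have h1 := Root.fn_co_le_three b (S.simple i)
        rw [simple_fn] at h1
        rw [map_add, map_smul, smul_eq_mul]
        push_cast
        rcases he with rfl | rfl <;> linarith
      · have h1 := hp (b.refl * a) (mul_mem h.refl_mem ha)
        rwa [← mul_assoc, ← mul_assoc, Root.mul_refl_mul_refl, mul_assoc y] at h1
    · refine ⟨u, hu, m, k + 1, by omega, ?_, fun a ha => ?_⟩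
      · rwa [map_add, map_smul, hC.root_co_eq_zero hi h, smul_zero, add_zero]
      · have h1 := hp a ha
        have h2 : z * b.refl * a = z * a * b.refl := by
          rw [mul_assoc, mul_assoc, (hC.commute ha h.refl_mem).eq]
        have h3 := hC.length₀_mul_refl ha h z
        rw [h2] at h1
        have h4 := (hasPath_of_length₀ hb he (z := z * a) (by linarith)).trans h1
        rwa [add_comm] at h4

theorem length₀_le_componentLength {i : I} {u : S.W₀} (hu : u ∈ S.par {j | S.SameComponent i j}) :
    S.length₀ u ≤ S.componentLength i := by
  refine le_csSup ⟨S.pos.card, ?_⟩ ⟨u, rfl, coe_mem_of_mem_par hu⟩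
  rintro _ ⟨v, rfl, -⟩
  exact length₀_le_card v

theorem WPath.root_le {y z : S.W₀} {n : ℕ} {c : Λ} (h : S.WPath y z n c) (hn : n ≤ S.dΓ z y)
    (i : I) : S.root i c ≤ 3 * S.componentLength i := by
  obtain ⟨u, hu, m, k, hmk, hc, hp⟩ := h.exists_filter (isClosed_component i)
    (Relation.EqvGen.refl i)
  have h1 : S.Reach z (y * u) k := by
    have := hp 1 (one_mem _)
    rw [mul_one, mul_one] at this
    exact ⟨k, this, le_rfl⟩
  have h2 := reach_mul (y * u) u⁻¹
  rw [mul_inv_cancel_right, length₀_inv] at h2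
  have h3 := (h1.trans h2).dΓ_le
  have h4 := length₀_le_componentLength hu
  omega

omit hS in
theorem IsSuperregular.le {l : Λ} (h : S.IsSuperregular l) (i : I) :
    3 * (S.componentLength i : ℤ) + 1 ≤ S.root i l := by
  have h1 := h i
  split_ifs at h1 <;> omega

omit hS in
theorem IsSuperregular.isDominant {l : Λ} (h : S.IsSuperregular l) : S.IsDominant l :=
  fun i => by have := h.le i; omega

theorem WPath.root_sub_pos {y z : S.W₀} {n : ℕ} {c : Λ} (h : S.WPath y z n c) (hn : n ≤ S.dΓ z y)
    {l : Λ} (hl : S.IsSuperregular l) (i : I) : 0 < S.root i (l - c) := by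
  have h1 := h.root_le hn i
  have h2 := hl.le i
  rw [map_sub]
  linarith

theorem length_form_of_regular {l : Λ} (hl : ∀ i, 0 < S.root i l) (x y : S.W₀) :
    (S.length (S.incl x * S.t l * S.incl y) : ℤ) = S.twoRho l + S.length₀ x - S.length₀ y :=
  length_form (fun i => (hl i).le) (fun i hi => absurd hi (hl i).ne') x

theorem WPath.length_eq {y z : S.W₀} {n : ℕ} {c : Λ} (h : S.WPath y z n c) (hn : n ≤ S.dΓ z y)
    {l : Λ} (hl : S.IsSuperregular l) :
    (S.length (S.incl z * S.t (l - c) * S.incl y⁻¹) : ℤ) = S.twoRho l - n := by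
  have h1 := h.twoRho_eq
  rw [length_form_of_regular (h.root_sub_pos hn hl), map_sub, length₀_inv]
  linarith

theorem WPath.bruhatLE {y z : S.W₀} {n : ℕ} {c : Λ} (h : S.WPath y z n c) (hn : n ≤ S.dΓ z y)
    {l : Λ} (hl : S.IsSuperregular l) :
    S.BruhatLE (S.incl z * S.t (l - c) * S.incl y⁻¹) (S.t (y.1 l)) := by
  induction h with
  | nil =>
    have h : S.incl y * S.t (l - 0) * S.incl y⁻¹ = S.t (y.1 l) := by
      refine Wext_ext ?_ ?_
      · rw [right_form, t_right, mul_inv_cancel]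
      · rw [tr_form, tr_t, inv_inv, sub_zero]
    rw [h]
    exact Relation.ReflTransGen.refl
  | @cons z n c b e hb he hlen hp ih =>
    have hn' : n ≤ S.dΓ (z * b.refl) y := by
      have h1 : S.Reach z (z * b.refl) 1 := ⟨1, hasPath_of_length₀ hb he hlen, le_rfl⟩
      have h2 := (h1.trans (reach_dΓ (z * b.refl) y)).dΓ_le
      omega
    have hp' := WPath.cons e hb he hlen hp
    refine Relation.ReflTransGen.head ⟨S.t (-e • (z • b).co) * S.incl (z • b).refl,
      ⟨(z • b).1, (z • b).2, -e, (z • b).refl, (z • b).isReflection_refl, rfl⟩, ?_, ?_⟩ (ih hn')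
    · refine Wext_ext ?_ ?_
      · simp [Root.mul_refl, mul_assoc]
      · rw [tr_form, tr_mul, tr_mul, tr_form, tr_t, tr_incl, right_form, incl_right, add_zero,
          inv_inv, Root.refl_inv, map_smul, ← Root.co_smul (z • b).refl, Root.refl_smul_self,
          Root.neg_co, Root.co_smul, mul_inv_rev, inv_inv]
        have e1 : ((y * z⁻¹).1 (-e • -(z.1 b.co))) = y.1 (e • b.co) := by
          change y.1 (z.1.symm _) = _
          rw [smul_neg, neg_smul, neg_neg, map_smul, LinearEquiv.symm_apply_apply]
        rw [e1, ← map_add]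
        congr 1
        abel
    · have h1 := hp'.length_eq hn hl
      have h2 := hp.length_eq hn' hl
      have : (S.length (S.incl z * S.t (l - (c + e • b.co)) * S.incl y⁻¹) : ℤ) <
          S.length (S.incl (z * b.refl) * S.t (l - c) * S.incl y⁻¹) := by
        rw [h1, h2]; push_cast; linarith
      exact_mod_cast this

/-- The maximum of `ℓ(w) + ℓ(η_σ(w))` over the admissible set is attained. -/
theorem exists_mem_adm_length_add_length_η_eq (σ : S.W₀ ≃* S.W₀)
    (hσ : ∀ u, S.length₀ (σ u) = S.length₀ u) {l : Λ} (hl : S.IsSuperregular l) :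
    ∃ w ∈ S.Adm l, (S.length w : ℤ) + S.length₀ (S.η σ w) =
      S.twoRho l + S.length₀ S.longest - minDist σ := by
  obtain ⟨x, hx⟩ : minDist σ ∈ Set.range fun x : S.W₀ => S.dΓ x (σ x * S.longest) :=
    Nat.sInf_mem ⟨_, 1, rfl⟩
  set y := σ x * S.longest with hy
  obtain ⟨c, hc⟩ := exists_wPath (hasPath_dΓ x y)
  refine ⟨_, ⟨y, hc.bruhatLE le_rfl hl⟩, ?_⟩
  rw [hc.length_eq le_rfl hl, η_form σ (hc.root_sub_pos le_rfl hl), ← hx]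
  have h1 : σ.symm y⁻¹ * x = (σ.symm S.longest)⁻¹ := by
    rw [hy, mul_inv_rev, map_mul, map_inv, map_inv, MulEquiv.symm_apply_apply, inv_mul_cancel_right]
  rw [h1, length₀_inv, ← hσ, MulEquiv.apply_symm_apply]
  ring

end FiniteType

/-! ### Automorphisms -/

theorem IsAut.inv {g : Λ ≃ₗ[ℤ] Λ} (hg : S.IsAut g) : S.IsAut g⁻¹ := by
  obtain ⟨π, h1, h2⟩ := hg
  refine ⟨π.symm, fun i => ?_, fun i l => ?_⟩
  · have h := h1 (π.symm i)
    rw [Equiv.apply_symm_apply] at h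
    rw [← h]
    exact g.symm_apply_apply _
  · have h := h2 (π.symm i) (g⁻¹ l)
    rw [Equiv.apply_symm_apply] at h
    rw [← h]
    congr 1
    exact g.apply_symm_apply _

theorem IsAut.isPos {g : Λ ≃ₗ[ℤ] Λ} (hg : S.IsAut g) {a : Module.Dual ℤ Λ} (ha : S.IsPos a) :
    S.IsPos (a ∘ₗ g.symm.toLinearMap) := by
  obtain ⟨π, h1, h2⟩ := hg
  induction ha using AddSubmonoid.closure_induction with
  | mem x hx =>
    obtain ⟨i, rfl⟩ := hx
    refine AddSubmonoid.subset_closure ⟨π i, LinearMap.ext fun l => ?_⟩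
    have h := h2 i (g.symm l)
    rwa [LinearEquiv.apply_symm_apply] at h
  | zero => rw [LinearMap.zero_comp]; exact zero_mem _
  | add x y _ _ hx hy =>
    rw [LinearMap.add_comp]
    exact IsPos.add hx hy

theorem IsAut.movePair_mem {g : Λ ≃ₗ[ℤ] Λ} (hg : S.IsAut g) {u v : S.W₀}
    (huv : v.1 = g * u.1 * g⁻¹) {r : Pair Λ}
    (hr : r ∈ {r ∈ S.posRoots | S.IsPos (-(movePair u.1 r).1)}) :
    movePair g r ∈ {r ∈ S.posRoots | S.IsPos (-(movePair v.1 r).1)} := by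
  obtain ⟨⟨⟨h, hh, i, rfl⟩, hpos⟩, hneg⟩ := hr
  refine ⟨⟨?_, hg.isPos hpos⟩, ?_⟩
  · have hg' := hg
    obtain ⟨π, h1, h2⟩ := hg
    refine ⟨g * h * g⁻¹, ?_, π i, ?_⟩
    · have : g * h * g⁻¹ ∈ S.W₀.map (MulAut.conj g).toMonoidHom := ⟨h, hh, rfl⟩
      rwa [hg'.map_W₀] at this
    · have h3 : movePair g (S.root i, S.coroot i) = (S.root (π i), S.coroot (π i)) := by
        refine Prod.ext (LinearMap.ext fun l => ?_) (h1 i)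
        have h := h2 i (g.symm l)
        rw [LinearEquiv.apply_symm_apply] at h
        exact h.symm
      rw [← h3, ← movePair_mul, ← movePair_mul, inv_mul_cancel_right]
  · have h3 : ∀ p : Pair Λ, movePair v.1 (movePair g p) = movePair g (movePair u.1 p) := fun p => by
      rw [huv, ← movePair_mul, ← movePair_mul, inv_mul_cancel_right]
    rw [h3]
    exact hg.isPos hneg

theorem length₀_conjW₀ {g : Λ ≃ₗ[ℤ] Λ} (hg : S.IsAut g) (u : S.W₀) :
    S.length₀ (S.conjW₀ g hg u) = S.length₀ u := by
  have hinj : Function.Injective (movePair g) := Function.LeftInverse.injective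
    (g := movePair g⁻¹) fun r => by rw [← movePair_mul, inv_mul_cancel]; rfl
  refine Eq.trans ?_ (Set.ncard_image_of_injective _ hinj)
  rw [length₀]
  congr 1
  ext r
  constructor
  · intro hr
    refine ⟨movePair g⁻¹ r, hg.inv.movePair_mem (u := S.conjW₀ g hg u) ?_ hr, ?_⟩
    · rw [conjW₀_coe]; group
    · rw [← movePair_mul, mul_inv_cancel]; rfl
  · rintro ⟨r, hr, rfl⟩
    exact hg.movePair_mem (S.conjW₀_coe g hg u) hr

end SimpleRoots

namespace GaloisRootDatum

variable {ι X Y : Type*} [Finite ι] [AddCommGroup X] [AddCommGroup Y] [Module.Finite ℤ Y]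
  (D : GaloisRootDatum ι X Y)

/-! ### The Cartan matrix of the absolute root system -/

/-- The matrix of the pairings of the absolute simple roots with the absolute simple coroots. -/
noncomputable def cartan : Matrix D.base.support D.base.support ℤ :=
  fun j k => D.P.root' j (D.P.coroot k)

open Classical in
theorem det_cartan_ne_zero : D.cartan.det ≠ 0 := by
  have := Fintype.ofFinite ι
  intro hdet
  obtain ⟨v, hv, hvA⟩ := Matrix.exists_vecMul_eq_zero_iff.2 hdet
  set s : X := ∑ j : D.base.support, v j • D.P.root j with hs
  have h0 : ∀ c ∈ Submodule.span ℤ (Set.range D.P.coroot), D.P.toLinearMap s c = 0 := by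
    have hle : Submodule.span ℤ (Set.range D.P.coroot) ≤ LinearMap.ker (D.P.toLinearMap s) := by
      have h : Submodule.span ℤ (D.P.coroot '' D.base.support) =
        Submodule.span ℤ (Set.range D.P.coroot) := D.base.span_coroot_support
      rw [← h, Submodule.span_le]
      rintro _ ⟨k, hk, rfl⟩
      have := congrFun hvA ⟨k, hk⟩
      rw [SetLike.mem_coe, LinearMap.mem_ker, hs, map_sum, LinearMap.sum_apply]
      simpa [Matrix.vecMul, dotProduct, cartan] using this
    exact fun c hc => hle hc
  have hmem : s ∈ D.P.rootSpan ℤ :=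
    Submodule.sum_mem _ fun j _ => Submodule.smul_mem _ _ (Submodule.subset_span ⟨j, rfl⟩)
  have hform : D.P.RootForm s s = 0 := by
    rw [D.P.rootForm_apply_apply]
    refine Finset.sum_eq_zero fun k _ => ?_
    have : D.P.coroot' k s = 0 := h0 _ (Submodule.subset_span ⟨k, rfl⟩)
    rw [this, mul_zero]
  have hs0 : s = 0 := by
    by_contra hne
    have h1 := D.P.posRootForm_posForm_pos_of_ne_zero ℤ (x := ⟨s, hmem⟩)
      (fun h => hne (congrArg Subtype.val h))
    have h2 := D.P.algebraMap_posRootForm_posForm ℤ ⟨s, hmem⟩ ⟨s, hmem⟩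
    simp only [algebraMap_int_eq, eq_intCast, Int.cast_id] at h2
    rw [h2, hform] at h1
    exact lt_irrefl _ h1
  have hli : LinearIndependent ℤ fun j : D.base.support => D.P.root j := D.base.linearIndepOn_root
  exact hv (funext fun j => linearIndependent_iff'.1 hli Finset.univ v hs0 j (Finset.mem_univ j))

theorem root'_simple_coroot_nonpos {j k : D.base.support} (h : j ≠ k) :
    D.P.root' j (D.P.coroot k) ≤ 0 := by
  have h1 := D.base.pairingIn_le_zero_of_ne (i := j) (j := k) (fun h' => h (Subtype.ext h')) j.2 k.2
  have h2 := D.P.algebraMap_pairingIn ℤ j k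
  simp only [algebraMap_int_eq, eq_intCast, Int.cast_id] at h2
  rw [h2] at h1
  exact h1

/-! ### Products of pairwise orthogonal reflections -/

/-- `h` is an automorphism of `Y` that permutes the absolute roots and coroots compatibly. -/
def IsRootAut (h : Y ≃ₗ[ℤ] Y) (π : Equiv.Perm ι) : Prop :=
  (∀ i, h (D.P.coroot i) = D.P.coroot (π i)) ∧ ∀ i y, D.P.root' (π i) (h y) = D.P.root' i y

variable {D} in
theorem IsRootAut.mul {h h' : Y ≃ₗ[ℤ] Y} {π π' : Equiv.Perm ι} (H : D.IsRootAut h π)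
    (H' : D.IsRootAut h' π') : D.IsRootAut (h * h') (π * π') :=
  ⟨fun i => by rw [LinearEquiv.mul_apply, H'.1, H.1, Equiv.Perm.mul_apply],
    fun i y => by rw [LinearEquiv.mul_apply, Equiv.Perm.mul_apply, H.2, H'.2]⟩

theorem isRootAut_coreflection (k : ι) :
    D.IsRootAut (D.P.coreflection k) (D.P.reflectionPerm k) := by
  refine ⟨fun i => (D.P.coroot_reflectionPerm k i).symm, fun i y => ?_⟩
  have h := D.P.root_reflectionPerm k i
  change D.P.toLinearMap (D.P.root (D.P.reflectionPerm k i)) (D.P.coreflection k y) = _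
  rw [h, D.P.reflection_apply, D.P.coreflection_apply]
  simp [mul_comm]
  ring

open Classical in
/-- The product of the reflections in a set of pairwise orthogonal roots. -/
theorem exists_isRootAut_of_orthogonal (s : Finset ι)
    (hs : ∀ j ∈ s, ∀ k ∈ s, j ≠ k → D.P.root' j (D.P.coroot k) = 0) :
    ∃ (h : Y ≃ₗ[ℤ] Y) (π : Equiv.Perm ι), D.IsRootAut h π ∧
      ∀ y, h y = y - ∑ k ∈ s, D.P.root' k y • D.P.coroot k := by
  induction s using Finset.induction_on with
  | empty => exact ⟨1, 1, ⟨fun _ => rfl, fun _ _ => rfl⟩, fun y => by simp⟩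
  | insert a s ha ih =>
    obtain ⟨h, π, H, hh⟩ := ih fun j hj k hk =>
      hs j (Finset.mem_insert_of_mem hj) k (Finset.mem_insert_of_mem hk)
    refine ⟨D.P.coreflection a * h, _, (D.isRootAut_coreflection a).mul H, fun y => ?_⟩
    have h0 : ∑ k ∈ s, D.P.root' k y * D.P.root' a (D.P.coroot k) = 0 :=
      Finset.sum_eq_zero fun k hk => by
        rw [hs a (Finset.mem_insert_self _ _) k (Finset.mem_insert_of_mem hk)
          (fun h => ha (h ▸ hk)), mul_zero]
    rw [LinearEquiv.mul_apply, D.P.coreflection_apply, hh, Finset.sum_insert ha]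
    simp only [map_sub, map_sum, map_smul, smul_eq_mul, h0, sub_zero]
    abel

end GaloisRootDatum

namespace GaloisRootDatum

variable {ι X Y : Type*} [Finite ι] [AddCommGroup X] [AddCommGroup Y] [Module.Finite ℤ Y]
  (D : GaloisRootDatum ι X Y)

/-! ### Orbits of simple roots -/

theorem mem_orbit_iff_orbit_eq {i j : D.base.support} : j ∈ D.orbit i ↔ D.orbit j = D.orbit i :=
  ⟨D.orbit_eq, fun h => h ▸ D.self_mem_orbit j⟩

open Classical in
theorem sum_mem_of_orbit {M : Type*} [AddCommMonoid M] (N : AddSubmonoid M)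
    {f : D.base.support → M} (h : ∀ i, ∑ j ∈ D.orbit i, f j ∈ N) : ∑ j, f j ∈ N := by
  rw [← Finset.sum_fiberwise_of_maps_to (s := Finset.univ) (t := Finset.univ.image D.orbit)
    (g := D.orbit) fun j _ => Finset.mem_image_of_mem _ (Finset.mem_univ j)]
  refine N.sum_mem fun o ho => ?_
  obtain ⟨i, -, rfl⟩ := Finset.mem_image.1 ho
  convert h i using 2
  ext j
  simp [D.mem_orbit_iff_orbit_eq]

theorem sum_eq_zero_of_orbit {M : Type*} [AddCommMonoid M]
    {f : D.base.support → M} (h : ∀ i, ∑ j ∈ D.orbit i, f j = 0) : ∑ j, f j = 0 :=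
  AddSubmonoid.mem_bot.1 (D.sum_mem_of_orbit ⊥ fun i => AddSubmonoid.mem_bot.2 (h i))

theorem mkQ_inertia {g : Y ≃ₗ[ℤ] Y} (hg : g ∈ D.inertia) (y : Y) :
    D.augmentation.mkQ (g y) = D.augmentation.mkQ y :=
  (Submodule.Quotient.eq _).2 (Submodule.subset_span ⟨g, hg, y, rfl⟩)

theorem mkQ_coroot_of_mem {i j : D.base.support} (h : j ∈ D.orbit i) :
    D.augmentation.mkQ (D.P.coroot j) = D.augmentation.mkQ (D.P.coroot i) := by
  obtain ⟨g, hg, e⟩ := D.mem_orbit.1 h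
  rw [← e, D.mkQ_inertia hg]

theorem orbitSum_eq_of_mem {i j : D.base.support} (h : j ∈ D.orbit i) :
    D.orbitSum j = D.orbitSum i := by
  rw [orbitSum, orbitSum, D.orbit_eq h]

theorem simpleRoots_root_mkQ (i : D.base.support) (y : Y) :
    D.simpleRoots.root i (D.augmentation.mkQ y) =
      2 / D.orbitSum i (D.P.coroot i) * D.orbitSum i y := rfl

theorem simpleRoots_coroot (i : D.base.support) :
    D.simpleRoots.coroot i = D.augmentation.mkQ (D.P.coroot i) := rfl

theorem two_div_orbitSum_pos (i : D.base.support) : 0 < 2 / D.orbitSum i (D.P.coroot i) := by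
  have h1 := D.orbitSum_coroot_le i
  have h2 := D.orbitSum_coroot_pos i
  generalize D.orbitSum i (D.P.coroot i) = k at *
  interval_cases k <;> norm_num

theorem simpleRoots_root_eq_of_mem {i j : D.base.support} (h : j ∈ D.orbit i) :
    D.simpleRoots.root j = D.simpleRoots.root i := by
  refine LinearMap.ext fun l => ?_
  obtain ⟨y, rfl⟩ := D.augmentation.mkQ_surjective l
  rw [simpleRoots_root_mkQ, simpleRoots_root_mkQ, D.orbitSum_eq_of_mem h,
    D.orbitSum_coroot_of_mem h]

open Classical in
theorem sum_erase_orbit_root' {i k : D.base.support} (hk : k ∈ D.orbit i) :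
    ∑ j ∈ (D.orbit i).erase k, D.P.root' j (D.P.coroot k) =
      D.orbitSum i (D.P.coroot i) - 2 := by
  rw [← D.orbitSum_coroot_of_mem hk, orbitSum, LinearMap.sum_apply,
    ← Finset.add_sum_erase _ _ hk]
  have : D.P.root' k (D.P.coroot k) = 2 := by simp
  rw [this]
  ring

theorem perm_simple_mem_orbit {g : Y ≃ₗ[ℤ] Y} (hg : g ∈ D.inertia) {i j k : D.base.support}
    (hj : j ∈ D.orbit i) (h : g (D.P.coroot j) = D.P.coroot k) : k ∈ D.orbit i := by
  rw [← D.orbit_eq hj]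
  exact D.mem_orbit.2 ⟨g, hg, h⟩

/-- A set of pairwise orthogonal absolute roots that is stable under inertia, such that the product of
their reflections induces the relative simple reflection attached to `i`. -/
structure IsReflectionSet (i : D.base.support) (s : Finset ι) : Prop where
  orthogonal : ∀ j ∈ s, ∀ k ∈ s, j ≠ k → D.P.root' j (D.P.coroot k) = 0
  stable : ∀ g ∈ D.inertia, ∀ π, D.IsRootAut g π → ∀ k ∈ s, π k ∈ s
  sum_eq : ∀ y, ∑ k ∈ s, D.P.root' k y • D.augmentation.mkQ (D.P.coroot k) =
    D.simpleRoots.root i (D.augmentation.mkQ y) • D.simpleRoots.coroot i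

theorem exists_perm_simple {g : Y ≃ₗ[ℤ] Y} (hg : g ∈ D.inertia) {π : Equiv.Perm ι}
    (hπ : D.IsRootAut g π) (k : D.base.support) : ∃ k' : D.base.support, π k = k' := by
  obtain ⟨ρ, h1, -⟩ := D.exists_perm (D.inertia_aut g hg)
  exact ⟨ρ k, D.P.coroot.injective (by rw [← hπ.1, h1])⟩

open Classical in
theorem isReflectionSet_orbit {i : D.base.support} (h : D.orbitSum i (D.P.coroot i) = 2) :
    D.IsReflectionSet i ((D.orbit i).map (Function.Embedding.subtype _)) := by
  refine ⟨?_, ?_, fun y => ?_⟩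
  · simp only [Finset.mem_map, Function.Embedding.subtype_apply]
    rintro _ ⟨j, hj, rfl⟩ _ ⟨k, hk, rfl⟩ hjk
    have hs := D.sum_erase_orbit_root' hk
    rw [h, sub_self, Finset.sum_eq_zero_iff_of_nonpos fun m hm =>
      D.root'_simple_coroot_nonpos (Finset.ne_of_mem_erase hm)] at hs
    exact hs j (Finset.mem_erase.2 ⟨fun h => hjk (congrArg _ h), hj⟩)
  · simp only [Finset.mem_map, Function.Embedding.subtype_apply]
    rintro g hg π hπ _ ⟨j, hj, rfl⟩
    obtain ⟨k, hk⟩ := D.exists_perm_simple hg hπ j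
    exact ⟨k, D.perm_simple_mem_orbit hg hj (by rw [hπ.1, hk]), hk.symm⟩
  · rw [Finset.sum_map, simpleRoots_root_mkQ, h, simpleRoots_coroot]
    simp only [Function.Embedding.subtype_apply]
    rw [Finset.sum_congr rfl fun k hk => by rw [D.mkQ_coroot_of_mem hk], ← Finset.sum_smul,
      orbitSum, LinearMap.sum_apply]
    norm_num

theorem exists_eq_neg_one_of_sum_eq {α : Type*} [DecidableEq α] {s : Finset α} {f : α → ℤ}
    (h0 : ∀ a ∈ s, f a ≤ 0) (h : ∑ a ∈ s, f a = -1) :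
    ∃ p ∈ s, f p = -1 ∧ ∀ a ∈ s, a ≠ p → f a = 0 := by
  obtain ⟨p, hp, hne⟩ := Finset.exists_ne_zero_of_sum_ne_zero (s := s) (f := f) (by simp [h])
  rw [← Finset.add_sum_erase _ _ hp] at h
  have h1 : ∀ a ∈ s.erase p, f a ≤ 0 := fun a ha => h0 a (Finset.mem_of_mem_erase ha)
  have h2 := Finset.sum_nonpos h1
  have h3 : f p < 0 := lt_of_le_of_ne (h0 p hp) hne
  refine ⟨p, hp, by omega, fun a ha hap => ?_⟩
  exact (Finset.sum_eq_zero_iff_of_nonpos h1).1 (by omega) a (Finset.mem_erase.2 ⟨hap, ha⟩)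

open Classical in
theorem exists_isReflectionSet_of_orbitSum_eq_one {i : D.base.support}
    (h : D.orbitSum i (D.P.coroot i) = 1) : ∃ s, D.IsReflectionSet i s := by
  have : Nonempty D.base.support := ⟨i⟩
  have hp : ∀ k ∈ D.orbit i, ∃ p, (p ∈ D.orbit i ∧ p ≠ k) ∧ D.P.root' p (D.P.coroot k) = -1 ∧
      ∀ j ∈ D.orbit i, j ≠ k → j ≠ p → D.P.root' j (D.P.coroot k) = 0 := by
    intro k hk
    obtain ⟨p, hp, h1, h2⟩ := exists_eq_neg_one_of_sum_eq
      (fun m hm => D.root'_simple_coroot_nonpos (Finset.ne_of_mem_erase hm))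
      ((D.sum_erase_orbit_root' hk).trans (by rw [h]; rfl))
    exact ⟨p, ⟨Finset.mem_of_mem_erase hp, Finset.ne_of_mem_erase hp⟩, h1,
      fun j hj hjk hjp => h2 j (Finset.mem_erase.2 ⟨hjk, hj⟩) hjp⟩
  choose! p hpm hp1 hp0 using hp
  have hpp : ∀ k ∈ D.orbit i, p (p k) = k := by
    intro k hk
    by_contra hne
    have h1 := hp0 (p k) (hpm k hk).1 k hk (hpm k hk).2.symm (Ne.symm hne)
    have h2 : D.P.pairing (p k) k = 0 := D.P.pairing_eq_zero_iff'.1 h1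
    have h3 : D.P.pairing (p k) k = -1 := hp1 k hk
    omega
  let q : D.base.support → ι := fun k => D.P.reflectionPerm (p k) k
  have hqr : ∀ k ∈ D.orbit i, ∀ y, D.P.root' (q k) y = D.P.root' k y + D.P.root' (p k) y := by
    intro k hk y
    have h1 : D.P.pairing k (p k) = -1 := by
      have := hp1 (p k) (hpm k hk).1
      rwa [hpp k hk] at this
    have h2 : D.P.root (q k) = D.P.root k + D.P.root (p k) := by
      rw [D.P.root_reflectionPerm, D.P.reflection_apply_root, h1]
      simp
    simp [RootPairing.root', h2]
  have hqc : ∀ k ∈ D.orbit i, D.P.coroot (q k) = D.P.coroot k + D.P.coroot (p k) := by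
    intro k hk
    have h1 : D.P.pairing (p k) k = -1 := hp1 k hk
    rw [D.P.coroot_reflectionPerm, D.P.coreflection_apply_coroot, h1]
    simp
  have horth : ∀ j ∈ D.orbit i, ∀ k ∈ D.orbit i, j ≠ k → j ≠ p k →
      D.P.root' (q j) (D.P.coroot (q k)) = 0 := by
    intro j hj k hk h1 h2
    have h3 : p j ≠ k := fun e => h2 (by rw [← e, hpp j hj])
    have h4 : p j ≠ p k := fun e => h1 (by rw [← hpp j hj, e, hpp k hk])
    rw [hqr j hj, hqc k hk, map_add, map_add, hp0 k hk j hj h1 h2,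
      hp0 k hk _ (hpm j hj).1 h3 h4, hp0 _ (hpm k hk).1 j hj h2 (by rwa [hpp k hk]),
      hp0 _ (hpm k hk).1 _ (hpm j hj).1 h4 (by rwa [hpp k hk])]
    rfl
  have hqp : ∀ k ∈ D.orbit i, q (p k) = q k := fun k hk =>
    D.P.coroot.injective (by rw [hqc _ (hpm k hk).1, hqc k hk, hpp k hk, add_comm])
  refine ⟨(D.orbit i).image q, ?_, ?_, fun y => ?_⟩
  · simp only [Finset.mem_image]
    rintro _ ⟨j, hj, rfl⟩ _ ⟨k, hk, rfl⟩ hjk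
    exact horth j hj k hk (fun e => hjk (by rw [e])) (fun e => hjk (by rw [e, hqp k hk]))
  · simp only [Finset.mem_image]
    rintro g hg π hπ _ ⟨k, hk, rfl⟩
    obtain ⟨k', hk'⟩ := D.exists_perm_simple hg hπ k
    obtain ⟨m, hm⟩ := D.exists_perm_simple hg hπ (p k)
    have h1 := D.perm_simple_mem_orbit hg hk (by rw [hπ.1, hk'])
    have h2 := D.perm_simple_mem_orbit hg (hpm k hk).1 (by rw [hπ.1, hm])
    have h3 : D.P.root' m (D.P.coroot k') = -1 := by
      rw [← hm, ← hk', ← hπ.1, hπ.2, hp1 k hk]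
    have h4 : m = p k' := by
      by_contra hne
      rcases eq_or_ne m k' with e | e
      · rw [e] at h3
        simp at h3
      · rw [hp0 k' h1 m h2 e hne] at h3
        omega
    refine ⟨k', h1, D.P.coroot.injective ?_⟩
    rw [hqc k' h1, ← hπ.1, hqc k hk, map_add, hπ.1, hπ.1, hk', hm, h4]
  · have h1 : ∀ m ∈ (D.orbit i).image q, D.P.root' m y • D.augmentation.mkQ (D.P.coroot m) =
        (∑ k ∈ D.orbit i with q k = m, D.P.root' k y) •
          ((2 : ℤ) • D.augmentation.mkQ (D.P.coroot i)) := by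
      intro m hm
      obtain ⟨k, hk, rfl⟩ := Finset.mem_image.1 hm
      have hf : {j ∈ D.orbit i | q j = q k} = {k, p k} := by
        ext j
        simp only [Finset.mem_filter, Finset.mem_insert, Finset.mem_singleton]
        constructor
        · rintro ⟨hj, e⟩
          by_contra! hne
          have := horth j hj k hk hne.1 hne.2
          rw [e] at this
          simp at this
        · rintro (rfl | rfl)
          · exact ⟨hk, rfl⟩
          · exact ⟨(hpm k hk).1, hqp k hk⟩
      rw [hf, Finset.sum_pair (hpm k hk).2.symm, hqr k hk, hqc k hk, map_add,
        D.mkQ_coroot_of_mem hk, D.mkQ_coroot_of_mem (hpm k hk).1, two_smul]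
    rw [Finset.sum_congr rfl h1, ← Finset.sum_smul,
      Finset.sum_fiberwise_of_maps_to fun k hk => Finset.mem_image_of_mem q hk,
      simpleRoots_root_mkQ, h, simpleRoots_coroot, orbitSum, LinearMap.sum_apply, smul_smul,
      mul_comm]
    rfl

theorem exists_isReflectionSet (i : D.base.support) : ∃ s, D.IsReflectionSet i s := by
  have h1 := D.orbitSum_coroot_le i
  have h2 := D.orbitSum_coroot_pos i
  obtain h | h : D.orbitSum i (D.P.coroot i) = 1 ∨ D.orbitSum i (D.P.coroot i) = 2 := by omega
  · exact D.exists_isReflectionSet_of_orbitSum_eq_one h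
  · exact ⟨_, D.isReflectionSet_orbit h⟩

/-! ### Lifting the relative Weyl group -/

/-- `h` lifts `u`: it permutes the absolute roots, commutes with inertia and induces `u` on
coinvariants. -/
structure IsLift (u : D.simpleRoots.W₀) (h : Y ≃ₗ[ℤ] Y) (π : Equiv.Perm ι) : Prop where
  isRootAut : D.IsRootAut h π
  comm : ∀ g ∈ D.inertia, ∀ y, h (g y) = g (h y)
  mkQ_eq : ∀ y, D.augmentation.mkQ (h y) = u.1 (D.augmentation.mkQ y)

theorem exists_isLift_sr (i : D.base.support) : ∃ h π, D.IsLift (D.simpleRoots.sr i) h π := by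
  obtain ⟨s, hs⟩ := D.exists_isReflectionSet i
  obtain ⟨h, π, H, hh⟩ := D.exists_isRootAut_of_orthogonal s hs.orthogonal
  refine ⟨h, π, H, fun g hg y => ?_, fun y => ?_⟩
  · obtain ⟨ρ, h1, h2, -⟩ := D.inertia_aut g hg
    have hms : s.map ρ.toEmbedding = s := Finset.eq_of_subset_of_card_le (fun k hk => by
      obtain ⟨j, hj, rfl⟩ := Finset.mem_map.1 hk
      exact hs.stable g hg ρ ⟨h1, h2⟩ j hj) (by simp)
    rw [hh, hh, map_sub, map_sum]
    conv_lhs => rw [← hms]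
    rw [Finset.sum_map]
    simp only [Equiv.coe_toEmbedding, map_smul, h1, h2]
  · rw [hh, map_sub, map_sum, SimpleRoots.sr_apply, ← hs.sum_eq]
    simp only [map_smul]

theorem exists_isLift (u : D.simpleRoots.W₀) : ∃ h π, D.IsLift u h π := by
  induction u using SimpleRoots.W₀_induction with
  | one => exact ⟨1, 1, ⟨fun _ => rfl, fun _ _ => rfl⟩, fun _ _ _ => rfl, fun _ => rfl⟩
  | mul u i ih =>
    obtain ⟨h, π, H⟩ := ih
    obtain ⟨h', π', H'⟩ := D.exists_isLift_sr i
    refine ⟨h * h', π * π', H.isRootAut.mul H'.isRootAut, fun g hg y => ?_, fun y => ?_⟩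
    · rw [LinearEquiv.mul_apply, LinearEquiv.mul_apply, H'.comm g hg, H.comm g hg]
    · rw [LinearEquiv.mul_apply, H.mkQ_eq, H'.mkQ_eq]
      rfl

end GaloisRootDatum

namespace GaloisRootDatum

variable {ι X Y : Type*} [Finite ι] [AddCommGroup X] [AddCommGroup Y] [Module.Finite ℤ Y]
  (D : GaloisRootDatum ι X Y)

/-! ### The relative root system is of finite type -/

theorem orbitSum_apply (i : D.base.support) (y : Y) :
    D.orbitSum i y = ∑ j ∈ D.orbit i, D.P.root' j y := by
  rw [orbitSum, LinearMap.sum_apply]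

theorem exists_perm_of_mem_roots {r : SimpleRoots.Pair D.Coinv} (hr : r ∈ D.simpleRoots.roots) :
    ∃ (i : D.base.support) (π : Equiv.Perm ι),
      (∀ y, r.1 (D.augmentation.mkQ y) =
        2 / D.orbitSum i (D.P.coroot i) * ∑ j ∈ D.orbit i, D.P.root' (π j) y) ∧
      r.2 = D.augmentation.mkQ (D.P.coroot (π i)) ∧
      ∀ j ∈ D.orbit i, ∃ g ∈ D.inertia, ∀ y, D.P.root' (π j) y = D.P.root' (π i) (g y) := by
  obtain ⟨u, hu, i, rfl⟩ := hr
  obtain ⟨h, π, H⟩ := D.exists_isLift ⟨u, hu⟩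
  have hroot : ∀ j y, D.P.root' (π j) y = D.P.root' j (h.symm y) := fun j y => by
    rw [← H.isRootAut.2 j, h.apply_symm_apply]
  refine ⟨i, π, fun y => ?_, ?_, fun j hj => ?_⟩
  · have h1 : u.symm (D.augmentation.mkQ y) = D.augmentation.mkQ (h.symm y) := by
      rw [LinearEquiv.symm_apply_eq, ← H.mkQ_eq, h.apply_symm_apply]
    change D.simpleRoots.root i (u.symm (D.augmentation.mkQ y)) = _
    rw [h1, simpleRoots_root_mkQ, D.orbitSum_apply i (h.symm y)]
    simp only [hroot]
  · change u (D.augmentation.mkQ (D.P.coroot i)) = _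
    rw [← H.isRootAut.1, H.mkQ_eq]
  · obtain ⟨g, hg, e⟩ := D.mem_orbit.1 hj
    obtain ⟨ρ, h1, h2, -⟩ := D.inertia_aut g hg
    have hρ : ρ i = j := D.P.coroot.injective (by rw [← h1, e])
    refine ⟨g⁻¹, inv_mem hg, fun y => ?_⟩
    have h3 : g (h.symm (g⁻¹ y)) = h.symm y := by
      rw [LinearEquiv.eq_symm_apply, H.comm g hg, h.apply_symm_apply]
      exact g.apply_symm_apply y
    rw [hroot, hroot, ← hρ, ← h2 i (h.symm (g⁻¹ y)), h3]

theorem finite_simpleRoots_roots : D.simpleRoots.roots.Finite := by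
  classical
  have hinj : Function.Injective fun r : SimpleRoots.Pair D.Coinv =>
      ((fun y => r.1 (D.augmentation.mkQ y), r.2) : (Y → ℤ) × D.Coinv) := by
    rintro r q h
    obtain ⟨h1, h2⟩ := Prod.ext_iff.1 h
    refine Prod.ext (LinearMap.ext fun l => ?_) h2
    obtain ⟨y, rfl⟩ := D.augmentation.mkQ_surjective l
    exact congrFun h1 y
  refine Set.Finite.subset (Set.Finite.preimage hinj.injOn (Set.finite_range
    fun p : D.base.support × Equiv.Perm ι =>
      ((fun y => 2 / D.orbitSum p.1 (D.P.coroot p.1) * ∑ j ∈ D.orbit p.1, D.P.root' (p.2 j) y,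
        D.augmentation.mkQ (D.P.coroot (p.2 p.1))) : (Y → ℤ) × D.Coinv))) fun r hr => ?_
  obtain ⟨i, π, h1, h2, -⟩ := D.exists_perm_of_mem_roots hr
  exact ⟨(i, π), Prod.ext (funext fun y => (h1 y).symm) h2.symm⟩

open Classical in
/-- A multiple of the fundamental coweight attached to an absolute simple root. -/
noncomputable def absCoweight (i : D.base.support) : Y :=
  ∑ k, (D.cartan.det * D.cartan.adjugate k i) • D.P.coroot k

open Classical in
theorem root'_absCoweight (i j : D.base.support) :
    D.P.root' j (D.absCoweight i) = if j = i then D.cartan.det ^ 2 else 0 := by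
  have h := congrFun (congrFun D.cartan.mul_adjugate j) i
  rw [Matrix.mul_apply, Matrix.smul_apply, Matrix.one_apply, smul_eq_mul] at h
  have h2 : D.P.root' j (D.absCoweight i) =
      D.cartan.det * ∑ k, D.cartan j k * D.cartan.adjugate k i := by
    rw [absCoweight, map_sum, Finset.mul_sum]
    refine Finset.sum_congr rfl fun k _ => ?_
    rw [map_smul, smul_eq_mul, cartan]
    ring
  rw [h2, h]
  split_ifs <;> ring

open Classical in
theorem orbitSum_absCoweight (i j : D.base.support) :
    D.orbitSum j (D.absCoweight i) = if i ∈ D.orbit j then D.cartan.det ^ 2 else 0 := by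
  rw [orbitSum, LinearMap.sum_apply]
  simp only [root'_absCoweight]
  rw [Finset.sum_ite_eq' (D.orbit j) i]

theorem root'_nonneg_or_nonpos (m : ι) :
    (∀ y, (∀ k : D.base.support, 0 ≤ D.P.root' k y) → 0 ≤ D.P.root' m y) ∨
      ∀ y, (∀ k : D.base.support, 0 ≤ D.P.root' k y) → D.P.root' m y ≤ 0 := by
  have key : ∀ f : ι → ℕ, ∀ y, (∀ k : D.base.support, 0 ≤ D.P.root' k y) →
      0 ≤ D.P.toLinearMap (∑ j ∈ D.base.support, f j • D.P.root j) y := by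
    intro f y hy
    rw [map_sum, LinearMap.sum_apply]
    refine Finset.sum_nonneg fun j hj => ?_
    rw [map_nsmul, LinearMap.smul_apply]
    exact nsmul_nonneg (hy ⟨j, hj⟩) _
  obtain ⟨f, -, h | h⟩ := D.base.exists_root_eq_sum_nat_or_neg m
  · left
    intro y hy
    have := key f y hy
    rwa [← h] at this
  · right
    intro y hy
    have h1 := key f y hy
    have h2 : D.P.root' m y = - D.P.toLinearMap (∑ j ∈ D.base.support, f j • D.P.root j) y := by
      change D.P.toLinearMap (D.P.root m) y = _
      rw [h, map_neg, LinearMap.neg_apply]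
    omega

theorem nonneg_or_nonpos_of_mem_roots {r : SimpleRoots.Pair D.Coinv}
    (hr : r ∈ D.simpleRoots.roots) :
    (∀ y, (∀ k : D.base.support, 0 ≤ D.P.root' k y) → 0 ≤ r.1 (D.augmentation.mkQ y)) ∨
      ∀ y, (∀ k : D.base.support, 0 ≤ D.P.root' k y) → r.1 (D.augmentation.mkQ y) ≤ 0 := by
  obtain ⟨i, π, h1, -, h3⟩ := D.exists_perm_of_mem_roots hr
  have hdom : ∀ g ∈ D.inertia, ∀ y, (∀ k : D.base.support, 0 ≤ D.P.root' k y) →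
      ∀ k : D.base.support, 0 ≤ D.P.root' k (g y) := by
    intro g hg y hy k
    obtain ⟨ρ, -, h2⟩ := D.exists_perm (D.inertia_aut g hg)
    have := hy (ρ.symm k)
    rwa [← h2, ρ.apply_symm_apply] at this
  have hc := D.two_div_orbitSum_pos i
  refine (D.root'_nonneg_or_nonpos (π i)).imp (fun h y hy => ?_) fun h y hy => ?_
  · rw [h1]
    refine mul_nonneg hc.le (Finset.sum_nonneg fun j hj => ?_)
    obtain ⟨g, hg, e⟩ := h3 j hj
    rw [e]
    exact h _ (hdom g hg y hy)
  · rw [h1]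
    refine mul_nonpos_of_nonneg_of_nonpos hc.le (Finset.sum_nonpos fun j hj => ?_)
    obtain ⟨g, hg, e⟩ := h3 j hj
    rw [e]
    exact h _ (hdom g hg y hy)

theorem mem_span_root_of_mem_roots {r : SimpleRoots.Pair D.Coinv}
    (hr : r ∈ D.simpleRoots.roots) :
    r.1 ∈ Submodule.span ℤ (Set.range D.simpleRoots.root) := by
  obtain ⟨g, hg, i, rfl⟩ := hr
  have key : ∀ u : D.simpleRoots.W₀, ∀ a ∈ Submodule.span ℤ (Set.range D.simpleRoots.root),
      a ∘ₗ u.1.symm.toLinearMap ∈ Submodule.span ℤ (Set.range D.simpleRoots.root) := by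
    intro u
    induction u using SimpleRoots.W₀_induction with
    | one => exact fun a ha => ha
    | mul u i ih =>
      intro a ha
      have h1 : a ∘ₗ (D.simpleRoots.sr i).1.symm.toLinearMap =
          a - a (D.simpleRoots.coroot i) • D.simpleRoots.root i := by
        refine LinearMap.ext fun l => ?_
        change a ((D.simpleRoots.sr i)⁻¹.1 l) = _
        rw [SimpleRoots.sr_inv, SimpleRoots.sr_apply]
        simp [mul_comm]
      change (a ∘ₗ (D.simpleRoots.sr i).1.symm.toLinearMap) ∘ₗ u.1.symm.toLinearMap ∈ _
      rw [h1]
      exact ih _ (sub_mem ha (Submodule.smul_mem _ _ (Submodule.subset_span ⟨i, rfl⟩)))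
  exact key ⟨g, hg⟩ _ (Submodule.subset_span ⟨i, rfl⟩)

theorem isPos_of_nonneg {a : Module.Dual ℤ D.Coinv}
    (h1 : a ∈ Submodule.span ℤ (Set.range D.simpleRoots.root))
    (h2 : ∀ y, (∀ k : D.base.support, 0 ≤ D.P.root' k y) → 0 ≤ a (D.augmentation.mkQ y)) :
    D.simpleRoots.IsPos a := by
  classical
  obtain ⟨n, rfl⟩ := (Submodule.mem_span_range_iff_exists_fun ℤ).1 h1
  refine D.sum_mem_of_orbit _ fun i => ?_
  rw [Finset.sum_congr rfl fun j hj => by rw [D.simpleRoots_root_eq_of_mem hj], ← Finset.sum_smul]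
  have hn : 0 ≤ ∑ j ∈ D.orbit i, n j := by
    have h3 := h2 (D.absCoweight i) fun k => by
      rw [root'_absCoweight]
      split_ifs <;> positivity
    have h4 : ∀ j, (n j • D.simpleRoots.root j) (D.augmentation.mkQ (D.absCoweight i)) =
        if j ∈ D.orbit i then
          n j * (2 / D.orbitSum i (D.P.coroot i) * D.cartan.det ^ 2) else 0 := by
      intro j
      rw [LinearMap.smul_apply, simpleRoots_root_mkQ, orbitSum_absCoweight, smul_eq_mul]
      have : i ∈ D.orbit j ↔ j ∈ D.orbit i := by
        rw [mem_orbit_iff_orbit_eq, mem_orbit_iff_orbit_eq, eq_comm]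
      rw [if_congr this rfl rfl]
      split_ifs with h
      · rw [D.orbitSum_eq_of_mem h, D.orbitSum_coroot_of_mem h]
      · ring
    rw [LinearMap.sum_apply, Finset.sum_congr rfl fun j _ => h4 j, Finset.sum_ite_mem,
      Finset.univ_inter, ← Finset.sum_mul] at h3
    exact nonneg_of_mul_nonneg_left h3 (mul_pos (D.two_div_orbitSum_pos i)
      (sq_pos_of_ne_zero D.det_cartan_ne_zero))
  obtain ⟨m, hm⟩ := Int.eq_ofNat_of_zero_le hn
  rw [hm, natCast_zsmul]
  exact nsmul_mem (AddSubmonoid.subset_closure (Set.mem_range_self i)) _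

open Classical in
theorem adjugate_cartan_perm {g : Y ≃ₗ[ℤ] Y} {ρ : Equiv.Perm D.base.support}
    (h1 : ∀ i : D.base.support, g (D.P.coroot i) = D.P.coroot (ρ i))
    (h2 : ∀ (i : D.base.support) y, D.P.root' (ρ i) (g y) = D.P.root' i y) (j k) :
    D.cartan.adjugate (ρ j) (ρ k) = D.cartan.adjugate j k := by
  have h : D.cartan.submatrix ρ ρ = D.cartan := by
    ext j k
    change D.P.root' (ρ j) (D.P.coroot (ρ k)) = D.P.root' j (D.P.coroot k)
    rw [← h1, h2]
  conv_rhs => rw [← h, Matrix.adjugate_submatrix_equiv_self]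
  rfl

theorem eq_zero_of_mem_span_coroot {c : D.Coinv}
    (hc : c ∈ Submodule.span ℤ (Set.range D.simpleRoots.coroot))
    (h0 : ∀ i, D.simpleRoots.root i c = 0) : c = 0 := by
  classical
  obtain ⟨n, rfl⟩ := (Submodule.mem_span_range_iff_exists_fun ℤ).1 hc
  set x : Y := ∑ k : D.base.support, n k • D.P.coroot k with hx
  have hcx : ∑ k, n k • D.simpleRoots.coroot k = D.augmentation.mkQ x := by
    rw [hx, map_sum]
    simp only [map_smul, simpleRoots_coroot]
  have hx0 : ∀ i, ∑ j ∈ D.orbit i, D.P.root' j x = 0 := by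
    intro i
    have h := h0 i
    rw [hcx, simpleRoots_root_mkQ, mul_eq_zero, D.orbitSum_apply i x] at h
    exact h.resolve_left (D.two_div_orbitSum_pos i).ne'
  have hdet : ∀ k, ∑ j, D.cartan.adjugate k j * D.P.root' j x = D.cartan.det * n k := by
    intro k
    have h1 : ∀ j : D.base.support, D.P.root' j x = D.cartan.mulVec n j := by
      intro j
      rw [hx, map_sum, Matrix.mulVec, dotProduct]
      refine Finset.sum_congr rfl fun k _ => ?_
      rw [map_smul, smul_eq_mul, cartan, mul_comm]
    have h2 := congrFun (Matrix.mulVec_mulVec n D.cartan.adjugate D.cartan) k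
    rw [D.cartan.adjugate_mul, Matrix.smul_mulVec, Matrix.one_mulVec, Pi.smul_apply,
      smul_eq_mul] at h2
    rw [← h2, Matrix.mulVec, dotProduct]
    simp only [h1]
  refine D.sum_eq_zero_of_orbit fun i => ?_
  have hn : ∑ k ∈ D.orbit i, n k = 0 := by
    have h3 : D.cartan.det * ∑ k ∈ D.orbit i, n k =
        ∑ j, (∑ k ∈ D.orbit i, D.cartan.adjugate k j) * D.P.root' j x := by
      rw [Finset.mul_sum]
      simp only [← hdet, Finset.sum_mul]
      exact Finset.sum_comm
    have h4 : ∑ j, (∑ k ∈ D.orbit i, D.cartan.adjugate k j) * D.P.root' j x = 0 := by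
      refine D.sum_eq_zero_of_orbit fun m => ?_
      have h5 : ∀ j ∈ D.orbit m, ∑ k ∈ D.orbit i, D.cartan.adjugate k j =
          ∑ k ∈ D.orbit i, D.cartan.adjugate k m := by
        intro j hj
        obtain ⟨g, hg, e⟩ := D.mem_orbit.1 hj
        obtain ⟨ρ, h1, h2⟩ := D.exists_perm (D.inertia_aut g hg)
        have hρ : ρ m = j := Subtype.ext (D.P.coroot.injective (by rw [← h1, e]))
        symm
        refine Finset.sum_equiv ρ (fun k => ?_) fun k _ => ?_
        · rw [mem_orbit_iff_orbit_eq, mem_orbit_iff_orbit_eq,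
            D.orbit_eq (D.mem_orbit.2 ⟨g, hg, h1 k⟩)]
        · rw [← hρ, D.adjugate_cartan_perm h1 h2]
      rw [Finset.sum_congr rfl fun j hj => by rw [h5 j hj], ← Finset.mul_sum, hx0, mul_zero]
    exact (mul_eq_zero.1 (h3.trans h4)).resolve_left D.det_cartan_ne_zero
  rw [Finset.sum_congr rfl fun k hk => by
    rw [simpleRoots_coroot, D.mkQ_coroot_of_mem hk], ← Finset.sum_smul, hn, zero_smul]

instance : D.simpleRoots.IsFiniteType where
  finite_roots := D.finite_simpleRoots_roots
  isPos_or_isPos_neg r hr := by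
    have h := D.mem_span_root_of_mem_roots hr
    refine (D.nonneg_or_nonpos_of_mem_roots hr).imp (D.isPos_of_nonneg h) fun h' =>
      D.isPos_of_nonneg (neg_mem h) fun y hy => ?_
    rw [LinearMap.neg_apply]
    exact neg_nonneg.2 (h' y hy)
  exists_coweight i := by
    refine ⟨D.augmentation.mkQ (D.absCoweight i), fun j hj => ?_, fun j hj => ?_⟩
    · rw [hj, simpleRoots_root_mkQ, orbitSum_absCoweight, if_pos (D.self_mem_orbit i)]
      exact mul_pos (D.two_div_orbitSum_pos i) (sq_pos_of_ne_zero D.det_cartan_ne_zero)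
    · rw [simpleRoots_root_mkQ, orbitSum_absCoweight, if_neg, mul_zero]
      exact fun h => hj (D.simpleRoots_root_eq_of_mem h).symm
  eq_zero_of_mem_span_coroot _ := D.eq_zero_of_mem_span_coroot

end GaloisRootDatum
theorem SimpleRoots.pairRho_tmul {Λ I : Type*} [AddCommGroup Λ] (S : SimpleRoots Λ I) (q : ℚ) (l : Λ) :
    S.pairRho (q ⊗ₜ[ℤ] l) = q * (S.twoRho l : ℚ) / 2 := rfl

theorem mainTheorem4 {F L Ω H : Type u} [Field F] [ValuativeRel F] [TopologicalSpace F]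
    [IsNonarchimedeanLocalField F] [Field L] [Algebra F L] [Field Ω] [Algebra F Ω] [Algebra L Ω]
    [IsScalarTower F L Ω] [IsAlgClosure L Ω] [CommRing H] [HopfAlgebra F H]
    (U : UnramifiedCompletion F L) (G : QuasiSplitGroup F H Ω)
    {ι X Y : Type*} [Finite ι] [AddCommGroup X] [AddCommGroup Y] [Module.Finite ℤ Y]
    (D : GaloisRootDatum ι X Y) (R : RootDatumIdentification U G D)
    (μ : Y) (hμ : ∀ i ∈ D.base.support, 0 ≤ D.P.root' i μ)
    (hreg : D.simpleRoots.IsSuperregular (D.augmentation.mkQ μ)) (b : Pt F H L) :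
    IsGreatest {d : ℚ | ∃ w ∈ D.simpleRoots.Adm (D.augmentation.mkQ μ), d = R.virtualDim w b}
      (D.simpleRoots.pairRho (1 ⊗ₜ[ℤ] D.augmentation.mkQ μ - R.newtonPoint b)
        - 1 / 2 * (defect U b : ℚ) + 1 / 2 * (D.simpleRoots.length₀ D.simpleRoots.longest : ℚ)
        - 1 / 2 * ((sInf (Set.range fun x : D.simpleRoots.W₀ =>
            D.simpleRoots.dΓ x (D.σW x * D.simpleRoots.longest)) : ℕ) : ℚ)) := by
  have hσ : ∀ u, D.simpleRoots.length₀ (D.σW u) = D.simpleRoots.length₀ u :=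
    SimpleRoots.length₀_conjW₀ D.σ_isAut
  have hρ : D.simpleRoots.pairRho (1 ⊗ₜ[ℤ] D.augmentation.mkQ μ - R.newtonPoint b) =
      (D.simpleRoots.twoRho (D.augmentation.mkQ μ) : ℚ) / 2 -
        D.simpleRoots.pairRho (R.newtonPoint b) := by
    rw [map_sub, SimpleRoots.pairRho_tmul, one_mul]
  rw [hρ]
  constructor
  · obtain ⟨w, hw, h⟩ := SimpleRoots.exists_mem_adm_length_add_length_η_eq D.σW hσ hreg
    refine ⟨w, hw, ?_⟩
    have h' := congrArg (Int.cast : ℤ → ℚ) h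
    rw [SimpleRoots.minDist] at h'
    push_cast at h'
    rw [RootDatumIdentification.virtualDim]
    linarith
  · rintro _ ⟨w, hw, rfl⟩
    have h := SimpleRoots.length_add_length_η_le hσ hreg.isDominant hw
    have h' := (Int.cast_le (R := ℚ)).2 h
    rw [SimpleRoots.minDist] at h'
    push_cast at h'
    rw [RootDatumIdentification.virtualDim]
    linarith
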